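/- Let $n,\ell\ge 0$ be integers, let $R_{2n}$ be the ring of symmetric polynomials in $x_1,\dots,x_{2n}$ over $\mathbb{C}$, and let $H^{(2n)}=\bigoplus_{k=0}^{2n-1}R_{2n}X^k$. Identify $\wedge^\ell H^{(2n)}$ with the $R_{2n}$-module of antisymmetric polynomials $P(X_1,\dots,X_\ell|x_1,\dots,x_{2n})$ of degree less than $2n$ in each $X_a$ with coefficients in $R_{2n}$. Put $$\rho_\pm(P)=P(X_1,\dots,X_{\ell-1},\pm x^{-1}\,|\,x_1,\dots,x_{2n-2},x,-x),$$ $$U_{2n,\ell}=\{P\in\wedge^\ell H^{(2n)} : \rho_+(P)=\rho_-(P)=0\},$$ where for $\ell=0$ no condition is imposed, i.e. $U_{2n,0}=R_{2n}$. Let $e_k$ be the $k$-th elementary symmetric polynomial in $x_1,\dots,x_{2n}$ ($e_k=0$ for $k<0$ or $k>2n$), and define $P_{1,s}=e_{2s-1}$ and $P_{r,s}=P_{r-1,s+1}-e_{2s}P_{r-1,1}$ for $r\ge 2$, $s\in\mathbb{Z}$. For $r,k\ge1$ set $$v_0=\sum_{j=0}^n e_{2j}X^{2j},\qquad v_r=\sum_{s=1}^n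 P_{r,s}X^{2(s-1)},\qquad w_r=Xv_r,$$ $$2\xi_k(X_1,X_2)=\frac{X_1-X_2}{X_1+X_2}\bigl(v_0(X_1)w_k(X_2)+v_0(X_2)w_k(X_1)\bigr)-v_0(X_1)w_k(X_2)+v_0(X_2)w_k(X_1),$$ the last being a polynomial. For antisymmetric $u_1,\dots,u_m$ in $\ell_1,\dots,\ell_m$ variables with $\ell_1+\dots+\ell_m=\ell$ let $$u_1\wedge\cdots\wedge u_m=\sum_{\sigma\in S_\ell}\operatorname{sgn}(\sigma)\,u_1(X_{\sigma(1)},\dots,X_{\sigma(\ell_1)})\cdots u_m(X_{\sigma(\ell_1+\cdots+\ell_{m-1}+1)},\dots,X_{\sigma(\ell)}),$$ and write $v_I=v_{i_1}\wedge\cdots\wedge v_{i_{\ell_1}}$ for $I=(i_1,\dots,i_{\ell_1})$, and similarly $w_J$, $\xi_K$. **Theorem.** $U_{2n,\ell}$ is a free $R_{2n}$-module of rank $\binom{2n}{\ell}$, and a basis is given by the family of elements $v_I\wedge w_J\wedge\xi_K$ (where the $m$-fold product above is taken over all the factors $v_{i_a}$, $w_{j_b}$, $\xi_{k_c}$ at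 once), indexed by all triples $I=(i_1,\dots,i_{\ell_1})$, $J=(j_1,\dots,j_{\ell_2})$, $K=(k_1,\dots,k_{\ell_3})$ of integer sequences, $\ell_1,\ell_2,\ell_3\ge0$, satisfying $$1\le i_1<\cdots<i_{\ell_1}\le n,\qquad 1\le j_1<\cdots<j_{\ell_2}\le n-\ell_1-\ell_3,$$ $$1\le k_1\le\cdots\le k_{\ell_3}\le n-\ell_1-\ell_3+1,\qquad \ell_1+\ell_2+2\ell_3=\ell.$$ -/

import Mathlib

open MvPolynomial

noncomputable section

/-- The ring of symmetric polynomials in `x_1, …, x_N` over `ℂ`. -/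
def SymRing (N : ℕ) : Type := symmetricSubalgebra (Fin N) ℂ

instance (N : ℕ) : CommRing (SymRing N) := inferInstanceAs (CommRing (symmetricSubalgebra (Fin N) ℂ))

/-- A symmetric polynomial as a polynomial in `x_1, …, x_N`. -/
def SymRing.toPoly (N : ℕ) : SymRing N →+* MvPolynomial (Fin N) ℂ :=
  (symmetricSubalgebra (Fin N) ℂ).val.toRingHom

/-- The exterior power `∧^ℓ H`, where `H` is the free module over `SymRing N` on
`1, X, …, X^(N-1)`, realised as the space of antisymmetric polynomials in `X_1, …, X_ℓ` with
coefficients in `SymRing N` and of degree less than `N` in each variable. -/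
def extPower (N ℓ : ℕ) : Submodule (SymRing N) (MvPolynomial (Fin ℓ) (SymRing N)) where
  carrier := {P | (∀ σ : Equiv.Perm (Fin ℓ), rename σ P = (Equiv.Perm.sign σ : ℤ) • P) ∧
    ∀ d ∈ P.support, ∀ a, d a < N}
  zero_mem' := by simp
  add_mem' := by
    rintro P Q ⟨hP, hP'⟩ ⟨hQ, hQ'⟩
    refine ⟨fun σ => by rw [map_add, hP, hQ, smul_add], fun d hd a => ?_⟩
    rcases Finset.mem_union.1 (support_add hd) with h | h
    exacts [hP' d h a, hQ' d h a]
  smul_mem' := by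
    rintro c P ⟨hP, hP'⟩
    exact ⟨fun σ => by rw [map_smul, hP, smul_comm], fun d hd a => hP' d (support_smul hd) a⟩

/-- Laurent polynomials in `x` with coefficients in `ℂ[x_1, …, x_(N-2)]`. -/
abbrev LaurentRing (N : ℕ) : Type := LaurentPolynomial (MvPolynomial (Fin (N - 2)) ℂ)

/-- The substitution `f ↦ f(x_1, …, x_(N-2), x, -x)`. -/
def bar (N : ℕ) : SymRing N →+* LaurentRing N :=
  (aeval fun j : Fin N =>
    if h : (j : ℕ) < N - 2 then (LaurentPolynomial.C (X ⟨j, h⟩) : LaurentRing N)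
    else if (j : ℕ) + 2 = N then LaurentPolynomial.T 1
    else -LaurentPolynomial.T 1 : MvPolynomial (Fin N) ℂ →ₐ[ℂ] LaurentRing N).toRingHom.comp
  (SymRing.toPoly N)

/-- `P ↦ P(X_1, …, X_m, ε x⁻¹ | x_1, …, x_(N-2), x, -x)` for a sign `ε`; here `P` depends on
`m + 1` variables `X_a`. -/
def rho (N : ℕ) {m : ℕ} (ε : ℤˣ) :
    MvPolynomial (Fin (m + 1)) (SymRing N) →+* MvPolynomial (Fin m) (LaurentRing N) :=
  eval₂Hom (C.comp (bar N))
    (Fin.snoc (α := fun _ => MvPolynomial (Fin m) (LaurentRing N)) X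
      (C (((ε : ℤ) : LaurentRing N) * LaurentPolynomial.T (-1))))

/-- The system `ρ_+(P) = ρ_-(P) = 0`. When there is no variable `X_a` it is no condition. -/
def IsSolution (N : ℕ) : {ℓ : ℕ} → MvPolynomial (Fin ℓ) (SymRing N) → Prop
  | 0, _ => True
  | _ + 1, P => rho N 1 P = 0 ∧ rho N (-1) P = 0

theorem rho_smul (N : ℕ) {m : ℕ} (ε : ℤˣ) (c : SymRing N)
    (P : MvPolynomial (Fin (m + 1)) (SymRing N)) :
    rho N ε (c • P) = C (bar N c) * rho N ε P := by
  rw [smul_eq_C_mul, map_mul]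
  simp [rho]

/-- The `SymRing N`-module `U_{N,ℓ}` of solutions in `∧^ℓ H`. -/
def solutionModule (N ℓ : ℕ) : Submodule (SymRing N) (MvPolynomial (Fin ℓ) (SymRing N)) where
  carrier := {P | P ∈ extPower N ℓ ∧ IsSolution N P}
  zero_mem' := ⟨zero_mem _, by cases ℓ <;> simp [IsSolution]⟩
  add_mem' := by
    rintro P Q ⟨hP, hP'⟩ ⟨hQ, hQ'⟩
    refine ⟨add_mem hP hQ, ?_⟩
    cases ℓ with
    | zero => trivial
    | succ m => exact ⟨by rw [map_add, hP'.1, hQ'.1, add_zero],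
        by rw [map_add, hP'.2, hQ'.2, add_zero]⟩
  smul_mem' := by
    rintro c P ⟨hP, hP'⟩
    refine ⟨Submodule.smul_mem _ c hP, ?_⟩
    cases ℓ with
    | zero => trivial
    | succ m => exact ⟨by rw [rho_smul, hP'.1, mul_zero], by rw [rho_smul, hP'.2, mul_zero]⟩

/-- The elementary symmetric polynomial `e_k` in `x_1, …, x_N`, zero for `k < 0` and `k > N`. -/
def elemSym (N : ℕ) (k : ℤ) : SymRing N :=
  if 0 ≤ k then (⟨esymm (Fin N) ℂ k.toNat, esymm_isSymmetric (Fin N) ℂ k.toNat⟩ :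
    symmetricSubalgebra (Fin N) ℂ) else 0

/-- `P_{1,s} = e_{2s-1}` and `P_{r,s} = P_{r-1,s+1} - e_{2s} P_{r-1,1}` for `r ≥ 2`
(the value at `r = 0` is not used). -/
def coeffP (N : ℕ) : ℕ → ℤ → SymRing N
  | 0, _ => 0
  | 1, s => elemSym N (2 * s - 1)
  | r + 2, s => coeffP N (r + 1) (s + 1) - elemSym N (2 * s) * coeffP N (r + 1) 1

/-- `v_0 = ∑_{j=0}^n e_{2j} X^{2j}`. -/
def vZero (n : ℕ) : Polynomial (SymRing (2 * n)) :=
  ∑ j ∈ Finset.range (n + 1), Polynomial.C (elemSym (2 * n) (2 * j)) * Polynomial.X ^ (2 * j)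

/-- `v_r = ∑_{s=1}^n P_{r,s} X^{2(s-1)}`, for `r ≥ 1`. -/
def vElt (n r : ℕ) : Polynomial (SymRing (2 * n)) :=
  ∑ s ∈ Finset.Icc 1 n, Polynomial.C (coeffP (2 * n) r s) * Polynomial.X ^ (2 * (s - 1))

/-- `w_r = X v_r`. -/
def wElt (n r : ℕ) : Polynomial (SymRing (2 * n)) := Polynomial.X * vElt n r

/-- The polynomial `p(X_a)` for a polynomial `p(X)` in one variable. -/
def atVar {N ℓ : ℕ} (a : Fin ℓ) (p : Polynomial (SymRing N)) : MvPolynomial (Fin ℓ) (SymRing N) :=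
  Polynomial.aeval (X a) p

theorem dvd_atVar_sub {N : ℕ} {ι : Type*} (s : Finset ι) (c : ι → SymRing N) (k : ι → ℕ) :
    (X 0 + X 1 : MvPolynomial (Fin 2) (SymRing N)) ∣
      atVar 0 (∑ i ∈ s, Polynomial.C (c i) * Polynomial.X ^ (2 * k i)) -
      atVar 1 (∑ i ∈ s, Polynomial.C (c i) * Polynomial.X ^ (2 * k i)) := by
  simp only [atVar, map_sum, map_mul, map_pow, Polynomial.aeval_C, Polynomial.aeval_X]
  rw [← Finset.sum_sub_distrib]
  refine Finset.dvd_sum fun i _ => ?_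
  rw [← mul_sub, pow_mul, pow_mul]
  refine Dvd.dvd.mul_left (Dvd.dvd.trans ?_ (sub_dvd_pow_sub_pow _ _ _)) _
  exact ⟨X 0 - X 1, by ring⟩

theorem xi_exists (n k : ℕ) : ∃ q : MvPolynomial (Fin 2) (SymRing (2 * n)),
    (X 0 + X 1) * (2 * q) =
      (X 0 - X 1) * (atVar 0 (vZero n) * atVar 1 (wElt n k) + atVar 1 (vZero n) * atVar 0 (wElt n k))
      + (X 0 + X 1) *
        (-(atVar 0 (vZero n) * atVar 1 (wElt n k)) + atVar 1 (vZero n) * atVar 0 (wElt n k)) := by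
  obtain ⟨f, hf⟩ := dvd_atVar_sub (Finset.range (n + 1))
    (fun j => elemSym (2 * n) (2 * j)) (fun j => j)
  obtain ⟨g, hg⟩ := dvd_atVar_sub (Finset.Icc 1 n)
    (fun s => coeffP (2 * n) k s) (fun s => s - 1)
  change atVar 0 (vZero n) - atVar 1 (vZero n) = _ at hf
  change atVar 0 (vElt n k) - atVar 1 (vElt n k) = _ at hg
  have hw : ∀ a : Fin 2, atVar a (wElt n k) = X a * atVar a (vElt n k) := by
    intro a; simp [atVar, wElt]
  refine ⟨(X 0 - X 1) * atVar 1 (vZero n) * atVar 1 (vElt n k) + X 0 ^ 2 * atVar 1 (vZero n) * g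
    - X 1 ^ 2 * f * atVar 1 (vElt n k), ?_⟩
  rw [hw, hw, eq_add_of_sub_eq hf, eq_add_of_sub_eq hg]
  ring

/-- The antisymmetric polynomial `ξ_k(X_1, X_2)`, the unique one with
`2 ξ_k = (X_1 - X_2) / (X_1 + X_2) * (v_0(X_1) w_k(X_2) + v_0(X_2) w_k(X_1))
  - v_0(X_1) w_k(X_2) + v_0(X_2) w_k(X_1)`. -/
def xiElt (n k : ℕ) : MvPolynomial (Fin 2) (SymRing (2 * n)) := (xi_exists n k).choose

/-- The triples `(I, J, K)` of index sequences, with entries counted from `1`: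
`1 ≤ i_1 < ⋯ < i_{ℓ₁} ≤ n`, `1 ≤ j_1 < ⋯ < j_{ℓ₂} ≤ n - ℓ₁ - ℓ₃`,
`1 ≤ k_1 ≤ ⋯ ≤ k_{ℓ₃} ≤ n - ℓ₁ - ℓ₃ + 1` and `ℓ₁ + ℓ₂ + 2 ℓ₃ = ℓ`. -/
structure BasisIndex (n ℓ : ℕ) where
  l₁ : ℕ
  l₂ : ℕ
  l₃ : ℕ
  I : Fin l₁ → ℕ
  J : Fin l₂ → ℕ
  K : Fin l₃ → ℕ
  one_le_I : ∀ a, 1 ≤ I a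
  I_strictMono : StrictMono I
  I_le : ∀ a, I a ≤ n
  one_le_J : ∀ b, 1 ≤ J b
  J_strictMono : StrictMono J
  J_le : ∀ b, J b + l₁ + l₃ ≤ n
  one_le_K : ∀ c, 1 ≤ K c
  K_monotone : Monotone K
  K_le : ∀ c, K c + l₁ + l₃ ≤ n + 1
  sum_eq : l₁ + l₂ + 2 * l₃ = ℓ

/-- The exterior product `v_I ∧ w_J ∧ ξ_K`, that is
`∑_σ sgn σ ∏_a v_{i_a}(X_{σ(a)}) ∏_b w_{j_b}(X_{σ(ℓ₁+b)})
  ∏_c ξ_{k_c}(X_{σ(ℓ₁+ℓ₂+2c-1)}, X_{σ(ℓ₁+ℓ₂+2c)})`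
(positions are counted from `0` in the code). -/
def basisElt {n ℓ : ℕ} (t : BasisIndex n ℓ) : MvPolynomial (Fin ℓ) (SymRing (2 * n)) :=
  ∑ σ : Equiv.Perm (Fin ℓ), (Equiv.Perm.sign σ : ℤ) •
    ((∏ a : Fin t.l₁, atVar (σ ⟨a, by have := t.sum_eq; omega⟩) (vElt n (t.I a))) *
     (∏ b : Fin t.l₂, atVar (σ ⟨t.l₁ + b, by have := t.sum_eq; omega⟩) (wElt n (t.J b))) *
     (∏ c : Fin t.l₃,
        rename ![σ ⟨t.l₁ + t.l₂ + 2 * c, by have := t.sum_eq; omega⟩,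
                 σ ⟨t.l₁ + t.l₂ + 2 * c + 1, by have := t.sum_eq; omega⟩] (xiElt n (t.K c))))

end

/-! Write `R` for the ring of symmetric polynomials and `b_t` for the elements `v_I ∧ w_J ∧ ξ_K`.

The `b_t` are solutions. Since `v_0 + w_1 = ∏ (1 + x_j X)`, once `x` and `-x` are among the
variables both `±x⁻¹` are roots. Parity separates the roots of `v_0` and `v_1`, the recursion passes
the vanishing on to every `v_r`, and `(X_1 + X_2) ξ_k` is built from `v_0` and `v_k`
(`rho_basisElt`).

Diagonalization. Suppose that over some ring `v_0 = ∏ (1 - η_j X²)` and `v_1 = ∑ β_i E_i` with `E_i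
= ∏_{j ≠ i} (1 - η_j X²)`. Then `v_{k+1} = ∑ β_i η_i^k E_i`, `w_{k+1} = ∑ β_i η_i^k O_i` with `O_i =
X E_i`, and `ξ_{k+1}` becomes `2 ∑ β_i η_i^k O_i ∧ E_i`. If the `η_i - η_j` are units, combinations
over `k` amount to polynomials in `η` with chosen zeros, and the span of the `b_t` contains every
wedge of `E_i`'s and `O_i`'s multiplied by the `β_i` of its distinct indices (`smul_word_mem`). For
`η_i = ζ_i²`, interpolation at the points `±ζ_i⁻¹` puts into the span every antisymmetric polynomial
of admissible degree whose values there are divisible by these products (`mem_span_map_basisElt`).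

The generic case. `psi` embeds `R` into a polynomial ring in `ζ_i` and `u_s`; after inverting
`denom` the diagonalization applies, with `β_i` equal to `weight i` up to a unit. A solution has the
required divisibility: modulo `weight i` both `v_0` and `v_1` vanish at `ζ_i⁻¹`, so `ζ_i` and `-ζ_i`
are two of the `x_j`, and the equations `ρ_± = 0` apply (`prod_weight_dvd_eval`). Hence the `b_t`
span the solutions over the localization.

Descent to `R`. Let `d` be the determinant of the coefficients of the `b_t`. It does not vanish at
the point where `e_{2n-1} = 1` and all other `e_k = 0`: with `e_{2n} = -1` instead, the
diagonalization over roots of unity gives spanning, and moving `e_{2n}` to `0` changes `ξ_k` only by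
terms `w ∧ v` within the allowed index ranges. By Cramer, `d P = ∑ c_t b_t`. Uniqueness of
coefficients in the localization shows that `d` divides `c_t` times a power of `denom`. The chosen
point lifts to `ζ = 0`, where each irreducible factor of `denom` vanishes and `d` does not, so `d`
is coprime to `denom` and divides `c_t` upstairs. As `psi` is injective and integral and `R` is
integrally closed, `d` divides `c_t` in `R` (`dvd_of_psi_dvd`). -/

open MvPolynomial

noncomputable section

/-! ### Products of anticommuting or commuting elements of square zero. -/

section SignedProducts

variable {α A : Type*} [Ring A] {f : α → A}

theorem List.Perm.prod_map_eq_or_neg (hf : ∀ a b, f a * f b = -(f b * f a)) {l l' : List α}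
    (h : l.Perm l') : (l.map f).prod = (l'.map f).prod ∨ (l.map f).prod = -(l'.map f).prod := by
  induction h with
  | nil => exact Or.inl rfl
  | cons a _ ih =>
    rcases ih with h | h
    · left; simp [h]
    · right; simp [h]
  | swap a b l =>
    right
    simp only [List.map_cons, List.prod_cons]
    rw [← mul_assoc, hf b a, neg_mul, mul_assoc]
  | trans _ _ h₁ h₂ =>
    rcases h₁ with h | h <;> rcases h₂ with h' | h' <;> simp [h, h']

theorem List.prod_map_eq_zero_of_not_nodup (hf : ∀ a b, f a * f b = -(f b * f a))
    (hs : ∀ a, f a * f a = 0) {l : List α} (h : ¬ l.Nodup) : (l.map f).prod = 0 := by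
  rw [← List.exists_duplicate_iff_not_nodup] at h
  obtain ⟨a, ha⟩ := h
  obtain ⟨t, ht⟩ := (List.duplicate_iff_sublist.1 ha).exists_perm_append
  have : (([a, a] ++ t).map f).prod = 0 := by simp [← mul_assoc, hs]
  rcases ht.prod_map_eq_or_neg hf with h | h <;> rw [h, this]
  simp

theorem add_pow_of_mul_self_eq_zero {x s : A} (hx : x * x = 0) (h : Commute x s) (k : ℕ) :
    (x + s) ^ (k + 1) = s ^ (k + 1) + (k + 1 : ℕ) • (x * s ^ k) := by
  induction k with
  | zero => simp [add_comm]
  | succ k ih =>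
    rw [pow_succ', ih, add_mul, mul_add, mul_add, mul_smul_comm, ← mul_assoc x x, hx, zero_mul,
      smul_zero, add_zero, mul_smul_comm, ← mul_assoc s x, ← h.eq, mul_assoc x s, ← pow_succ' s k,
      ← pow_succ' s (k + 1), succ_nsmul (x * s ^ (k + 1)) (k + 1)]
    abel

/-- In the multinomial expansion every term with a repeated factor vanishes. This evaluates powers
of the two-forms `ξ`. -/
theorem List.sum_map_pow_length (hc : ∀ a b, Commute (f a) (f b)) (hs : ∀ a, f a * f a = 0)
    (l : List α) : (l.map f).sum ^ l.length = l.length.factorial • (l.map f).prod ∧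
      (l.map f).sum ^ (l.length + 1) = 0 := by
  induction l with
  | nil => simp
  | cons a l ih =>
    have hcomm : Commute (f a) (l.map f).sum := by
      refine Commute.list_sum_right _ _ fun b hb => ?_
      obtain ⟨c, -, rfl⟩ := List.mem_map.1 hb
      exact hc a c
    simp only [List.map_cons, List.sum_cons, List.length_cons, List.prod_cons]
    constructor
    · rw [add_pow_of_mul_self_eq_zero (hs a) hcomm, ih.1, ih.2, zero_add, mul_smul_comm, smul_smul,
        Nat.factorial_succ]
    · rw [add_pow_of_mul_self_eq_zero (hs a) hcomm, ih.2, pow_succ, ih.2]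
      simp

end SignedProducts

/-! ### Signs in the exterior algebra. -/

namespace ExteriorAlgebra

variable {B M : Type*} [CommRing B] [AddCommGroup M] [Module B M]

theorem ι_mul_ι_comm (x y : M) : ι B x * ι B y = -(ι B y * ι B x) :=
  eq_neg_of_add_eq_zero_left (ι_add_mul_swap x y)

/-- A vector that passes two others changes sign twice. -/
theorem commute_ι_mul_ι (a b : M) (x : ExteriorAlgebra B M) : Commute (ι B a * ι B b) x := by
  induction x using ExteriorAlgebra.induction with
  | algebraMap r => exact Algebra.commutes' r _ |>.symm
  | ι m =>
    change _ = _
    rw [mul_assoc, ι_mul_ι_comm b m, mul_neg, ← mul_assoc, ι_mul_ι_comm a m, neg_mul, neg_neg,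
      mul_assoc]
  | mul x y hx hy => exact hx.mul_right hy
  | add x y hx hy => exact hx.add_right hy

end ExteriorAlgebra

/-! ### Weighted words spanned by products of the diagonalized vectors and two-forms. -/

namespace WedgeSpan

open ExteriorAlgebra Polynomial

variable {B M : Type*} [CommRing B] [AddCommGroup M] [Module B M] {n : ℕ}

theorem prod_map_smul {α A : Type*} [Ring A] [Algebra B A] (c : α → B) (f : α → A) (l : List α) :
    (l.map fun i => c i • f i).prod = (l.map c).prod • (l.map f).prod := by
  induction l with
  | nil => simp
  | cons i l ih => simp only [List.map_cons, List.prod_cons, ih, smul_mul_smul_comm]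

theorem smul_mul_expand {A ι : Type*} [Ring A] [Algebra B A] (L : M →ₗ[B] A) (c b : B) (m : M)
    (s : Finset ι) (γ : ι → B) (v : ι → M) (a t y p : A) :
    c • (a * (t * (L (b • m + ∑ j ∈ s, γ j • v j) * y)) * p) =
      (c * b) • (a * (t * L m * y) * p) + ∑ j ∈ s, (c * γ j) • (a * (t * L (v j) * y) * p) := by
  simp only [map_add, map_sum, map_smul, add_mul, mul_add, Finset.sum_mul, Finset.mul_sum,
    Finset.smul_sum, smul_add, smul_mul_assoc, mul_smul_comm, smul_smul, mul_assoc]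

/-- The word `e_{a_1} ∧ ⋯ ∧ e_{a_p}`. -/
def word (e : Fin n → M) (l : List (Fin n)) : ExteriorAlgebra B M :=
  (l.map fun i => ι B (e i)).prod

/-- The product of the two-forms `o_i ∧ e_i`. -/
def pairs (e o : Fin n → M) (l : List (Fin n)) : ExteriorAlgebra B M :=
  (l.map fun i => ι B (o i) * ι B (e i)).prod

/-- The vector `∑ β_i f(η_i) e_i`. -/
def weighted (β η : Fin n → B) (e : Fin n → M) : B[X] →ₗ[B] M where
  toFun f := ∑ i, (β i * f.eval (η i)) • e i
  map_add' f g := by simp [mul_add, add_smul, Finset.sum_add_distrib]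
  map_smul' c f := by
    simp only [eval_smul, smul_eq_mul, RingHom.id_apply, Finset.smul_sum, smul_smul]
    exact Finset.sum_congr rfl fun i _ => by ring_nf

/-- The two-form `2 ∑ β_i f(η_i) o_i ∧ e_i`. -/
def weightedPair (β η : Fin n → B) (e o : Fin n → M) : B[X] →ₗ[B] ExteriorAlgebra B M where
  toFun f := ∑ i, (2 * (β i * f.eval (η i))) • (ι B (o i) * ι B (e i))
  map_add' f g := by simp [mul_add, add_smul, Finset.sum_add_distrib]
  map_smul' c f := by
    simp only [eval_smul, smul_eq_mul, RingHom.id_apply, Finset.smul_sum, smul_smul]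
    exact Finset.sum_congr rfl fun i _ => by ring_nf

theorem weightedPair_apply (β η : Fin n → B) (e o : Fin n → M) (f : B[X]) :
    weightedPair β η e o f = ∑ i, (2 * (β i * f.eval (η i))) • (ι B (o i) * ι B (e i)) := rfl

theorem word_cons (e : Fin n → M) (i : Fin n) (l : List (Fin n)) :
    word (B := B) e (i :: l) = ι B (e i) * word e l := by simp [word]

theorem word_append (e : Fin n → M) (l l' : List (Fin n)) :
    word (B := B) e (l ++ l') = word e l * word e l' := by simp [word]

theorem pairs_cons (e o : Fin n → M) (i : Fin n) (l : List (Fin n)) :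
    pairs (B := B) e o (i :: l) = ι B (o i) * ι B (e i) * pairs e o l := by simp [pairs]

theorem word_singleton (e : Fin n → M) (i : Fin n) : word (B := B) e [i] = ι B (e i) := by
  simp [word]

theorem word_perm (e : Fin n → M) {l l' : List (Fin n)} (h : l.Perm l') :
    word (B := B) e l = word e l' ∨ word (B := B) e l = -word e l' :=
  h.prod_map_eq_or_neg fun _ _ => ι_mul_ι_comm _ _

theorem word_eq_zero (e : Fin n → M) {l : List (Fin n)} (h : ¬ l.Nodup) :
    word (B := B) e l = 0 :=
  List.prod_map_eq_zero_of_not_nodup (fun _ _ => ι_mul_ι_comm _ _) (fun _ => ι_sq_zero _) h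

theorem pairs_perm (e o : Fin n → M) {l l' : List (Fin n)} (h : l.Perm l') :
    pairs (B := B) e o l = pairs e o l' := by
  refine List.Perm.prod_eq' (h.map _) ?_
  rw [List.pairwise_map]
  exact List.pairwise_of_forall (fun _ _ => commute_ι_mul_ι _ _ _)

theorem commute_pairs (e o : Fin n → M) (l : List (Fin n)) (x : ExteriorAlgebra B M) :
    Commute (pairs e o l) x := by
  refine Commute.list_prod_left _ _ fun y hy => ?_
  obtain ⟨i, -, rfl⟩ := List.mem_map.1 hy
  exact commute_ι_mul_ι _ _ _

theorem pair_mul_self (x y : M) : (ι B x * ι B y) * (ι B x * ι B y) = 0 := by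
  rw [(commute_ι_mul_ι x y (ι B x * ι B y)).eq, mul_assoc, ← mul_assoc (ι B y), ι_mul_ι_comm y x,
    neg_mul, mul_assoc, ι_sq_zero]
  simp

theorem word_mul_eq_zero (e : Fin n → M) {l : List (Fin n)} {i : Fin n} (hi : i ∈ l) :
    word (B := B) e l * ι B (e i) = 0 := by
  have : word (B := B) e (l ++ [i]) = 0 := word_eq_zero e (by simp [List.nodup_append, hi])
  rw [word_append] at this
  simpa [word] using this

theorem mul_pairs_eq_zero {e o : Fin n → M} {l : List (Fin n)} {i : Fin n} (hi : i ∈ l)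
    {x : ExteriorAlgebra B M} (hx : x * (ι B (o i) * ι B (e i)) = 0) : x * pairs e o l = 0 := by
  rw [pairs_perm e o (List.perm_cons_erase hi), pairs_cons, ← mul_assoc, hx, zero_mul]

theorem word_mul_pair_eq_zero {e o : Fin n → M} {l : List (Fin n)} {i : Fin n} (hi : i ∈ l) :
    word e l * (ι B (o i) * ι B (e i)) = 0 := by
  rw [ι_mul_ι_comm, mul_neg, ← mul_assoc, word_mul_eq_zero e hi]
  simp

theorem word_mul_pairs_eq_zero {e o : Fin n → M} {l l' : List (Fin n)} {i : Fin n} (hi : i ∈ l)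
    (hi' : i ∈ l') : word (B := B) e l * pairs e o l' = 0 :=
  mul_pairs_eq_zero hi' (word_mul_pair_eq_zero hi)

theorem word_mul_pairs_eq_zero' {e o : Fin n → M} {l l' : List (Fin n)} {i : Fin n} (hi : i ∈ l)
    (hi' : i ∈ l') : word (B := B) o l * pairs e o l' = 0 :=
  mul_pairs_eq_zero hi' (by rw [← mul_assoc, word_mul_eq_zero o hi, zero_mul])

theorem pairs_eq_zero {e o : Fin n → M} {l : List (Fin n)} (h : ¬ l.Nodup) :
    pairs (B := B) e o l = 0 := by
  rw [← List.exists_duplicate_iff_not_nodup] at h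
  obtain ⟨a, ha⟩ := h
  obtain ⟨t, ht⟩ := (List.duplicate_iff_sublist.1 ha).exists_perm_append
  rw [pairs_perm e o ht, List.cons_append, List.cons_append, pairs_cons, pairs_cons, ← mul_assoc,
    pair_mul_self, zero_mul]

/-- Moving a common index of the first two words into the product of pairs. -/
theorem word_mul_word_cons (e o : Fin n → M) (i : Fin n) (l l' : List (Fin n))
    (x : ExteriorAlgebra B M) :
    word e (i :: l) * word o (i :: l') * x = word e l * word o l' * (ι B (o i) * ι B (e i) * x) ∨
    word e (i :: l) * word o (i :: l') * x =
      -(word e l * word o l' * (ι B (o i) * ι B (e i) * x)) := by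
  have key : word e (l ++ [i]) * word o (i :: l') * x =
      -(word e l * word o l' * (ι B (o i) * ι B (e i) * x)) := by
    have h : word (B := B) e [i] * word o (i :: l') = -(word o l' * (ι B (o i) * ι B (e i))) := by
      rw [word_cons o, word_cons, ← (commute_ι_mul_ι (o i) (e i) (word o l')).eq,
        ← neg_mul, ← ι_mul_ι_comm]
      simp [word, mul_assoc]
    rw [word_append, mul_assoc (word e l), h]
    simp only [mul_neg, neg_mul, mul_assoc]
  rcases word_perm (B := B) e (List.perm_append_singleton i l).symm with h | h
  · right; rw [h, key]
  · left; rw [h, neg_mul, neg_mul, key, neg_neg]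

section Main

variable {β η : Fin n → B} {e o : Fin n → M} {W : Submodule B (ExteriorAlgebra B M)} {ℓ : ℕ}

theorem weighted_eq_single {f : B[X]} {i : Fin n} (h : ∀ j, j ≠ i → f.eval (η j) = 0) :
    weighted β η e f = (β i * f.eval (η i)) • e i := by
  refine Finset.sum_eq_single i (fun j _ hj => ?_) (fun h => absurd (Finset.mem_univ _) h)
  rw [h j hj, mul_zero, zero_smul]

theorem prod_weighted (f : Fin n → B[X]) (h : ∀ i j, j ≠ i → (f i).eval (η j) = 0)
    (l : List (Fin n)) : (l.map fun i => ι B (weighted β η e (f i))).prod =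
      (l.map fun i => β i * (f i).eval (η i)).prod • word e l := by
  rw [word, ← prod_map_smul]
  congr 2
  funext i
  rw [weighted_eq_single (h i), map_smul]

/-- The zeros of `h` remove all pairs with index outside `l ∪ l'`, and the word in `l` kills those
with index in `l`. What is left is a sum over `l'` of commuting elements of square zero, whose top
power is a factorial times their product. -/
theorem word_mul_weightedPair_pow {h : B[X]} {l l' : List (Fin n)} (hl' : l'.Nodup) (hd : l.Disjoint l') (hh : ∀ j, j ∉ l → j ∉ l' → h.eval (η j) = 0)
    (x : ExteriorAlgebra B M) :
    word e l * x * weightedPair β η e o h ^ l'.length =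
      ((l'.length.factorial : B) * (l'.map fun i => 2 * (β i * h.eval (η i))).prod) •
        (word e l * x * pairs e o l') := by
  set c : Fin n → B := fun i => 2 * (β i * h.eval (η i)) with hc
  set θ : Fin n → ExteriorAlgebra B M := fun i => ι B (o i) * ι B (e i)
  set S := (l'.map fun i => c i • θ i).sum with hS
  have hθ : ∀ i y, Commute (c i • θ i) y := fun i y => (commute_ι_mul_ι _ _ _).smul_left _
  have hcomm : ∀ y, Commute (weightedPair β η e o h) y := fun y =>
    Commute.sum_left Finset.univ (fun i => c i • θ i) y fun i _ => hθ i y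
  have hscomm : ∀ y, Commute S y := fun y => by
    refine Commute.list_sum_left _ _ fun z hz => ?_
    obtain ⟨i, -, rfl⟩ := List.mem_map.1 hz
    exact hθ i y
  have hsplit : weightedPair β η e o h = ∑ i ∈ l.toFinset, c i • θ i + S := by
    have h1 : S = ∑ i ∈ l'.toFinset, c i • θ i := (List.sum_toFinset _ hl').symm
    rw [h1, ← Finset.sum_union (by simpa [List.disjoint_toFinset_iff_disjoint] using hd)]
    symm
    refine Finset.sum_subset (Finset.subset_univ _) fun j _ hj => ?_
    simp only [Finset.mem_union, List.mem_toFinset, not_or] at hj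
    simp [hc, hh j hj.1 hj.2]
  have hone : word e l * weightedPair β η e o h = word e l * S := by
    rw [hsplit, mul_add, Finset.mul_sum, Finset.sum_eq_zero, zero_add]
    intro i hi
    rw [mul_smul_comm, word_mul_pair_eq_zero (List.mem_toFinset.1 hi), smul_zero]
  have hpow : ∀ m, word e l * weightedPair β η e o h ^ m = word e l * S ^ m := by
    intro m
    induction m with
    | zero => simp
    | succ m ih =>
      rw [pow_succ, ← mul_assoc, ih, mul_assoc, ← (hcomm (S ^ m)).eq, ← mul_assoc, hone, mul_assoc,
        ← pow_succ']
  have hSpow : S ^ l'.length =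
      ((l'.length.factorial : B) * (l'.map c).prod) • pairs e o l' := by
    rw [hS, (List.sum_map_pow_length (fun i j => hθ i _) (fun i => by
      rw [smul_mul_smul_comm, pair_mul_self, smul_zero]) l').1]
    rw [mul_smul, ← Nat.cast_smul_eq_nsmul B]
    rw [prod_map_smul]
    rfl
  have hx : ∀ y : ExteriorAlgebra B M, (∀ z, Commute y z) → word e l * x * y = word e l * y * x :=
    fun y hy => by rw [mul_assoc, ← (hy x).eq, mul_assoc]
  rw [hx _ fun z => (hcomm z).pow_left _, hpow, hSpow, mul_smul_comm, smul_mul_assoc,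
    hx _ (commute_pairs e o l')]

/-- Multiplying out the remaining vectors only lengthens `t`, so each resulting word still meets
`l`. A new letter `j` brings its own `β j`, which keeps the coefficient divisible by the weights of
all letters. -/
theorem smul_word_mul_prod_mem {l l₃ : List (Fin n)} {m : ℕ}
    (hW : ∀ t : List (Fin n), t.length = m → (∃ i ∈ l, i ∈ t) → ∀ x : B,
      (∏ i ∈ (l ++ t ++ l₃).toFinset, β i) ∣ x → x • (word e l * word o t * pairs e o l₃) ∈ W)
    (gs : List B[X]) (t : List (Fin n)) (ht : t.length + gs.length = m) (hi : ∃ i ∈ l, i ∈ t)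
    (x : B) (hx : (∏ i ∈ (l ++ t ++ l₃).toFinset, β i) ∣ x) :
    x • (word e l * (word o t * (gs.map fun g => ι B (weighted β η o g)).prod) * pairs e o l₃)
      ∈ W := by
  induction gs generalizing t x with
  | nil => simpa using hW t (by simpa using ht) hi x hx
  | cons g gs ih =>
    rw [List.map_cons, List.prod_cons]
    conv in weighted β η o g => rw [weighted, LinearMap.coe_mk, AddHom.coe_mk]
    simp only [map_sum, map_smul, Finset.sum_mul, Finset.mul_sum, Finset.smul_sum]
    refine Submodule.sum_mem _ fun j _ => ?_
    have := ih (t ++ [j]) (by simp at ht ⊢; omega)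
      (by obtain ⟨i, h, h'⟩ := hi; exact ⟨i, h, by simp [h']⟩) (x * (β j * g.eval (η j))) ?_
    · rw [word_append, mul_smul] at this
      convert this using 2
      simp only [smul_mul_assoc, mul_smul_comm, mul_assoc]
      simp only [word, List.map_cons, List.map_nil, List.prod_cons, List.prod_nil, mul_one]
    · have h1 : (l ++ (t ++ [j]) ++ l₃).toFinset = insert j (l ++ t ++ l₃).toFinset := by
        ext; simp
      rw [h1]
      by_cases hj : j ∈ (l ++ t ++ l₃).toFinset
      · rw [Finset.insert_eq_of_mem hj]; exact hx.mul_right _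
      · rw [Finset.prod_insert hj, mul_comm]
        exact mul_dvd_mul hx (Dvd.intro _ rfl)

/-- The polynomial `∏_{j ∈ s} (X - η_j)`. -/
def nodal (η : Fin n → B) (s : Finset (Fin n)) : B[X] := ∏ j ∈ s, (Polynomial.X - Polynomial.C (η j))

theorem nodal_mem_degreeLT (s : Finset (Fin n)) {d : ℕ} (hd : s.card < d) :
    nodal η s ∈ degreeLT B d := by
  rw [mem_degreeLT]
  refine lt_of_le_of_lt (degree_prod_le _ _) ?_
  refine lt_of_le_of_lt (Finset.sum_le_sum fun i _ => degree_X_sub_C_le _) ?_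
  simpa using hd

theorem eval_nodal_eq_zero {s : Finset (Fin n)} {j : Fin n} (hj : j ∈ s) :
    (nodal η s).eval (η j) = 0 := by
  rw [nodal, Polynomial.eval_prod]
  exact Finset.prod_eq_zero hj (by simp)

theorem isUnit_eval_nodal (hη : ∀ i j, i ≠ j → IsUnit (η i - η j)) {s : Finset (Fin n)} {j : Fin n}
    (hj : j ∉ s) : IsUnit ((nodal η s).eval (η j)) := by
  rw [nodal, Polynomial.eval_prod, IsUnit.prod_iff]
  intro i hi
  simpa using hη j i fun h => hj (h ▸ hi)

theorem smul_word_mem_of_unit_smul {x u : B} (hu : IsUnit u) {y : ExteriorAlgebra B M}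
    (h : (u * x) • y ∈ W) : x • y ∈ W := by
  obtain ⟨u, rfl⟩ := hu
  have := W.smul_mem (↑u⁻¹ : B) h
  rwa [smul_smul, ← mul_assoc, Units.inv_mul, one_mul] at this

/-- The vectors attached to `l₂` are replaced one at a time by their leading letters. The error
terms carry a letter of `l₁`, where `meet` applies, or a letter of `l₃`, where the pairs annihilate
them. -/
theorem smul_word_mem_of_unexpanded {l₁ l₂ l₃ : List (Fin n)} (h₂ : l₂.Nodup)
    (h₁₂ : l₁.Disjoint l₂) (h₂₃ : l₂.Disjoint l₃)
    (meet : ∀ t : List (Fin n), t.length = l₂.length → (∃ i ∈ l₁, i ∈ t) → ∀ x : B,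
      (∏ i ∈ (l₁ ++ t ++ l₃).toFinset, β i) ∣ x →
        x • (word e l₁ * word o t * pairs e o l₃) ∈ W)
    (g : Fin n → B[X]) (hug : ∀ i, IsUnit ((g i).eval (η i)))
    (hg : ∀ i j, j ≠ i → j ∉ (l₁ ++ l₃).toFinset → (g i).eval (η j) = 0)
    (start : ∀ x : B, (∏ i ∈ (l₁ ++ l₃).toFinset, β i) ∣ x →
      x • (word e l₁ * (l₂.map fun i => ι B (weighted β η o (g i))).prod * pairs e o l₃) ∈ W)
    (s t : List (Fin n)) (hst : t ++ s = l₂) (x : B)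
    (hx : (∏ i ∈ (l₁ ++ t ++ l₃).toFinset, β i) ∣ x) :
    x • (word e l₁ * (word o t * (s.map fun i => ι B (weighted β η o (g i))).prod) *
        pairs e o l₃) ∈ W := by
  induction t using List.reverseRecOn generalizing s x with
  | nil =>
    simp only [List.nil_append] at hst
    subst hst
    simpa [word] using start x (by simpa using hx)
  | append_singleton t b iht =>
    have hb : b ∈ l₂ := by rw [← hst]; simp
    have hbt : b ∉ t := by
      have := hst ▸ h₂
      rw [List.append_assoc, List.nodup_append] at this
      intro hbt
      exact this.2.2 b hbt b (by simp) rfl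
    have hb' : b ∉ (l₁ ++ t ++ l₃).toFinset := by
      simp only [List.mem_toFinset, List.mem_append, not_or]
      exact ⟨⟨fun h => h₁₂ h hb, hbt⟩, fun h => h₂₃ hb h⟩
    have hins : (l₁ ++ (t ++ [b]) ++ l₃).toFinset = insert b (l₁ ++ t ++ l₃).toFinset := by
      ext; simp
    rw [hins, Finset.prod_insert hb'] at hx
    obtain ⟨z, rfl⟩ := hx
    have key := iht (b :: s) (by simpa using hst) _ (Dvd.intro z rfl)
    rw [List.map_cons, List.prod_cons] at key
    -- By `hg` only the letter `b` and the letters of `l₁` and `l₃` survive in this vector.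
    have hw : weighted β η o (g b) = (β b * (g b).eval (η b)) • o b +
        ∑ j ∈ (l₁ ++ l₃).toFinset, (β j * (g b).eval (η j)) • o j := by
      have hb'' : b ∉ (l₁ ++ l₃).toFinset := by
        simp at hb' ⊢; tauto
      rw [← Finset.sum_insert (f := fun j => (β j * (g b).eval (η j)) • o j) hb'']
      symm
      refine Finset.sum_subset (Finset.subset_univ _) fun j _ hj => ?_
      rw [Finset.mem_insert, not_or] at hj
      rw [hg b j hj.1 hj.2, mul_zero, zero_smul]
    set y := (s.map fun i => ι B (weighted β η o (g i))).prod
    set c := (∏ i ∈ (l₁ ++ t ++ l₃).toFinset, β i) * z with hc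
    have expand : c • (word e l₁ * (word o t * (ι B (weighted β η o (g b)) * y)) * pairs e o l₃) =
        (c * (β b * (g b).eval (η b))) •
          (word e l₁ * (word o (t ++ [b]) * y) * pairs e o l₃) +
        ∑ j ∈ (l₁ ++ l₃).toFinset, (c * (β j * (g b).eval (η j))) •
          (word e l₁ * (word o (t ++ [j]) * y) * pairs e o l₃) := by
      have hone : ∀ j, word (B := B) o (t ++ [j]) = word o t * ι B (o j) := fun j => by
        rw [word_append, word_singleton]
      simp only [hone, hw]
      exact smul_mul_expand _ _ _ _ _ _ _ _ _ _ _
    have hrest : ∑ j ∈ (l₁ ++ l₃).toFinset, (c * (β j * (g b).eval (η j))) •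
          (word e l₁ * (word o (t ++ [j]) * y) * pairs e o l₃) ∈ W := by
      refine Submodule.sum_mem _ fun j hj => ?_
      rw [List.mem_toFinset, List.mem_append] at hj
      rcases hj with hj | hj
      · have := smul_word_mul_prod_mem (W := W) (β := β) (η := η) meet (s.map g) (t ++ [j])
          (by rw [← hst]; simp; omega) ⟨j, hj, by simp⟩ (c * (β j * (g b).eval (η j))) ?_
        · rwa [List.map_map] at this
        · refine Dvd.dvd.mul_right ?_ _
          have : (l₁ ++ (t ++ [j]) ++ l₃).toFinset = (l₁ ++ t ++ l₃).toFinset := by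
            ext i; simp only [List.toFinset_append, Finset.mem_union, List.mem_toFinset,
              List.mem_singleton]
            constructor
            · rintro ((h | h | rfl) | h) <;> tauto
            · tauto
          rw [this]; exact Dvd.intro _ rfl
      · have h0 : word e l₁ * (word o (t ++ [j]) * y) * pairs e o l₃ = 0 := by
          rw [mul_assoc, mul_assoc (word o (t ++ [j])), ← (commute_pairs e o l₃ y).eq,
            ← mul_assoc (word o (t ++ [j])),
            word_mul_pairs_eq_zero' (i := j) (by simp) hj, zero_mul, mul_zero]
        rw [h0, smul_zero]; exact W.zero_mem
    rw [expand] at key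
    have hmain := (W.add_mem_iff_left hrest).1 key
    refine smul_word_mem_of_unit_smul (hug b) ?_
    convert hmain using 2
    rw [hc]; ring

set_option maxHeartbeats 800000 in
/-- A submodule containing all products of `l₁` vectors `v_f` with `deg f < n`, `l₂` vectors `w_g`
with `deg g < n - l₁ - l₃` and `l₃` two-forms `ξ_h` with `deg h ≤ n - l₁ - l₃` contains all
words in the `e_i` and `o_i`, up to the product of the weights `β_i` over the letters. -/
theorem smul_word_mem [Algebra ℚ B] (hη : ∀ i j, i ≠ j → IsUnit (η i - η j))
    (hW : ∀ (fs gs hs : List B[X]), fs.length + hs.length ≤ n →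
      fs.length + gs.length + 2 * hs.length = ℓ → (∀ f ∈ fs, f ∈ degreeLT B n) →
      (∀ g ∈ gs, g ∈ degreeLT B (n - fs.length - hs.length)) →
      (∀ h ∈ hs, h ∈ degreeLT B (n - fs.length - hs.length + 1)) →
      (fs.map fun f => ι B (weighted β η e f)).prod * (gs.map fun g => ι B (weighted β η o g)).prod *
        (hs.map fun h => weightedPair β η e o h).prod ∈ W)
    (l₁ l₂ l₃ : List (Fin n)) (hl : l₁.length + l₂.length + 2 * l₃.length = ℓ) (x : B)
    (hx : (∏ i ∈ (l₁ ++ l₂ ++ l₃).toFinset, β i) ∣ x) :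
    x • (word e l₁ * word o l₂ * pairs e o l₃) ∈ W := by
  -- An index common to an `e`-letter and an `o`-letter is traded for a pair; this shortens `l₁`,
  -- which is why its length drives the induction.
  induction hN : l₁.length using Nat.strong_induction_on generalizing l₁ l₂ l₃ x with
  | _ N ih =>
  subst hN
  by_cases h₁ : l₁.Nodup; swap
  · rw [word_eq_zero e h₁]; simp
  by_cases h₂ : l₂.Nodup; swap
  · rw [word_eq_zero o h₂]; simp
  by_cases h₃ : l₃.Nodup; swap
  · rw [pairs_eq_zero h₃]; simp
  by_cases h₁₃ : l₁.Disjoint l₃; swap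
  · obtain ⟨i, hi, hi'⟩ : ∃ i, i ∈ l₁ ∧ i ∈ l₃ := by
      simpa [List.Disjoint] using h₁₃
    rw [mul_assoc, ← (commute_pairs e o l₃ _).eq, ← mul_assoc, word_mul_pairs_eq_zero hi hi']
    simp
  by_cases h₂₃ : l₂.Disjoint l₃; swap
  · obtain ⟨i, hi, hi'⟩ : ∃ i, i ∈ l₂ ∧ i ∈ l₃ := by
      simpa [List.Disjoint] using h₂₃
    rw [mul_assoc, word_mul_pairs_eq_zero' hi hi']
    simp
  have meet : ∀ t : List (Fin n), t.length = l₂.length → (∃ i ∈ l₁, i ∈ t) → ∀ x : B,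
      (∏ i ∈ (l₁ ++ t ++ l₃).toFinset, β i) ∣ x →
        x • (word e l₁ * word o t * pairs e o l₃) ∈ W := by
    -- The common letter `i` moves into the pairs. The set of letters stays the same, and with it
    -- the divisibility condition on `x`.
    rintro t ht ⟨i, hi, hi'⟩ x hx
    have p₁ := List.perm_cons_erase hi
    have p₂ := List.perm_cons_erase hi'
    have hlen₁ := p₁.length_eq
    have hlen₂ := p₂.length_eq
    simp only [List.length_cons] at hlen₁ hlen₂
    have hmem : x • (word e (l₁.erase i) * word o (t.erase i) * pairs e o (i :: l₃)) ∈ W := by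
      refine ih _ (by omega) _ _ (i :: l₃) (by simp; omega) x ?_ rfl
      convert hx using 2
      ext j
      have e₁ := p₁.mem_iff (a := j)
      have e₂ := p₂.mem_iff (a := j)
      simp only [List.mem_cons] at e₁ e₂
      simp only [List.toFinset_append, List.toFinset_cons, Finset.mem_union, List.mem_toFinset,
        Finset.mem_insert, e₁, e₂]
      tauto
    rw [pairs_cons] at hmem
    have hcons : x • (word e (i :: l₁.erase i) * word o (i :: t.erase i) * pairs e o l₃) ∈ W := by
      rcases word_mul_word_cons (B := B) e o i (l₁.erase i) (t.erase i) (pairs e o l₃) with h | h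
      · rwa [h]
      · rw [h, smul_neg]; exact W.neg_mem hmem
    rcases word_perm (B := B) e p₁ with h | h <;> rcases word_perm (B := B) o p₂ with h' | h' <;>
      rw [h, h'] <;> simpa using hcons
  by_cases h₁₂ : l₁.Disjoint l₂; swap
  · obtain ⟨i, hi, hi'⟩ : ∃ i, i ∈ l₁ ∧ i ∈ l₂ := by
      simpa [List.Disjoint] using h₁₂
    exact meet l₂ rfl ⟨i, hi, hi'⟩ x hx
  have hcard : (l₁ ++ l₃).toFinset.card = l₁.length + l₃.length := by
    rw [List.toFinset_card_of_nodup (List.nodup_append'.2 ⟨h₁, h₃, h₁₃⟩), List.length_append]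
  have hle : l₁.length + l₃.length ≤ n := by
    rw [← hcard]; simpa using Finset.card_le_univ (l₁ ++ l₃).toFinset
  -- The zeros are chosen so that `f i` leaves only `e i`, that `g i` for `i` in `l₂` leaves `o i`
  -- and the letters of `l₁` and `l₃`, and that `h` leaves only pairs with index in `l₁` or `l₃`.
  -- The degrees `n - 1`, `n - l₁ - l₃ - 1` and `n - l₁ - l₃` are the largest that `hW` permits.
  set f : Fin n → B[X] := fun i => nodal η (Finset.univ.erase i) with hf
  set g : Fin n → B[X] := fun i => nodal η (Finset.univ \ insert i (l₁ ++ l₃).toFinset) with hg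
  set h : B[X] := nodal η (Finset.univ \ (l₁ ++ l₃).toFinset) with hh
  have huf : ∀ i, IsUnit ((f i).eval (η i)) := fun i => isUnit_eval_nodal hη (by simp)
  have hug : ∀ i, IsUnit ((g i).eval (η i)) := fun i => isUnit_eval_nodal hη (by simp)
  have huh : ∀ i ∈ l₃, IsUnit (h.eval (η i)) := fun i hi => isUnit_eval_nodal hη (by simp [hi])
  -- all vectors `w_g` still unexpanded
  have start : ∀ x : B, (∏ i ∈ (l₁ ++ l₃).toFinset, β i) ∣ x →
      x • (word e l₁ * (l₂.map fun i => ι B (weighted β η o (g i))).prod * pairs e o l₃) ∈ W := by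
    intro x hx
    have hmem := hW (l₁.map f) (l₂.map g) (List.replicate l₃.length h) (by simpa using hle)
      (by simpa using hl) ?_ ?_ ?_
    · rw [List.map_map, List.map_map, List.map_replicate, List.prod_replicate] at hmem
      simp only [Function.comp_def] at hmem
      rw [prod_weighted f (fun i j hj => eval_nodal_eq_zero (by simp [hj])), smul_mul_assoc,
        smul_mul_assoc, word_mul_weightedPair_pow h₃ h₁₃ (fun j hj hj' =>
          eval_nodal_eq_zero (by simp [hj, hj'])), smul_smul] at hmem
      obtain ⟨y, rfl⟩ := hx
      have hprod : ∏ i ∈ (l₁ ++ l₃).toFinset, β i = (l₁.map β).prod * (l₃.map β).prod := by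
        rw [List.prod_toFinset _ (List.nodup_append'.2 ⟨h₁, h₃, h₁₃⟩)]; simp
      rw [List.prod_map_mul, List.prod_map_mul, List.prod_map_mul] at hmem
      refine smul_word_mem_of_unit_smul (u := (l₁.map fun i => (f i).eval (η i)).prod *
        ((l₃.length.factorial : B) * ((l₃.map fun _ => 2).prod *
          (l₃.map fun i => h.eval (η i)).prod))) ?_ ?_
      · have hnat : ∀ k : ℕ, k ≠ 0 → IsUnit (k : B) := fun k hk => by
          have := (IsUnit.mk0 (k : ℚ) (by exact_mod_cast hk)).map (algebraMap ℚ B)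
          simpa using this
        have hlist : ∀ (l : List (Fin n)) (c : Fin n → B), (∀ i ∈ l, IsUnit (c i)) →
            IsUnit (l.map c).prod := by
          intro l c hc
          induction l with
          | nil => simp
          | cons i l ih =>
            simp only [List.map_cons, List.prod_cons]
            exact (hc i (by simp)).mul (ih fun j hj => hc j (by simp [hj]))
        refine (hlist _ _ fun i _ => huf i).mul ((hnat _ (Nat.factorial_ne_zero _)).mul
          ((hlist _ _ fun i _ => ?_).mul (hlist _ _ huh)))
        simpa using hnat 2 two_ne_zero
      · rw [hprod]
        have := W.smul_mem y hmem
        rw [smul_smul] at this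
        convert this using 2
        ring
    · intro q hq
      obtain ⟨i, -, rfl⟩ := List.mem_map.1 hq
      exact nodal_mem_degreeLT _ (by
        rw [Finset.card_erase_of_mem (Finset.mem_univ _)]; have := i.pos; simp; omega)
    · intro q hq
      obtain ⟨i, hi, rfl⟩ := List.mem_map.1 hq
      refine nodal_mem_degreeLT _ ?_
      have hi' : i ∉ (l₁ ++ l₃).toFinset := by
        simp only [List.mem_toFinset, List.mem_append, not_or]
        exact ⟨fun h => h₁₂ h hi, fun h => h₂₃ hi h⟩
      have hc := Finset.card_le_univ (insert i (l₁ ++ l₃).toFinset)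
      rw [Finset.card_insert_of_notMem hi', hcard, Fintype.card_fin] at hc
      rw [Finset.card_sdiff_of_subset (Finset.subset_univ _), Finset.card_insert_of_notMem hi',
        hcard, Finset.card_univ, Fintype.card_fin, List.length_map, List.length_replicate]
      omega
    · intro q hq
      rw [List.eq_of_mem_replicate hq]
      refine nodal_mem_degreeLT _ ?_
      rw [Finset.card_sdiff_of_subset (Finset.subset_univ _), hcard, Finset.card_univ,
        Fintype.card_fin, List.length_map, List.length_replicate]
      omega
  have := smul_word_mem_of_unexpanded (W := W) h₂ h₁₂ h₂₃ meet g hug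
    (fun i j hj hj' => eval_nodal_eq_zero (Finset.mem_sdiff.2 ⟨Finset.mem_univ _,
      fun h => (Finset.mem_insert.1 h).elim hj hj'⟩)) start [] l₂ (by simp) x hx
  simpa using this

end Main
end WedgeSpan

/-! ### From the exterior algebra to antisymmetric polynomials. -/

namespace WedgeSpan

open ExteriorAlgebra Polynomial

variable {B : Type*} [CommRing B]

/-- The product `u_1(X_1) ⋯ u_ℓ(X_ℓ)`, as a multilinear map. -/
def slotProduct (B : Type*) [CommRing B] (ℓ : ℕ) :
    MultilinearMap B (fun _ : Fin ℓ => B[X]) (MvPolynomial (Fin ℓ) B) :=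
  (MultilinearMap.mkPiAlgebra B (Fin ℓ) (MvPolynomial (Fin ℓ) B)).compLinearMap fun a =>
    (Polynomial.aeval (MvPolynomial.X a : MvPolynomial (Fin ℓ) B)).toLinearMap

/-- The antisymmetrization of products `u_1(X_1) ⋯ u_ℓ(X_ℓ)`, as a linear map on the exterior
algebra. -/
def antisym (B : Type*) [CommRing B] (ℓ : ℕ) :
    ExteriorAlgebra B B[X] →ₗ[B] MvPolynomial (Fin ℓ) B :=
  liftAlternating (Pi.single ℓ (MultilinearMap.alternatization (slotProduct B ℓ)))

/-- The linear map sending `f(X_1) g(X_2)` to `f ∧ g`. -/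
def twoForm (B : Type*) [CommRing B] : MvPolynomial (Fin 2) B →ₗ[B] ExteriorAlgebra B B[X] :=
  (MvPolynomial.basisMonomials (Fin 2) B).constr B fun d =>
    ι B (Polynomial.X ^ d 0 : B[X]) * ι B (Polynomial.X ^ d 1 : B[X])

theorem twoForm_monomial (d : Fin 2 →₀ ℕ) :
    twoForm B (MvPolynomial.monomial d 1) =
      ι B (Polynomial.X ^ d 0 : B[X]) * ι B (Polynomial.X ^ d 1 : B[X]) := by
  exact (MvPolynomial.basisMonomials (Fin 2) B).constr_basis B _ d

theorem monomial_fin_two (d : Fin 2 →₀ ℕ) : (MvPolynomial.monomial d 1 : MvPolynomial (Fin 2) B) =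
    MvPolynomial.X 0 ^ d 0 * MvPolynomial.X 1 ^ d 1 := by
  rw [MvPolynomial.monomial_eq, Finsupp.prod_fintype _ _ (by simp)]
  simp

theorem twoForm_mul (f g : B[X]) :
    twoForm B (Polynomial.aeval (MvPolynomial.X 0) f * Polynomial.aeval (MvPolynomial.X 1) g) =
      ι B f * ι B g := by
  induction f using Polynomial.induction_on' with
  | add p q hp hq => simp only [map_add, add_mul, hp, hq]
  | monomial i a =>
    induction g using Polynomial.induction_on' with
    | add p q hp hq => simp only [map_add, mul_add, hp, hq]
    | monomial j b =>
      rw [← Polynomial.smul_X_eq_monomial, ← Polynomial.smul_X_eq_monomial]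
      simp only [map_smul, map_pow, Polynomial.aeval_X, smul_mul_assoc, mul_smul_comm]
      have : (MvPolynomial.X 0 ^ i * MvPolynomial.X 1 ^ j : MvPolynomial (Fin 2) B) =
          MvPolynomial.monomial (Finsupp.single 0 i + Finsupp.single 1 j) 1 := by
        rw [MvPolynomial.X_pow_eq_monomial, MvPolynomial.X_pow_eq_monomial,
          MvPolynomial.monomial_mul, one_mul]
      rw [this, twoForm_monomial]
      simp

theorem antisym_ιMulti (ℓ : ℕ) (u : Fin ℓ → B[X]) :
    antisym B ℓ (ιMulti B ℓ u) = ∑ σ : Equiv.Perm (Fin ℓ), (Equiv.Perm.sign σ : ℤ) •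
      ∏ a, Polynomial.aeval (MvPolynomial.X (σ a) : MvPolynomial (Fin ℓ) B) (u a) := by
  rw [antisym, liftAlternating_apply_ιMulti, Pi.single_eq_same,
    MultilinearMap.alternatization_apply, ← Equiv.sum_comp (Equiv.inv _)]
  refine Finset.sum_congr rfl fun σ _ => ?_
  rw [Equiv.inv_apply, Equiv.Perm.sign_inv, MultilinearMap.domDomCongr_apply, slotProduct,
    MultilinearMap.compLinearMap_apply, MultilinearMap.mkPiAlgebra_apply]
  rw [← Equiv.prod_comp σ]
  simp [Units.smul_def]

theorem prod_ofFn_pairs {A : Type*} [Monoid A] (l : ℕ) (f : Fin l → Fin 2 → A) :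
    (List.ofFn fun c => f c 0 * f c 1).prod =
      (List.ofFn fun k : Fin (2 * l) => f ⟨k / 2, by omega⟩ ⟨k % 2, by omega⟩).prod := by
  rw [List.ofFn_mul', List.prod_flatten, List.map_ofFn]
  congr 2
  funext c
  simp only [Function.comp_apply, List.ofFn_succ, List.ofFn_zero, List.prod_cons, List.prod_nil,
    mul_one]
  congr 1 <;> congr 1 <;> simp [Fin.ext_iff] <;> omega

/-- The antisymmetrization of `∏ u_a ∏ w_b ∏ q_c` with two variables for each `q_c`. -/
theorem antisym_mul_mul (l₁ l₂ l₃ : ℕ) (u : Fin l₁ → B[X]) (w : Fin l₂ → B[X])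
    (q : Fin l₃ → MvPolynomial (Fin 2) B) :
    antisym B (l₁ + l₂ + 2 * l₃) ((List.ofFn fun a => ι B (u a)).prod *
      (List.ofFn fun b => ι B (w b)).prod * (List.ofFn fun c => twoForm B (q c)).prod) =
    ∑ σ : Equiv.Perm (Fin (l₁ + l₂ + 2 * l₃)), (Equiv.Perm.sign σ : ℤ) •
      ((∏ a : Fin l₁, Polynomial.aeval (MvPolynomial.X (σ ⟨a, by omega⟩) :
          MvPolynomial (Fin (l₁ + l₂ + 2 * l₃)) B) (u a)) *
       (∏ b : Fin l₂, Polynomial.aeval (MvPolynomial.X (σ ⟨l₁ + b, by omega⟩) :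
          MvPolynomial (Fin (l₁ + l₂ + 2 * l₃)) B) (w b)) *
       (∏ c : Fin l₃, rename ![σ ⟨l₁ + l₂ + 2 * c, by omega⟩,
          σ ⟨l₁ + l₂ + 2 * c + 1, by omega⟩] (q c))) := by
  set L := l₁ + l₂ + 2 * l₃ with hL
  let F₁ : MultilinearMap B (fun _ : Fin l₃ => MvPolynomial (Fin 2) B) (MvPolynomial (Fin L) B) :=
    ((antisym B L) ∘ₗ LinearMap.mulLeft B ((List.ofFn fun a => ι B (u a)).prod *
      (List.ofFn fun b => ι B (w b)).prod)).compMultilinearMap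
      ((MultilinearMap.mkPiAlgebraFin B l₃ (ExteriorAlgebra B B[X])).compLinearMap
        fun _ => twoForm B)
  let F₂ : MultilinearMap B (fun _ : Fin l₃ => MvPolynomial (Fin 2) B) (MvPolynomial (Fin L) B) :=
    ∑ σ : Equiv.Perm (Fin L), (Equiv.Perm.sign σ : ℤ) •
      (LinearMap.mulLeft B ((∏ a : Fin l₁, Polynomial.aeval (MvPolynomial.X (σ ⟨a, by omega⟩) :
          MvPolynomial (Fin L) B) (u a)) *
       (∏ b : Fin l₂, Polynomial.aeval (MvPolynomial.X (σ ⟨l₁ + b, by omega⟩) :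
          MvPolynomial (Fin L) B) (w b)))).compMultilinearMap
      ((MultilinearMap.mkPiAlgebra B (Fin l₃) (MvPolynomial (Fin L) B)).compLinearMap fun c =>
        (rename ![σ ⟨l₁ + l₂ + 2 * c, by omega⟩,
          σ ⟨l₁ + l₂ + 2 * c + 1, by omega⟩]).toLinearMap)
  have hF₁ : F₁ q = antisym B L ((List.ofFn fun a => ι B (u a)).prod *
      (List.ofFn fun b => ι B (w b)).prod * (List.ofFn fun c => twoForm B (q c)).prod) := rfl
  have hF₂ : F₂ q = ∑ σ : Equiv.Perm (Fin L), (Equiv.Perm.sign σ : ℤ) •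
      ((∏ a : Fin l₁, Polynomial.aeval (MvPolynomial.X (σ ⟨a, by omega⟩) :
          MvPolynomial (Fin L) B) (u a)) *
       (∏ b : Fin l₂, Polynomial.aeval (MvPolynomial.X (σ ⟨l₁ + b, by omega⟩) :
          MvPolynomial (Fin L) B) (w b)) *
       (∏ c : Fin l₃, rename ![σ ⟨l₁ + l₂ + 2 * c, by omega⟩,
          σ ⟨l₁ + l₂ + 2 * c + 1, by omega⟩] (q c))) := by
    simp only [F₂, sum_apply]
    rfl
  rw [← hF₁, ← hF₂]
  congr 1
  -- Both sides are multilinear in `q`. On monomials each two-form splits into two vectors, and the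
  -- whole product is a single `ιMulti`.
  refine Module.Basis.ext_multilinear (fun _ => MvPolynomial.basisMonomials (Fin 2) B) fun d => ?_
  simp only [F₁, F₂, sum_apply, MvPolynomial.coe_basisMonomials]
  simp only [LinearMap.compMultilinearMap_apply, MultilinearMap.compLinearMap_apply,
    MultilinearMap.mkPiAlgebraFin_apply, smul_apply, MultilinearMap.mkPiAlgebra_apply,
    LinearMap.mulLeft_apply, LinearMap.comp_apply, AlgHom.toLinearMap_apply, twoForm_monomial]
  rw [prod_ofFn_pairs l₃ fun c j => ι B (Polynomial.X ^ d c j : B[X]),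
    ← ιMulti_apply, ← ιMulti_apply,
    ← ιMulti_apply (fun k : Fin (2 * l₃) =>
      (Polynomial.X ^ d ⟨k / 2, by omega⟩ ⟨k % 2, by omega⟩ : B[X])),
    ιMulti_mul_ιMulti, ιMulti_mul_ιMulti, antisym_ιMulti]
  refine Finset.sum_congr rfl fun σ _ => ?_
  congr 1
  rw [Fin.prod_univ_add, Fin.prod_univ_add]
  simp only [Fin.append_left, Fin.append_right]
  congr 1
  rw [← List.prod_ofFn (n := 2 * l₃), List.ofFn_mul', List.prod_flatten, List.map_ofFn,
    List.prod_ofFn]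
  refine Finset.prod_congr rfl fun c _ => ?_
  have h₀ : ∀ j : Fin 2, (⟨(2 * (c : ℕ) + j) / 2, by omega⟩ : Fin l₃) = c := fun j =>
    Fin.ext (by simp; omega)
  have h₁ : ∀ j : Fin 2, (⟨(2 * (c : ℕ) + j) % 2, by omega⟩ : Fin 2) = j := fun j =>
    Fin.ext (by simp; omega)
  simp only [Function.comp_apply, List.ofFn_succ, List.ofFn_zero, List.prod_cons, List.prod_nil,
    mul_one, map_pow, Polynomial.aeval_X, monomial_fin_two, h₀, h₁, map_mul, rename_X]
  rfl

end WedgeSpan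

/-! ### The span of the `v_I ∧ w_J ∧ ξ_K` inside the exterior algebra. -/

namespace WedgeSpan

open ExteriorAlgebra Polynomial

variable {B : Type*} [CommRing B] {n ℓ : ℕ}

theorem commute_twoForm (q : MvPolynomial (Fin 2) B) (x : ExteriorAlgebra B B[X]) :
    Commute (twoForm B q) x := by
  induction q using MvPolynomial.induction_on' with
  | monomial d a =>
    rw [← mul_one a, ← smul_eq_mul, ← MvPolynomial.smul_monomial, map_smul, twoForm_monomial]
    exact (commute_ι_mul_ι _ _ _).smul_left _
  | add p q hp hq => rw [map_add]; exact hp.add_left hq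

theorem prod_ofFn_eq_zero_or_exists_strictMono {A : Type*} [Ring A] {f : ℕ → A}
    (hf : ∀ a b, f a * f b = -(f b * f a)) (hs : ∀ a, f a * f a = 0) {l : ℕ} (I : Fin l → ℕ) :
    (List.ofFn fun a => f (I a)).prod = 0 ∨ ∃ σ : Equiv.Perm (Fin l), StrictMono (I ∘ σ) ∧
      ((List.ofFn fun a => f (I a)).prod = (List.ofFn fun a => f (I (σ a))).prod ∨
        (List.ofFn fun a => f (I a)).prod = -(List.ofFn fun a => f (I (σ a))).prod) := by
  have h : ∀ J : Fin l → ℕ, (List.ofFn fun a => f (J a)).prod = ((List.ofFn J).map f).prod :=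
    fun J => by rw [List.map_ofFn]; rfl
  by_cases hI : Function.Injective I
  · refine Or.inr ⟨Tuple.sort I, (Tuple.monotone_sort I).strictMono_of_injective
      (hI.comp (Tuple.sort I).injective), ?_⟩
    rw [h I, h fun a => I (Tuple.sort I a)]
    exact List.Perm.prod_map_eq_or_neg hf (Equiv.Perm.ofFn_comp_perm (Tuple.sort I) I).symm
  · left
    rw [h I]
    exact List.prod_map_eq_zero_of_not_nodup hf hs (by rwa [List.nodup_ofFn])

section Family

variable (φ : SymRing (2 * n) →+* B)

/-- The element of the exterior algebra corresponding to `v_I ∧ w_J ∧ ξ_K`. -/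
def basisForm (t : BasisIndex n ℓ) : ExteriorAlgebra B B[X] :=
  (List.ofFn fun a => ι B ((vElt n (t.I a)).map φ)).prod *
    (List.ofFn fun b => ι B ((wElt n (t.J b)).map φ)).prod *
    (List.ofFn fun c => twoForm B (MvPolynomial.map φ (xiElt n (t.K c)))).prod

theorem map_atVar (a : Fin ℓ) (p : Polynomial (SymRing (2 * n))) :
    MvPolynomial.map φ (atVar a p) = Polynomial.aeval (MvPolynomial.X a) (p.map φ) := by
  rw [atVar, Polynomial.aeval_def, Polynomial.aeval_def, Polynomial.hom_eval₂,
    Polynomial.eval₂_map]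
  congr 1
  · ext x : 1; simp [MvPolynomial.algebraMap_eq]
  · simp

theorem antisym_basisForm (t : BasisIndex n ℓ) :
    antisym B ℓ (basisForm φ t) = MvPolynomial.map φ (basisElt t) := by
  obtain ⟨l₁, l₂, l₃, I, J, K, h₁, h₂, h₃, h₄, h₅, h₆, h₇, h₈, h₉, rfl⟩ := t
  rw [basisForm, antisym_mul_mul, basisElt, map_sum]
  refine Finset.sum_congr rfl fun σ _ => ?_
  simp only [map_zsmul, map_mul, map_prod, map_atVar, MvPolynomial.map_rename]

/-- The span of the vectors `v_r`. -/
def vSpan : Submodule B (ExteriorAlgebra B B[X]) :=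
  Submodule.span B ((fun r => ι B ((vElt n r).map φ)) '' Set.Icc 1 n)

/-- The span of the vectors `w_1, …, w_m`. -/
def wSpan (m : ℕ) : Submodule B (ExteriorAlgebra B B[X]) :=
  Submodule.span B ((fun r => ι B ((wElt n r).map φ)) '' Set.Icc 1 m)

/-- The span of the two-forms `ξ_1, …, ξ_m`. -/
def xiSpan (m : ℕ) : Submodule B (ExteriorAlgebra B B[X]) :=
  Submodule.span B ((fun r => twoForm B (MvPolynomial.map φ (xiElt n r))) '' Set.Icc 1 m)

/-- The span of all `v_I ∧ w_J ∧ ξ_K`. -/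
def basisFormSpan (ℓ : ℕ) : Submodule B (ExteriorAlgebra B B[X]) :=
  Submodule.span B (Set.range (basisForm φ (ℓ := ℓ)))

/-- Sorting the anticommuting factors costs a sign and a repeated index gives zero, while the
two-forms commute and may repeat. This is why `I` and `J` are strictly increasing but `K` only
weakly. -/
theorem basisForm_mem (l₁ l₂ l₃ : ℕ) (hℓ : l₁ + l₂ + 2 * l₃ = ℓ) (hn : l₁ + l₃ ≤ n)
    (I : Fin l₁ → ℕ) (J : Fin l₂ → ℕ) (K : Fin l₃ → ℕ) (hI : ∀ a, I a ∈ Set.Icc 1 n)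
    (hJ : ∀ b, J b ∈ Set.Icc 1 (n - l₁ - l₃)) (hK : ∀ c, K c ∈ Set.Icc 1 (n - l₁ - l₃ + 1)) :
    (List.ofFn fun a => ι B ((vElt n (I a)).map φ)).prod *
      (List.ofFn fun b => ι B ((wElt n (J b)).map φ)).prod *
      (List.ofFn fun c => twoForm B (MvPolynomial.map φ (xiElt n (K c)))).prod ∈
        basisFormSpan φ ℓ := by
  rcases prod_ofFn_eq_zero_or_exists_strictMono (f := fun r => ι B ((vElt n r).map φ))
    (fun _ _ => ι_mul_ι_comm _ _) (fun _ => ι_sq_zero _) I with h | ⟨σ, hσ, h⟩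
  · rw [h]; simp
  rcases prod_ofFn_eq_zero_or_exists_strictMono (f := fun r => ι B ((wElt n r).map φ))
    (fun _ _ => ι_mul_ι_comm _ _) (fun _ => ι_sq_zero _) J with h' | ⟨τ, hτ, h'⟩
  · rw [h']; simp
  have h'' : (List.ofFn fun c => twoForm B (MvPolynomial.map φ (xiElt n (K c)))).prod =
      (List.ofFn fun c => twoForm B (MvPolynomial.map φ (xiElt n (K (Tuple.sort K c))))).prod := by
    refine List.Perm.prod_eq' (Equiv.Perm.ofFn_comp_perm (Tuple.sort K)
      fun c => twoForm B (MvPolynomial.map φ (xiElt n (K c)))).symm ?_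
    rw [List.pairwise_ofFn]
    exact fun _ _ _ => commute_twoForm _ _
  have hmem : basisForm φ (⟨l₁, l₂, l₃, I ∘ σ, J ∘ τ, K ∘ Tuple.sort K, fun a => (hI _).1, hσ,
      fun a => (hI _).2, fun b => (hJ _).1, hτ, fun b => by have := (hJ (τ b)).2; simp; omega,
      fun c => (hK _).1, Tuple.monotone_sort K,
      fun c => by have := (hK (Tuple.sort K c)).2; simp; omega, hℓ⟩ : BasisIndex n ℓ) ∈
      basisFormSpan φ ℓ := Submodule.subset_span ⟨_, rfl⟩
  rw [h'']
  rcases h with h | h <;> rcases h' with h' | h' <;> rw [h, h'] <;>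
    (try simp only [neg_mul, mul_neg, neg_neg, Submodule.neg_mem_iff]) <;> exact hmem

open scoped Pointwise in
theorem exists_of_mem_image_pow {A : Type*} [Monoid A] {f : ℕ → A} {s : Set ℕ} {l : ℕ} {x : A}
    (hx : x ∈ (f '' s) ^ l) :
    ∃ I : Fin l → ℕ, (∀ a, I a ∈ s) ∧ (List.ofFn fun a => f (I a)).prod = x := by
  obtain ⟨g, rfl⟩ := Set.mem_pow.1 hx
  choose I hI hI' using fun a => (g a).2
  exact ⟨I, hI, by simp only [hI']⟩

theorem span_mul_span_le (l₁ l₂ l₃ : ℕ) (hℓ : l₁ + l₂ + 2 * l₃ = ℓ) (hn : l₁ + l₃ ≤ n) :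
    vSpan φ ^ l₁ * wSpan φ (n - l₁ - l₃) ^ l₂ * xiSpan φ (n - l₁ - l₃ + 1) ^ l₃ ≤
      basisFormSpan φ ℓ := by
  rw [vSpan, wSpan, xiSpan, Submodule.span_pow, Submodule.span_pow, Submodule.span_pow,
    Submodule.span_mul_span, Submodule.span_mul_span, Submodule.span_le]
  rintro _ ⟨_, ⟨x, hx, y, hy, rfl⟩, z, hz, rfl⟩
  obtain ⟨I, hI, rfl⟩ := exists_of_mem_image_pow hx
  obtain ⟨J, hJ, rfl⟩ := exists_of_mem_image_pow hy
  obtain ⟨K, hK, rfl⟩ := exists_of_mem_image_pow hz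
  exact basisForm_mem φ l₁ l₂ l₃ hℓ hn I J K hI hJ hK

theorem list_prod_mem_pow {A : Type*} [Ring A] [Algebra B A] {S : Submodule B A} (l : List A)
    (hl : ∀ x ∈ l, x ∈ S) : l.prod ∈ S ^ l.length := by
  induction l with
  | nil => rw [List.prod_nil, List.length_nil, pow_zero]; exact Submodule.one_le.1 le_rfl
  | cons x l ih =>
    rw [List.prod_cons, List.length_cons, pow_succ']
    exact Submodule.mul_mem_mul (hl x (by simp)) (ih fun y hy => hl y (by simp [hy]))

theorem mem_span_image_of_mem_degreeLT {A : Type*} [AddCommGroup A] [Module B A]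
    (L : B[X] →ₗ[B] A) (f : ℕ → A) (hf : ∀ k, L (Polynomial.X ^ k) = f (k + 1)) {m : ℕ} {p : B[X]}
    (hp : p ∈ degreeLT B m) : L p ∈ Submodule.span B (f '' Set.Icc 1 m) := by
  classical
  rw [degreeLT_eq_span_X_pow] at hp
  have := Submodule.mem_map_of_mem (f := L) hp
  rw [Submodule.map_span] at this
  refine Submodule.span_mono ?_ this
  rintro _ ⟨q, hq, rfl⟩
  obtain ⟨k, hk, rfl⟩ := Finset.mem_image.1 (Finset.mem_coe.1 hq)
  exact ⟨k + 1, ⟨by omega, by simpa using hk⟩, (hf k).symm⟩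

/-- All words in the `e_i`, `o_i`, weighted by the `β_i`, are combinations of the
`v_I ∧ w_J ∧ ξ_K`. -/
theorem smul_word_mem_basisFormSpan [Algebra ℚ B] {β η : Fin n → B} {e o : Fin n → B[X]}
    (hη : ∀ i j, i ≠ j → IsUnit (η i - η j))
    (hv : ∀ k, weighted β η e (Polynomial.X ^ k) = (vElt n (k + 1)).map φ)
    (hw : ∀ k, weighted β η o (Polynomial.X ^ k) = (wElt n (k + 1)).map φ)
    (hx : ∀ k, weightedPair β η e o (Polynomial.X ^ k) =
      twoForm B (MvPolynomial.map φ (xiElt n (k + 1))))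
    (l₁ l₂ l₃ : List (Fin n)) (hl : l₁.length + l₂.length + 2 * l₃.length = ℓ) (x : B)
    (hd : (∏ i ∈ (l₁ ++ l₂ ++ l₃).toFinset, β i) ∣ x) :
    x • (word e l₁ * word o l₂ * pairs e o l₃) ∈ basisFormSpan φ ℓ := by
  refine smul_word_mem hη (fun fs gs hs hn hℓ hf hg hh => ?_) l₁ l₂ l₃ hl x hd
  refine span_mul_span_le φ fs.length gs.length hs.length hℓ hn ?_
  refine Submodule.mul_mem_mul (Submodule.mul_mem_mul ?_ ?_) ?_
  · have := list_prod_mem_pow (S := vSpan φ) (fs.map fun f => ι B (weighted β η e f)) ?_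
    · simpa using this
    · intro y hy
      obtain ⟨f, hf', rfl⟩ := List.mem_map.1 hy
      exact mem_span_image_of_mem_degreeLT ((ι B).comp (weighted β η e)) _
        (fun k => by simp [hv]) (hf f hf')
  · have := list_prod_mem_pow (S := wSpan φ (n - fs.length - hs.length))
      (gs.map fun f => ι B (weighted β η o f)) ?_
    · simpa using this
    · intro y hy
      obtain ⟨f, hf', rfl⟩ := List.mem_map.1 hy
      exact mem_span_image_of_mem_degreeLT ((ι B).comp (weighted β η o)) _
        (fun k => by simp [hw]) (hg f hf')
  · have := list_prod_mem_pow (S := xiSpan φ (n - fs.length - hs.length + 1))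
      (hs.map fun f => weightedPair β η e o f) ?_
    · simpa using this
    · intro y hy
      obtain ⟨f, hf', rfl⟩ := List.mem_map.1 hy
      exact mem_span_image_of_mem_degreeLT (weightedPair β η e o) _ hx (hh f hf')

end Family

end WedgeSpan

/-! ### The recursion for `v_r` and the defining relation of `ξ_k`. -/

theorem SymRing.toPoly_injective (N : ℕ) : Function.Injective (SymRing.toPoly N) :=
  Subtype.val_injective

theorem toPoly_elemSym (N k : ℕ) : SymRing.toPoly N (elemSym N k) = esymm (Fin N) ℂ k := by
  unfold elemSym
  split_ifs with h
  · rfl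
  · exact absurd (Int.natCast_nonneg k) h

theorem elemSym_zero (N : ℕ) : elemSym N 0 = 1 :=
  SymRing.toPoly_injective N (by
    rw [← Nat.cast_zero, toPoly_elemSym, esymm_zero, map_one])

theorem elemSym_eq_zero {N : ℕ} {k : ℤ} (h : (N : ℤ) < k) : elemSym N k = 0 := by
  obtain ⟨m, rfl⟩ := Int.eq_ofNat_of_zero_le (show 0 ≤ k by omega)
  refine SymRing.toPoly_injective N ?_
  rw [toPoly_elemSym, map_zero, esymm, Finset.powersetCard_eq_empty.2 (by simp; omega),
    Finset.sum_empty]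

theorem coeffP_eq_zero {n r : ℕ} {s : ℤ} (h : (n : ℤ) < s) : coeffP (2 * n) r s = 0 := by
  induction r using Nat.strong_induction_on generalizing s with
  | _ r ih =>
  match r, ih with
  | 0, _ => rfl
  | 1, _ => rw [coeffP]; exact elemSym_eq_zero (by push_cast; omega)
  | r + 2, ih =>
    rw [coeffP, ih (r + 1) (by omega) (by omega), elemSym_eq_zero (by push_cast; omega)]
    simp

theorem vZero_eq (n : ℕ) : vZero n = 1 + ∑ s ∈ Finset.range n,
    Polynomial.C (elemSym (2 * n) (2 * (s + 1 : ℕ))) * Polynomial.X ^ (2 * (s + 1)) := by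
  rw [vZero, Finset.sum_range_succ']
  simp only [Nat.cast_zero, mul_zero, elemSym_zero, map_one, pow_zero, mul_one]
  rw [add_comm]

theorem vElt_eq (n r : ℕ) : vElt n r = ∑ s ∈ Finset.range n,
    Polynomial.C (coeffP (2 * n) r (s + 1 : ℕ)) * Polynomial.X ^ (2 * s) := by
  rw [vElt, Finset.range_eq_Ico, ← Finset.Ico_add_one_right_eq_Icc,
    ← Finset.sum_Ico_add' _ 0 n 1]
  simp

/-- The recursion for `coeffP` in generating-function form. Since `e_0 = 1`, the subtraction cancels
the constant term; the coefficients beyond `n` are zero, so truncating the sum loses nothing. -/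
theorem X_sq_mul_vElt (n r : ℕ) : Polynomial.X ^ 2 * vElt n (r + 2) =
    vElt n (r + 1) - Polynomial.C (coeffP (2 * n) (r + 1) 1) * vZero n := by
  have h1 : vElt n (r + 1) = Polynomial.C (coeffP (2 * n) (r + 1) 1) + ∑ s ∈ Finset.range n,
      Polynomial.C (coeffP (2 * n) (r + 1) (s + 2 : ℕ)) * Polynomial.X ^ (2 * (s + 1)) := by
    have h2 := Finset.sum_range_succ (fun s : ℕ => Polynomial.C (coeffP (2 * n) (r + 1) (s + 1 : ℕ)) *
      (Polynomial.X : Polynomial (SymRing (2 * n))) ^ (2 * s)) n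
    rw [coeffP_eq_zero (s := ((n + 1 : ℕ) : ℤ)) (by push_cast; omega), map_zero, zero_mul,
      add_zero, Finset.sum_range_succ'] at h2
    rw [vElt_eq, ← h2]
    rw [add_comm]
    simp [add_assoc, one_add_one_eq_two]
  rw [h1, vElt_eq, vZero_eq, mul_add, mul_one, add_sub_add_left_eq_sub, Finset.mul_sum,
    Finset.mul_sum, ← Finset.sum_sub_distrib]
  refine Finset.sum_congr rfl fun s _ => ?_
  rw [coeffP]
  simp only [map_sub, map_mul, Nat.cast_add, Nat.cast_one, Nat.cast_ofNat, add_assoc,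
    one_add_one_eq_two]
  ring

/-- With `w_k = X v_k` substituted, two of the four terms double and the mixed ones cancel. In this
form each variable enters each term through `v_0` or `v_k`. -/
theorem xiElt_spec (n k : ℕ) : (X 0 + X 1) * (2 * xiElt n k) =
    2 * (X 0 ^ 2 * atVar 1 (vZero n) * atVar 0 (vElt n k) -
      X 1 ^ 2 * atVar 0 (vZero n) * atVar 1 (vElt n k)) := by
  rw [xiElt, (xi_exists n k).choose_spec]
  have hw : ∀ a : Fin 2, atVar a (wElt n k) = X a * atVar a (vElt n k) := by
    intro a; simp [atVar, wElt]
  rw [hw, hw]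
  ring

/-! ### Diagonalization of `v_r`, `w_r` and `ξ_k`. -/

namespace WedgeSpan

open ExteriorAlgebra Polynomial

variable {B : Type*} [CommRing B] [IsDomain B] [Algebra ℚ B] {n ℓ : ℕ}
  {φ : SymRing (2 * n) →+* B}

theorem two_ne_zero_of_rat : (2 : B) ≠ 0 := by
  have : CharZero B := algebraRat.charZero B
  exact two_ne_zero

theorem map_xiElt_spec (φ : SymRing (2 * n) →+* B) (k : ℕ) :
    (MvPolynomial.X 0 + MvPolynomial.X 1) * MvPolynomial.map φ (xiElt n k) =
      MvPolynomial.X 0 ^ 2 * Polynomial.aeval (MvPolynomial.X 1) ((vZero n).map φ) *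
        Polynomial.aeval (MvPolynomial.X 0) ((vElt n k).map φ) -
      MvPolynomial.X 1 ^ 2 * Polynomial.aeval (MvPolynomial.X 0) ((vZero n).map φ) *
        Polynomial.aeval (MvPolynomial.X 1) ((vElt n k).map φ) := by
  have h := congrArg (MvPolynomial.map φ) (xiElt_spec n k)
  simp only [map_mul, map_add, map_sub, map_pow, MvPolynomial.map_X, map_ofNat, map_atVar] at h
  have h2 : (2 : MvPolynomial (Fin 2) B) ≠ 0 := by
    intro h0
    have := congrArg (MvPolynomial.coeff 0) h0
    rw [← map_ofNat (MvPolynomial.C (σ := Fin 2) (R := B)) 2] at this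
    simp [two_ne_zero_of_rat] at this
  refine mul_left_cancel₀ h2 ?_
  rw [← h]
  ring

omit [Algebra ℚ B] in
theorem X_add_X_ne_zero {σ : Type*} {a b : σ} (h : a ≠ b) :
    (MvPolynomial.X a + MvPolynomial.X b : MvPolynomial σ B) ≠ 0 := by
  classical
  intro h0
  have := congrArg (MvPolynomial.coeff (Finsupp.single a 1)) h0
  simp [MvPolynomial.coeff_X, Finsupp.single_left_inj, h.symm] at this

/-- The polynomial `∏_{j ≠ i} (1 - η_j X²)`. -/
def evenBasis (η : Fin n → B) (i : Fin n) : B[X] :=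
  ∏ j ∈ Finset.univ.erase i, (1 - Polynomial.C (η j) * Polynomial.X ^ 2)

/-- The polynomial `X ∏_{j ≠ i} (1 - η_j X²)`. -/
def oddBasis (η : Fin n → B) (i : Fin n) : B[X] := Polynomial.X * evenBasis η i

variable {β η : Fin n → B}

omit [IsDomain B] [Algebra ℚ B] in
theorem map_vZero_eq_mul
    (h₀ : (vZero n).map φ = ∏ j, (1 - Polynomial.C (η j) * Polynomial.X ^ 2)) (i : Fin n) :
    (vZero n).map φ = (1 - Polynomial.C (η i) * Polynomial.X ^ 2) * evenBasis η i := by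
  rw [h₀, evenBasis, Finset.mul_prod_erase Finset.univ
    (fun j => 1 - Polynomial.C (η j) * Polynomial.X ^ 2) (Finset.mem_univ i)]

-- By the recursion: the `i`-th summand of `v_{k+1} - P_{k+1,1} v_0` contains the factor `1 - (1 -
-- η_i X²) = η_i X²`, so division by `X²` multiplies the `i`-th coefficient by `η_i`.
omit [Algebra ℚ B] in
theorem map_vElt (h₀ : (vZero n).map φ = ∏ j, (1 - Polynomial.C (η j) * Polynomial.X ^ 2))
    (h₁ : (vElt n 1).map φ = ∑ i, β i • evenBasis η i) (k : ℕ) :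
    (vElt n (k + 1)).map φ = ∑ i, (β i * η i ^ k) • evenBasis η i := by
  induction k with
  | zero => simpa using h₁
  | succ k ih =>
    have hX : (Polynomial.X ^ 2 : B[X]) ≠ 0 := pow_ne_zero _ Polynomial.X_ne_zero
    refine mul_left_cancel₀ hX ?_
    have h := congrArg (Polynomial.map φ) (X_sq_mul_vElt n k)
    simp only [Polynomial.map_mul, Polynomial.map_pow, Polynomial.map_X, Polynomial.map_sub,
      Polynomial.map_C] at h
    rw [h]
    -- The constant term identifies `P_{k+1,1}` with `∑ β_i η_i^k`.
    have hc := congrArg (Polynomial.eval 0) h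
    have hE : ∀ i, (evenBasis η i).eval 0 = 1 := fun i => by
      simp [evenBasis, Polynomial.eval_prod]
    have ha : ((vZero n).map φ).eval 0 = 1 := by simp [h₀, Polynomial.eval_prod]
    rw [Polynomial.eval_sub, Polynomial.eval_mul, Polynomial.eval_mul, ha, ih] at hc
    simp only [Polynomial.eval_pow, Polynomial.eval_X, ne_eq, OfNat.ofNat_ne_zero,
      not_false_eq_true, zero_pow, zero_mul, Polynomial.eval_finsetSum, Polynomial.eval_smul, hE,
      Polynomial.eval_C, smul_eq_mul, mul_one] at hc
    rw [← sub_eq_zero.1 hc.symm, ih, map_sum, Finset.sum_mul, ← Finset.sum_sub_distrib,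
      Finset.mul_sum]
    refine Finset.sum_congr rfl fun i _ => ?_
    rw [map_vZero_eq_mul h₀ i, Polynomial.smul_eq_C_mul, Polynomial.smul_eq_C_mul, pow_succ]
    simp only [map_mul, map_pow]
    ring

omit [Algebra ℚ B] in
theorem map_wElt (h₀ : (vZero n).map φ = ∏ j, (1 - Polynomial.C (η j) * Polynomial.X ^ 2))
    (h₁ : (vElt n 1).map φ = ∑ i, β i • evenBasis η i) (k : ℕ) :
    (wElt n (k + 1)).map φ = ∑ i, (β i * η i ^ k) • oddBasis η i := by
  rw [wElt, Polynomial.map_mul, Polynomial.map_X, map_vElt h₀ h₁, Finset.mul_sum]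
  exact Finset.sum_congr rfl fun i _ => mul_smul_comm _ _ _

/-- After multiplication by `X_1 + X_2`, the identity `X_1² (1 - η_i X_2²) - X_2² (1 - η_i X_1²) =
X_1² - X_2²` makes the `i`-th summand independent of `η_i` apart from its coefficient and `E_i`. -/
theorem map_xiElt (h₀ : (vZero n).map φ = ∏ j, (1 - Polynomial.C (η j) * Polynomial.X ^ 2))
    (h₁ : (vElt n 1).map φ = ∑ i, β i • evenBasis η i) (k : ℕ) :
    MvPolynomial.map φ (xiElt n (k + 1)) = ∑ i, (β i * η i ^ k) •
      ((MvPolynomial.X 0 - MvPolynomial.X 1) * Polynomial.aeval (MvPolynomial.X 0) (evenBasis η i) *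
        Polynomial.aeval (MvPolynomial.X 1) (evenBasis η i)) := by
  refine mul_left_cancel₀ (X_add_X_ne_zero (a := (0 : Fin 2)) (b := 1) (by decide)) ?_
  rw [map_xiElt_spec, map_vElt h₀ h₁]
  simp only [map_sum, Finset.mul_sum, ← Finset.sum_sub_distrib]
  refine Finset.sum_congr rfl fun i _ => ?_
  rw [map_vZero_eq_mul h₀ i]
  simp only [map_smul, map_mul, map_sub, map_one, map_pow, Polynomial.aeval_X, Polynomial.aeval_C,
    MvPolynomial.algebraMap_eq, MvPolynomial.smul_eq_C_mul]
  ring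

/-- The antisymmetric `O_i(X_1) E_i(X_2) - E_i(X_1) O_i(X_2)` goes to twice `O_i ∧ E_i`, which
accounts for the factor two in `weightedPair`. -/
theorem twoForm_map_xiElt
    (h₀ : (vZero n).map φ = ∏ j, (1 - Polynomial.C (η j) * Polynomial.X ^ 2))
    (h₁ : (vElt n 1).map φ = ∑ i, β i • evenBasis η i) (k : ℕ) :
    twoForm B (MvPolynomial.map φ (xiElt n (k + 1))) =
      weightedPair β η (evenBasis η) (oddBasis η) (Polynomial.X ^ k) := by
  rw [map_xiElt h₀ h₁, weightedPair_apply, map_sum]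
  refine Finset.sum_congr rfl fun i _ => ?_
  have : (MvPolynomial.X 0 - MvPolynomial.X 1) *
      Polynomial.aeval (MvPolynomial.X 0 : MvPolynomial (Fin 2) B) (evenBasis η i) *
        Polynomial.aeval (MvPolynomial.X 1) (evenBasis η i) =
      Polynomial.aeval (MvPolynomial.X 0) (oddBasis η i) *
        Polynomial.aeval (MvPolynomial.X 1) (evenBasis η i) -
      Polynomial.aeval (MvPolynomial.X 0) (evenBasis η i) *
        Polynomial.aeval (MvPolynomial.X 1) (oddBasis η i) := by
    simp only [oddBasis, map_mul, Polynomial.aeval_X]; ring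
  rw [this, map_smul, map_sub, twoForm_mul, twoForm_mul, ι_mul_ι_comm (evenBasis η i),
    sub_neg_eq_add, ← two_smul B, smul_smul]
  simp [mul_comm]

/-- All words in the `E_i`, `O_i`, weighted by the `β_i`, are combinations of the
`v_I ∧ w_J ∧ ξ_K`. -/
theorem smul_word_evenBasis_mem (hη : ∀ i j, i ≠ j → IsUnit (η i - η j))
    (h₀ : (vZero n).map φ = ∏ j, (1 - Polynomial.C (η j) * Polynomial.X ^ 2))
    (h₁ : (vElt n 1).map φ = ∑ i, β i • evenBasis η i)
    (l₁ l₂ : List (Fin n)) (hl : l₁.length + l₂.length = ℓ) (x : B)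
    (hd : (∏ i ∈ (l₁ ++ l₂).toFinset, β i) ∣ x) :
    x • (word (evenBasis η) l₁ * word (oddBasis η) l₂) ∈ basisFormSpan φ ℓ := by
  have := smul_word_mem_basisFormSpan (ℓ := ℓ) φ (β := β) (e := evenBasis η) (o := oddBasis η) hη
    (fun k => by rw [map_vElt h₀ h₁]; simp [weighted])
    (fun k => by rw [map_wElt h₀ h₁]; simp [weighted])
    (fun k => (twoForm_map_xiElt h₀ h₁ k).symm) l₁ l₂ [] (by simpa using hl) x (by simpa using hd)
  simpa [pairs] using this

end WedgeSpan

/-! ### Interpolation at the points `±ζ_i⁻¹`. -/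

namespace WedgeSpan

open ExteriorAlgebra Polynomial

variable {B : Type*} [CommRing B] {n ℓ : ℕ}

theorem ι_mul_word {M : Type*} [AddCommGroup M] [Module B M] (e : Fin n → M) (m : M)
    (l : List (Fin n)) : word e l * ι B m = ι B m * word e l ∨
      word e l * ι B m = -(ι B m * word e l) := by
  induction l with
  | nil => simp [word]
  | cons i l ih =>
    rw [word_cons, mul_assoc, ← mul_assoc (ι B m), ι_mul_ι_comm m (e i), neg_mul]
    rcases ih with h | h <;> rw [h] <;> simp [mul_assoc]

/-- A product of combinations of `e_i` and `o_i` lies in any submodule containing the words in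
the same letters. -/
theorem smul_word_mul_prod_mem_of_words {M ι' : Type*} [AddCommGroup M] [Module B M]
    {e o : Fin n → M} {β : Fin n → B} {W : Submodule B (ExteriorAlgebra B M)}
    (hW : ∀ l₁ l₂ : List (Fin n), l₁.length + l₂.length = ℓ → ∀ x : B,
      (∏ i ∈ (l₁ ++ l₂).toFinset, β i) ∣ x → x • (word e l₁ * word o l₂) ∈ W)
    (site : ι' → Fin n) (N : ι' → M) (c d : ι' → B)
    (hN : ∀ p, N p = c p • e (site p) + d p • o (site p)) (L : List ι') (l₁ l₂ : List (Fin n))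
    (hl : l₁.length + l₂.length + L.length = ℓ) (x : B)
    (hx : (∏ i ∈ (l₁ ++ l₂ ++ L.map site).toFinset, β i) ∣ x) :
    x • (word e l₁ * word o l₂ * (L.map fun p => ι B (N p)).prod) ∈ W := by
  induction L generalizing l₁ l₂ x with
  | nil => simpa using hW l₁ l₂ (by simpa using hl) x (by simpa using hx)
  | cons p L ih =>
    set y := (L.map fun p => ι B (N p)).prod with hy
    have he : x • (word e l₁ * word o l₂ * (ι B (e (site p)) * y)) ∈ W := by
      have := ih (l₁ ++ [site p]) l₂ (by simp at hl ⊢; omega) x (by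
        convert hx using 2; ext; simp)
      rw [word_append, word_singleton] at this
      rcases ι_mul_word (B := B) o (e (site p)) l₂ with h | h <;>
        rw [mul_assoc, ← mul_assoc (word o l₂), h]
      · simpa only [mul_assoc] using this
      · simpa only [mul_assoc, neg_mul, mul_neg, smul_neg, neg_mem_iff] using this
    have ho : x • (word e l₁ * word o l₂ * (ι B (o (site p)) * y)) ∈ W := by
      have := ih l₁ (l₂ ++ [site p]) (by simp at hl ⊢; omega) x (by
        convert hx using 2; ext; simp)
      rw [word_append, word_singleton] at this
      simpa only [mul_assoc] using this
    rw [List.map_cons, List.prod_cons, hN p, map_add, map_smul, map_smul, add_mul, mul_add,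
      smul_mul_assoc, smul_mul_assoc, mul_smul_comm, mul_smul_comm, smul_add, smul_comm x,
      smul_comm x]
    exact W.add_mem (W.smul_mem _ he) (W.smul_mem _ ho)

/-- Interpolation of a polynomial in several variables on a grid. -/
theorem eq_sum_eval_smul_prod {ι' : Type*} [Fintype ι'] [DecidableEq ι'] (pt : ι' → B)
    (N : ι' → B[X]) {d : ℕ}
    (hN : ∀ k < d, (Polynomial.X ^ k : B[X]) = ∑ p, pt p ^ k • N p)
    (P : MvPolynomial (Fin ℓ) B) (hP : ∀ m ∈ P.support, ∀ a, m a < d) :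
    P = ∑ x : Fin ℓ → ι', (MvPolynomial.eval (fun a => pt (x a)) P) •
      ∏ a, Polynomial.aeval (MvPolynomial.X a : MvPolynomial (Fin ℓ) B) (N (x a)) := by
  have key : ∀ m ∈ P.support, MvPolynomial.monomial m (P.coeff m) =
      ∑ x : Fin ℓ → ι', (P.coeff m * ∏ a, pt (x a) ^ m a) •
        ∏ a, Polynomial.aeval (MvPolynomial.X a : MvPolynomial (Fin ℓ) B) (N (x a)) := by
    intro m hm
    rw [MvPolynomial.monomial_eq, Finsupp.prod_fintype _ _ (by simp)]
    have : ∀ a, (MvPolynomial.X a ^ m a : MvPolynomial (Fin ℓ) B) =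
        ∑ p, pt p ^ m a • Polynomial.aeval (MvPolynomial.X a) (N p) := fun a => by
      have := congrArg (Polynomial.aeval (MvPolynomial.X a : MvPolynomial (Fin ℓ) B))
        (hN (m a) (hP m hm a))
      simpa using this
    simp only [this]
    rw [Finset.prod_univ_sum, Fintype.piFinset_univ, Finset.mul_sum]
    refine Finset.sum_congr rfl fun x _ => ?_
    rw [← MvPolynomial.smul_eq_C_mul, mul_smul]
    congr 1
    simp only [MvPolynomial.smul_eq_C_mul, Finset.prod_mul_distrib, map_prod]
  conv_lhs => rw [MvPolynomial.as_sum P, Finset.sum_congr rfl key, Finset.sum_comm]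
  refine Finset.sum_congr rfl fun x _ => ?_
  rw [← Finset.sum_smul, MvPolynomial.eval_eq' _ P]

theorem antisym_ιMulti_eq (u : Fin ℓ → B[X]) :
    antisym B ℓ (ιMulti B ℓ u) = ∑ σ : Equiv.Perm (Fin ℓ), (Equiv.Perm.sign σ : ℤ) •
      rename σ (∏ a, Polynomial.aeval (MvPolynomial.X a : MvPolynomial (Fin ℓ) B) (u a)) := by
  rw [antisym_ιMulti]
  refine Finset.sum_congr rfl fun σ _ => ?_
  rw [map_prod]
  congr 1
  refine Finset.prod_congr rfl fun a _ => ?_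
  rw [← Polynomial.aeval_algHom_apply, rename_X]

/-- Antisymmetrizing `P` multiplies it by `ℓ!`; antisymmetrizing its interpolation formula turns
each product of node polynomials into a wedge. -/
theorem factorial_smul_eq_sum {ι' : Type*} [Fintype ι'] [DecidableEq ι'] (pt : ι' → B)
    (N : ι' → B[X]) {d : ℕ}
    (hN : ∀ k < d, (Polynomial.X ^ k : B[X]) = ∑ p, pt p ^ k • N p)
    (P : MvPolynomial (Fin ℓ) B)
    (hσ : ∀ σ : Equiv.Perm (Fin ℓ), rename σ P = (Equiv.Perm.sign σ : ℤ) • P)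
    (hP : ∀ m ∈ P.support, ∀ a, m a < d) :
    (ℓ.factorial : B) • P = ∑ x : Fin ℓ → ι', (MvPolynomial.eval (fun a => pt (x a)) P) •
      antisym B ℓ (ιMulti B ℓ fun a => N (x a)) := by
  have h1 : (ℓ.factorial : B) • P =
      ∑ σ : Equiv.Perm (Fin ℓ), (Equiv.Perm.sign σ : ℤ) • rename σ P := by
    have : ∀ σ : Equiv.Perm (Fin ℓ), (Equiv.Perm.sign σ : ℤ) • rename σ P = P := fun σ => by
      rw [hσ, smul_smul, ← Units.val_mul, Int.units_mul_self, Units.val_one, one_smul]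
    simp only [this, Finset.sum_const, Finset.card_univ, Fintype.card_perm, Fintype.card_fin]
    rw [Nat.cast_smul_eq_nsmul]
  rw [h1]
  simp only [antisym_ιMulti_eq, Finset.smul_sum]
  rw [Finset.sum_comm]
  refine Finset.sum_congr rfl fun σ _ => ?_
  conv_lhs => rw [eq_sum_eval_smul_prod pt N hN P hP]
  rw [map_sum, Finset.smul_sum]
  refine Finset.sum_congr rfl fun x _ => ?_
  rw [map_smul, smul_comm]

variable [IsDomain B] [Algebra ℚ B] {φ : SymRing (2 * n) →+* B}

/-- The point `± ζ_i⁻¹`. -/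
def gridPoint (ζ : Fin n → Bˣ) (p : Fin n × ℤˣ) : B := ((p.2 : ℤ) : B) * ↑(ζ p.1)⁻¹

section Grid

variable (ζ : Fin n → Bˣ)

/-- The squares `ζ_i²`. -/
def sq (i : Fin n) : B := (ζ i : B) ^ 2

omit [IsDomain B] [Algebra ℚ B] in
theorem sq_mul_gridPoint_sq (p : Fin n × ℤˣ) : sq ζ p.1 * gridPoint ζ p ^ 2 = 1 := by
  have h : (((p.2 : ℤ) : B)) ^ 2 = 1 := by
    rw [← Int.cast_pow, ← Units.val_pow_eq_pow_val, Int.units_sq]; simp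
  rw [gridPoint, sq, mul_pow, h, one_mul, ← mul_pow, Units.mul_inv, one_pow]

omit [IsDomain B] [Algebra ℚ B] in
theorem eval_evenBasis_of_ne (i : Fin n) (p : Fin n × ℤˣ) (h : p.1 ≠ i) :
    (evenBasis (sq ζ) i).eval (gridPoint ζ p) = 0 := by
  rw [evenBasis, Polynomial.eval_prod]
  refine Finset.prod_eq_zero (i := p.1) (by simpa using h) ?_
  simp [sq_mul_gridPoint_sq]

/-- The value of `∏_{j ≠ i} (1 - ζ_j² X²)` at `± ζ_i⁻¹`. -/
def gridValue (i : Fin n) : B := ∏ j ∈ Finset.univ.erase i, (1 - sq ζ j * (↑(ζ i)⁻¹ : B) ^ 2)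

omit [IsDomain B] [Algebra ℚ B] in
theorem eval_evenBasis_self (p : Fin n × ℤˣ) :
    (evenBasis (sq ζ) p.1).eval (gridPoint ζ p) = gridValue ζ p.1 := by
  rw [evenBasis, Polynomial.eval_prod, gridValue]
  refine Finset.prod_congr rfl fun j _ => ?_
  have h : (((p.2 : ℤ) : B)) ^ 2 = 1 := by
    rw [← Int.cast_pow, ← Units.val_pow_eq_pow_val, Int.units_sq]; simp
  simp [gridPoint, mul_pow, h]

omit [IsDomain B] [Algebra ℚ B] in
theorem isUnit_gridValue (hη : ∀ i j, i ≠ j → IsUnit (sq ζ i - sq ζ j)) (i : Fin n) :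
    IsUnit (gridValue ζ i) := by
  rw [gridValue, IsUnit.prod_iff]
  intro j hj
  have : 1 - sq ζ j * (↑(ζ i)⁻¹ : B) ^ 2 = (sq ζ i - sq ζ j) * (↑(ζ i)⁻¹ : B) ^ 2 := by
    rw [sub_mul, show sq ζ i * (↑(ζ i)⁻¹ : B) ^ 2 = 1 by
      rw [sq, ← mul_pow, Units.mul_inv, one_pow]]
  rw [this]
  exact (hη i j (Finset.ne_of_mem_erase hj).symm).mul (Units.isUnit _ |>.pow 2)

theorem gridPoint_injective (hη : ∀ i j, i ≠ j → IsUnit (sq ζ i - sq ζ j)) :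
    Function.Injective (gridPoint ζ) := by
  rintro ⟨i, s⟩ ⟨j, t⟩ h
  have h2 := sq_mul_gridPoint_sq ζ (i, s)
  have h3 := sq_mul_gridPoint_sq ζ (j, t)
  rw [← h] at h3
  by_cases hij : i = j
  · subst hij
    have h4 : ((s : ℤ) : B) = ((t : ℤ) : B) := (Units.isUnit (ζ i)⁻¹).mul_right_cancel h
    have : CharZero B := algebraRat.charZero B
    simpa [Prod.ext_iff, Units.ext_iff] using h4
  · exfalso
    refine (hη i j hij).ne_zero ?_
    have h5 : (sq ζ i - sq ζ j) * gridPoint ζ (i, s) ^ 2 = 0 := by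
      rw [sub_mul, h2, h3, sub_self]
    refine (mul_eq_zero.1 h5).resolve_right fun h0 => ?_
    rw [h0, mul_zero] at h2
    exact zero_ne_one h2

omit [IsDomain B] [Algebra ℚ B] in
theorem degree_evenBasis_add_one_lt (η : Fin n → B) (i : Fin n) :
    (evenBasis η i).degree + 1 < (2 * n : ℕ) := by
  have h1 : (evenBasis (η) i).natDegree ≤ 2 * (n - 1) := by
    refine (Polynomial.natDegree_prod_le _ _).trans ?_
    refine (Finset.sum_le_card_nsmul _ _ 2 fun j _ => ?_).trans ?_
    · compute_degree
    · simp [mul_comm]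
  have h3 := Polynomial.degree_le_natDegree (p := evenBasis (η) i)
  have := i.pos
  calc (evenBasis (η) i).degree + 1 ≤ ((2 * (n - 1) : ℕ) : WithBot ℕ) + 1 := by
        gcongr; exact h3.trans (by exact_mod_cast h1)
    _ < (2 * n : ℕ) := by norm_cast; omega

/-- The interpolation basis at the points `± ζ_i⁻¹`. -/
theorem exists_gridBasis (hη : ∀ i j, i ≠ j → IsUnit (sq ζ i - sq ζ j)) :
    ∃ c d : Fin n × ℤˣ → B, ∀ k < 2 * n, (Polynomial.X ^ k : B[X]) = ∑ p, gridPoint ζ p ^ k •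
      (c p • evenBasis (sq ζ) p.1 + d p • oddBasis (sq ζ) p.1) := by
  have hcz : CharZero B := algebraRat.charZero B
  have h2 : IsUnit (2 : B) := by
    have := (IsUnit.mk0 (2 : ℚ) two_ne_zero).map (algebraMap ℚ B)
    rwa [map_ofNat] at this
  choose u hu using fun i => h2.mul (isUnit_gridValue ζ hη i)
  -- The Lagrange polynomial of the node `ε ζ_i⁻¹` is `E_i (1 + ε ζ_i X)` divided by twice the value
  -- of `E_i` there: the linear factor is `2` at the node and `0` at its negative.
  refine ⟨fun p => ↑(u p.1)⁻¹, fun p => ↑(u p.1)⁻¹ * (((p.2 : ℤ) : B) * ζ p.1), fun k hk => ?_⟩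
  have hdE := degree_evenBasis_add_one_lt (sq ζ)
  have hdO : ∀ i, (oddBasis (sq ζ) i).degree < (2 * n : ℕ) := fun i => by
    rw [oddBasis, Polynomial.degree_mul, Polynomial.degree_X, add_comm]; exact hdE i
  have hdE' : ∀ i, (evenBasis (sq ζ) i).degree < (2 * n : ℕ) := fun i =>
    lt_of_le_of_lt (le_add_of_nonneg_right (by norm_num)) (hdE i)
  refine Polynomial.eq_of_degrees_lt_of_eval_index_eq Finset.univ
    ((gridPoint_injective ζ hη).injOn) ?_ ?_ ?_
  · rw [Polynomial.degree_X_pow, Finset.card_univ, Fintype.card_prod, Fintype.card_fin,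
      Fintype.card_units_int, mul_comm]; exact_mod_cast hk
  · rw [← Polynomial.mem_degreeLT]
    refine Submodule.sum_mem _ fun p _ => Submodule.smul_mem _ _ (Submodule.add_mem _
      (Submodule.smul_mem _ _ ?_) (Submodule.smul_mem _ _ ?_)) <;> rw [Polynomial.mem_degreeLT]
    · simpa [mul_comm] using hdE' p.1
    · simpa [mul_comm] using hdO p.1
  · intro q _
    rw [Polynomial.eval_finsetSum, Finset.sum_eq_single q]
    · simp only [Polynomial.eval_pow, Polynomial.eval_X, Polynomial.eval_smul, Polynomial.eval_add,
        smul_eq_mul, oddBasis, Polynomial.eval_mul, eval_evenBasis_self]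
      have h : (((q.2 : ℤ) : B)) * ((q.2 : ℤ) : B) = 1 := by
        rw [← Int.cast_mul, ← Units.val_mul, Int.units_mul_self]; simp
      have h3 : (ζ q.1 : B) * ↑(ζ q.1)⁻¹ = 1 := Units.mul_inv _
      have h4 : (↑(u q.1)⁻¹ : B) * (2 * gridValue ζ q.1) = 1 := by rw [← hu]; exact Units.inv_mul _
      have h5 : ((q.2 : ℤ) : B) * (ζ q.1) * gridPoint ζ q = 1 := by
        rw [gridPoint]; linear_combination (((q.2 : ℤ) : B)) * ((q.2 : ℤ) : B) * h3 + h
      linear_combination (-gridPoint ζ q ^ k) * h4 -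
        gridPoint ζ q ^ k * (↑(u q.1)⁻¹ : B) * gridValue ζ q.1 * h5
    · intro p _ hp
      simp only [Polynomial.eval_smul, Polynomial.eval_add, smul_eq_mul, oddBasis,
        Polynomial.eval_mul, Polynomial.eval_X]
      by_cases h1 : q.1 = p.1
      · rw [← h1, eval_evenBasis_self]
        have hs : (((p.2 : ℤ) : B)) * ((q.2 : ℤ) : B) = -1 := by
          have hne : p.2 ≠ q.2 := fun h => hp (Prod.ext h1.symm h)
          rcases Int.units_eq_one_or p.2 with h | h <;> rcases Int.units_eq_one_or q.2 with h' | h' <;>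
            simp_all
        have h3 : (ζ q.1 : B) * ↑(ζ q.1)⁻¹ = 1 := Units.mul_inv _
        have h5 : ((p.2 : ℤ) : B) * (ζ q.1) * gridPoint ζ q = -1 := by
          rw [gridPoint]; linear_combination (((p.2 : ℤ) : B)) * ((q.2 : ℤ) : B) * h3 + hs
        linear_combination gridPoint ζ p ^ k * (↑(u q.1)⁻¹ : B) * gridValue ζ q.1 * h5
      · rw [eval_evenBasis_of_ne ζ p.1 q h1]; simp
    · simp

/-- An antisymmetric polynomial of degree less than `2n` in each variable whose values at the
points `± ζ_i⁻¹` are divisible by the corresponding weights is a combination of the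
`v_I ∧ w_J ∧ ξ_K`. -/
theorem mem_span_map_basisElt {β : Fin n → B} (hη : ∀ i j, i ≠ j → IsUnit (sq ζ i - sq ζ j))
    (h₀ : (vZero n).map φ = ∏ j, (1 - Polynomial.C (sq ζ j) * Polynomial.X ^ 2))
    (h₁ : (vElt n 1).map φ = ∑ i, β i • evenBasis (sq ζ) i)
    (P : MvPolynomial (Fin ℓ) B)
    (hσ : ∀ σ : Equiv.Perm (Fin ℓ), rename σ P = (Equiv.Perm.sign σ : ℤ) • P)
    (hP : ∀ m ∈ P.support, ∀ a, m a < 2 * n)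
    (hd : ∀ x : Fin ℓ → Fin n × ℤˣ, (∏ i ∈ Finset.univ.image fun a => (x a).1, β i) ∣
      MvPolynomial.eval (fun a => gridPoint ζ (x a)) P) :
    P ∈ Submodule.span B (Set.range fun t : BasisIndex n ℓ =>
      MvPolynomial.map φ (basisElt t)) := by
  obtain ⟨c, d, hN⟩ := exists_gridBasis ζ hη
  have hsum := factorial_smul_eq_sum (gridPoint ζ) _ hN P hσ hP
  have hmem : (ℓ.factorial : B) • P ∈ Submodule.span B (Set.range fun t : BasisIndex n ℓ =>
      MvPolynomial.map φ (basisElt t)) := by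
    rw [hsum]
    refine Submodule.sum_mem _ fun x _ => ?_
    rw [← map_smul]
    have hmem : (MvPolynomial.eval (fun a => gridPoint ζ (x a)) P) • (ιMulti B ℓ fun a =>
        c (x a) • evenBasis (sq ζ) (x a).1 + d (x a) • oddBasis (sq ζ) (x a).1) ∈
          basisFormSpan φ ℓ := by
      have := smul_word_mul_prod_mem_of_words (ℓ := ℓ) (β := β) (e := evenBasis (sq ζ))
        (o := oddBasis (sq ζ)) (W := basisFormSpan φ ℓ)
        (smul_word_evenBasis_mem hη h₀ h₁) Prod.fst _ c d (fun p => rfl) (List.ofFn x) [] []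
        (by simp) (MvPolynomial.eval (fun a => gridPoint ζ (x a)) P) (by
          convert hd x using 2
          ext i; simp [List.mem_ofFn])
      simpa [word, ιMulti_apply, List.map_ofFn, Function.comp_def] using this
    have := Submodule.mem_map_of_mem (f := antisym B ℓ) hmem
    rw [basisFormSpan, Submodule.map_span] at this
    refine Submodule.span_mono ?_ this
    rintro _ ⟨_, ⟨t, rfl⟩, rfl⟩
    exact ⟨t, (antisym_basisForm φ t).symm⟩
  have hu : IsUnit (ℓ.factorial : B) := by
    have := (IsUnit.mk0 (ℓ.factorial : ℚ) (by exact_mod_cast Nat.factorial_ne_zero ℓ)).map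
      (algebraMap ℚ B)
    simpa using this
  obtain ⟨u, hu⟩ := hu
  rw [← hu] at hmem
  have := Submodule.smul_mem _ (↑u⁻¹ : B) hmem
  rwa [smul_smul, Units.inv_mul, one_smul] at this

end Grid

end WedgeSpan

instance (N : ℕ) : IsDomain (SymRing N) :=
  inferInstanceAs (IsDomain (symmetricSubalgebra (Fin N) ℂ))

instance (N : ℕ) : Algebra ℂ (SymRing N) :=
  inferInstanceAs (Algebra ℂ (symmetricSubalgebra (Fin N) ℂ))

instance (N : ℕ) : Algebra ℚ (SymRing N) :=
  inferInstanceAs (Algebra ℚ (symmetricSubalgebra (Fin N) ℂ))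

/-! ### Degree bounds, and roots of the generating function of the `e_k`. -/

namespace WedgeSpan

open ExteriorAlgebra Polynomial

section Degree

variable {B : Type*} [CommRing B] [Nontrivial B] {ℓ : ℕ}

theorem degreeOf_aeval_X_le (a b : Fin ℓ) (p : B[X]) :
    (Polynomial.aeval (MvPolynomial.X a : MvPolynomial (Fin ℓ) B) p).degreeOf b ≤
      if a = b then p.natDegree else 0 := by
  rw [Polynomial.aeval_eq_sum_range]
  refine (degreeOf_sum_le _ _ _).trans (Finset.sup_le fun i hi => ?_)
  rw [MvPolynomial.smul_eq_C_mul]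
  refine (degreeOf_C_mul_le _ _ _).trans ((degreeOf_pow_le _ _ _).trans ?_)
  rw [degreeOf_X]
  have := Finset.mem_range.1 hi
  split_ifs with h h'
  · simpa using Nat.lt_succ_iff.1 this
  · exact absurd h.symm h'
  · rename_i h'; exact absurd h'.symm h
  · simp

theorem degreeOf_prod_aeval_X_le (u : Fin ℓ → B[X]) (b : Fin ℓ) :
    (∏ a, Polynomial.aeval (MvPolynomial.X a : MvPolynomial (Fin ℓ) B) (u a)).degreeOf b ≤
      (u b).natDegree := by
  refine (degreeOf_prod_le _ _ _).trans ?_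
  refine (Finset.sum_le_sum fun a _ => degreeOf_aeval_X_le a b (u a)).trans ?_
  simp

omit [Nontrivial B] in
theorem twoForm_mem_mul {d : ℕ} {q : MvPolynomial (Fin 2) B} (hq : ∀ a, q.degreeOf a < d) :
    twoForm B q ∈ (degreeLT B d).map (ι B) * (degreeLT B d).map (ι B) := by
  rw [MvPolynomial.as_sum q, map_sum]
  refine Submodule.sum_mem _ fun m hm => ?_
  rw [show MvPolynomial.monomial m (q.coeff m) = q.coeff m • MvPolynomial.monomial m 1 by
    rw [MvPolynomial.smul_monomial, smul_eq_mul, mul_one], map_smul, twoForm_monomial]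
  have h : ∀ a, (Polynomial.X ^ m a : B[X]) ∈ degreeLT B d := fun a => by
    rw [Polynomial.mem_degreeLT]
    refine lt_of_le_of_lt (Polynomial.degree_X_pow_le _) ?_
    exact_mod_cast (degreeOf_lt_iff (lt_of_le_of_lt (Nat.zero_le _) (hq a))).1 (hq a) m hm
  exact Submodule.smul_mem _ _ (Submodule.mul_mem_mul (Submodule.mem_map_of_mem (h 0))
    (Submodule.mem_map_of_mem (h 1)))

omit [Nontrivial B] in
theorem rename_antisym_ιMulti (u : Fin ℓ → B[X]) (τ : Equiv.Perm (Fin ℓ)) :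
    rename τ (antisym B ℓ (ιMulti B ℓ u)) =
      (Equiv.Perm.sign τ : ℤ) • antisym B ℓ (ιMulti B ℓ u) := by
  rw [antisym_ιMulti_eq, map_sum, Finset.smul_sum, ← Equiv.sum_comp (Equiv.mulLeft τ)
    (fun σ => (Equiv.Perm.sign τ : ℤ) • (Equiv.Perm.sign σ : ℤ) • _)]
  refine Finset.sum_congr rfl fun σ _ => ?_
  rw [map_zsmul, rename_rename, Equiv.coe_mulLeft, Equiv.Perm.sign_mul, smul_smul, Units.val_mul,
    ← mul_assoc, ← Units.val_mul, Int.units_mul_self, Units.val_one, one_mul, Equiv.Perm.coe_mul]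

theorem antisym_ιMulti_mem_extPower {N : ℕ} (u : Fin ℓ → (SymRing N)[X])
    (hu : ∀ a, u a ∈ degreeLT (SymRing N) N) :
    antisym (SymRing N) ℓ (ιMulti (SymRing N) ℓ u) ∈ extPower N ℓ := by
  refine ⟨rename_antisym_ιMulti u, fun d hd a => ?_⟩
  have hN : ∀ a, (u a).natDegree < N := fun a => by
    have h := Polynomial.mem_degreeLT.1 (hu a)
    by_cases h0 : u a = 0
    -- For `N = 0` the zero polynomial has `natDegree` not below `N`; but a zero factor makes the
    -- wedge zero, so its support has no element `d`.
    · rcases Nat.eq_zero_or_pos N with rfl | hN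
      · exfalso
        have : ℓ ≠ 0 := by rintro rfl; exact a.elim0
        have hz : antisym (SymRing 0) ℓ (ιMulti (SymRing 0) ℓ u) = 0 := by
          rw [(ιMulti (SymRing 0) ℓ).map_coord_zero a h0, map_zero]
        rw [hz] at hd
        simp at hd
      · simpa [h0] using hN
    · exact (Polynomial.natDegree_lt_iff_degree_lt h0).2 h
  have hdeg : (antisym (SymRing N) ℓ (ιMulti (SymRing N) ℓ u)).degreeOf a < N := by
    rw [degreeOf_lt_iff (lt_of_le_of_lt (Nat.zero_le _) (hN a)), antisym_ιMulti_eq]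
    intro m hm
    obtain ⟨σ, -, hσ⟩ := Finset.mem_biUnion.1 (MvPolynomial.support_sum hm)
    have hσ' := MvPolynomial.support_smul hσ
    have := (degreeOf_le_iff (n := a) (d := (u (σ.symm a)).natDegree)).1 ?_ m hσ'
    · exact this.trans_lt (hN _)
    · conv_lhs => rw [← σ.apply_symm_apply a]
      rw [degreeOf_rename_of_injective σ.injective]
      exact degreeOf_prod_aeval_X_le _ _
  exact (degreeOf_lt_iff (lt_of_le_of_lt (Nat.zero_le _) (hN a))).1 hdeg d hd

open scoped Pointwise in
theorem antisym_mem_extPower {N : ℕ} {x : ExteriorAlgebra (SymRing N) (SymRing N)[X]}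
    (hx : x ∈ ((degreeLT (SymRing N) N).map (ι (SymRing N))) ^ ℓ) :
    antisym (SymRing N) ℓ x ∈ extPower N ℓ := by
  have hle : ((degreeLT (SymRing N) N).map (ι (SymRing N))) ^ ℓ ≤
      (extPower N ℓ).comap (antisym (SymRing N) ℓ) := by
    rw [← Submodule.span_eq ((degreeLT (SymRing N) N).map (ι (SymRing N))), Submodule.span_pow,
      Submodule.span_le]
    intro y hy
    obtain ⟨f, rfl⟩ := Set.mem_pow.1 hy
    choose u hu hu' using fun a => (f a).2
    simp only [← hu']
    rw [← ιMulti_apply]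
    exact antisym_ιMulti_mem_extPower u hu
  exact hle hx

end Degree

section Membership

variable {n ℓ : ℕ}

theorem vElt_mem_degreeLT (r : ℕ) : vElt n r ∈ degreeLT (SymRing (2 * n)) (2 * n) := by
  rw [vElt_eq]
  refine Submodule.sum_mem _ fun s hs => ?_
  rw [Polynomial.mem_degreeLT]
  refine lt_of_le_of_lt (Polynomial.degree_C_mul_X_pow_le _ _) ?_
  have := Finset.mem_range.1 hs
  exact_mod_cast (by omega : 2 * s < 2 * n)

theorem wElt_mem_degreeLT (r : ℕ) : wElt n r ∈ degreeLT (SymRing (2 * n)) (2 * n) := by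
  rw [wElt, vElt_eq, Finset.mul_sum]
  refine Submodule.sum_mem _ fun s hs => ?_
  rw [Polynomial.mem_degreeLT, mul_left_comm, ← pow_succ']
  refine lt_of_le_of_lt (Polynomial.degree_C_mul_X_pow_le _ _) ?_
  have := Finset.mem_range.1 hs
  exact_mod_cast (by omega : 2 * s + 1 < 2 * n)

theorem natDegree_vElt_le (r : ℕ) : (vElt n r).natDegree ≤ 2 * n - 2 := by
  rw [vElt_eq]
  refine Polynomial.natDegree_sum_le_of_forall_le _ _ fun s hs => ?_
  refine (Polynomial.natDegree_C_mul_X_pow_le _ _).trans ?_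
  have := Finset.mem_range.1 hs
  omega

theorem natDegree_vZero_le : (vZero n).natDegree ≤ 2 * n := by
  rw [vZero]
  refine Polynomial.natDegree_sum_le_of_forall_le _ _ fun s hs => ?_
  refine (Polynomial.natDegree_C_mul_X_pow_le _ _).trans ?_
  have := Finset.mem_range.1 hs
  omega

theorem xiElt_spec' (k : ℕ) : (MvPolynomial.X 0 + MvPolynomial.X 1) * xiElt n k =
      MvPolynomial.X 0 ^ 2 * atVar 1 (vZero n) * atVar 0 (vElt n k) -
      MvPolynomial.X 1 ^ 2 * atVar 0 (vZero n) * atVar 1 (vElt n k) := by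
  have := map_xiElt_spec (RingHom.id (SymRing (2 * n))) k
  simpa only [MvPolynomial.map_id, RingHom.id_apply, Polynomial.map_id, atVar] using this

/-- The product with `X_1 + X_2` has degree at most `2n` in each variable. Degrees add over a
domain, so dividing by `X_1 + X_2` lowers the bound by one. -/
theorem degreeOf_xiElt_lt (hn : 0 < n) (k : ℕ) (a : Fin 2) : (xiElt n k).degreeOf a < 2 * n := by
  by_cases h0 : xiElt n k = 0
  · rw [h0]; simpa using hn
  have hX := X_add_X_ne_zero (B := SymRing (2 * n)) (a := (0 : Fin 2)) (b := 1) (by decide)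
  have h1 : ((MvPolynomial.X 0 + MvPolynomial.X 1 : MvPolynomial (Fin 2) (SymRing (2 * n))) *
      xiElt n k).degreeOf a ≤ 2 * n := by
    rw [xiElt_spec']
    have hv : ∀ b, (atVar b (vZero n) : MvPolynomial (Fin 2) (SymRing (2 * n))).degreeOf a ≤
        if b = a then 2 * n else 0 := fun b => (degreeOf_aeval_X_le b a _).trans (by
          split_ifs; exacts [natDegree_vZero_le, le_rfl])
    have hw : ∀ b, (atVar b (vElt n k) : MvPolynomial (Fin 2) (SymRing (2 * n))).degreeOf a ≤
        if b = a then 2 * n - 2 else 0 := fun b => (degreeOf_aeval_X_le b a _).trans (by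
          split_ifs; exacts [natDegree_vElt_le k, le_rfl])
    have hX : ∀ b, (MvPolynomial.X b ^ 2 : MvPolynomial (Fin 2) (SymRing (2 * n))).degreeOf a ≤
        if b = a then 2 else 0 := fun b => (degreeOf_pow_le _ _ _).trans (by
          rw [degreeOf_X]; simp only [eq_comm (a := b)]; split_ifs <;> norm_num)
    refine (degreeOf_sub_le _ _ _).trans (max_le ?_ ?_)
    · refine (degreeOf_mul_le _ _ _).trans ((add_le_add (degreeOf_mul_le _ _ _) le_rfl).trans ?_)
      refine (add_le_add (add_le_add (hX 0) (hv 1)) (hw 0)).trans ?_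
      fin_cases a <;> simp
      omega
    · refine (degreeOf_mul_le _ _ _).trans ((add_le_add (degreeOf_mul_le _ _ _) le_rfl).trans ?_)
      refine (add_le_add (add_le_add (hX 1) (hv 0)) (hw 1)).trans ?_
      fin_cases a <;> simp
      omega
  rw [degreeOf_mul_eq hX h0] at h1
  have h2 : 0 < (MvPolynomial.X 0 + MvPolynomial.X 1 :
      MvPolynomial (Fin 2) (SymRing (2 * n))).degreeOf a := by
    by_contra hlt
    have hle := (degreeOf_le_iff (n := a) (d := 0)).1 (Nat.le_of_not_lt hlt) (Finsupp.single a 1) (by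
      rw [MvPolynomial.mem_support_iff, MvPolynomial.coeff_add, MvPolynomial.coeff_X,
        MvPolynomial.coeff_X]
      fin_cases a <;> simp [Finsupp.single_eq_single_iff])
    simp at hle
  omega

theorem basisElt_mem_extPower (t : BasisIndex n ℓ) : basisElt t ∈ extPower (2 * n) ℓ := by
  have h := antisym_basisForm (RingHom.id (SymRing (2 * n))) t
  rw [MvPolynomial.map_id] at h
  rw [← h]
  refine antisym_mem_extPower ?_
  set S := (degreeLT (SymRing (2 * n)) (2 * n)).map (ι (SymRing (2 * n))) with hS
  have hmem : basisForm (RingHom.id (SymRing (2 * n))) t ∈ S ^ t.l₁ * S ^ t.l₂ * (S * S) ^ t.l₃ := by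
    refine Submodule.mul_mem_mul (Submodule.mul_mem_mul ?_ ?_) ?_
    · have := list_prod_mem_pow (S := S) (List.ofFn fun a => ι (SymRing (2 * n))
        ((vElt n (t.I a)).map (RingHom.id _))) ?_
      · rwa [List.length_ofFn] at this
      · intro x hx
        obtain ⟨a, rfl⟩ := List.mem_ofFn.1 hx
        rw [Polynomial.map_id]
        exact Submodule.mem_map_of_mem (vElt_mem_degreeLT _)
    · have := list_prod_mem_pow (S := S) (List.ofFn fun a => ι (SymRing (2 * n))
        ((wElt n (t.J a)).map (RingHom.id _))) ?_
      · rwa [List.length_ofFn] at this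
      · intro x hx
        obtain ⟨a, rfl⟩ := List.mem_ofFn.1 hx
        rw [Polynomial.map_id]
        exact Submodule.mem_map_of_mem (wElt_mem_degreeLT _)
    · have := list_prod_mem_pow (S := S * S) (List.ofFn fun c => twoForm (SymRing (2 * n))
        (MvPolynomial.map (RingHom.id _) (xiElt n (t.K c)))) ?_
      · rwa [List.length_ofFn] at this
      · intro x hx
        obtain ⟨c, rfl⟩ := List.mem_ofFn.1 hx
        rw [MvPolynomial.map_id]
        have hn : 0 < n := by
          have := t.K_le c
          have := t.one_le_K c
          have := c.pos
          omega
        exact twoForm_mem_mul (degreeOf_xiElt_lt hn _)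
  have hpow : S ^ t.l₁ * S ^ t.l₂ * (S * S) ^ t.l₃ = S ^ ℓ := by
    rw [← pow_two, ← pow_mul, ← pow_add, ← pow_add, t.sum_eq]
  rwa [hpow] at hmem

theorem sum_range_two_mul_add_one {A : Type*} [AddCommMonoid A] (f : ℕ → A) (n : ℕ) :
    ∑ k ∈ Finset.range (2 * n + 1), f k =
      ∑ j ∈ Finset.range (n + 1), f (2 * j) + ∑ j ∈ Finset.range n, f (2 * j + 1) := by
  induction n with
  | zero => simp
  | succ n ih =>
    rw [show 2 * (n + 1) + 1 = 2 * n + 1 + 1 + 1 by ring, Finset.sum_range_succ,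
      Finset.sum_range_succ, ih, Finset.sum_range_succ (fun j => f (2 * j)) (n + 1),
      Finset.sum_range_succ (fun j => f (2 * j + 1)) n]
    rw [show 2 * (n + 1) = 2 * n + 1 + 1 by ring]
    abel

/-- `v_0 + w_1` is the generating function of the elementary symmetric polynomials. -/
theorem vZero_add_wElt_one : vZero n + wElt n 1 = ∑ k ∈ Finset.range (2 * n + 1),
    Polynomial.C (elemSym (2 * n) k) * Polynomial.X ^ k := by
  rw [sum_range_two_mul_add_one, vZero, wElt, vElt_eq, Finset.mul_sum]
  refine congrArg₂ (· + ·) (Finset.sum_congr rfl fun s _ => ?_) (Finset.sum_congr rfl fun s _ => ?_)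
  · rw [Nat.cast_mul, Nat.cast_ofNat]
  · have : coeffP (2 * n) 1 (s + 1 : ℕ) = elemSym (2 * n) ((2 * s + 1 : ℕ) : ℤ) := by
      rw [coeffP, show (2 * ((s + 1 : ℕ) : ℤ) - 1) = ((2 * s + 1 : ℕ) : ℤ) by push_cast; ring]
    rw [mul_left_comm, ← pow_succ', this]

/-- If `t⁻¹` and `-t⁻¹` are roots of `v_0 + w_1`, all `v_r` vanish there. -/
theorem eval_vElt_eq_zero {B : Type*} [CommRing B] [IsDomain B] [Algebra ℚ B]
    (φ : SymRing (2 * n) →+* B) {u : B} (hu : u ≠ 0)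
    (h : ((vZero n + wElt n 1).map φ).eval u = 0) (h' : ((vZero n + wElt n 1).map φ).eval (-u) = 0) :
    ((vZero n).map φ).eval u = 0 ∧ ∀ r, ((vElt n (r + 1)).map φ).eval u = 0 := by
  -- As `v_0` and `v_1` are even, the two hypotheses read `v_0(u) + u v_1(u) = 0` and `v_0(u) - u
  -- v_1(u) = 0`.
  have hv0 : ((vZero n).map φ).eval (-u) = ((vZero n).map φ).eval u := by
    simp [vZero, Polynomial.eval_finsetSum, Polynomial.map_sum, pow_mul]
  have hv1 : ((vElt n 1).map φ).eval (-u) = ((vElt n 1).map φ).eval u := by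
    simp [vElt_eq, Polynomial.eval_finsetSum, Polynomial.map_sum, pow_mul]
  simp only [wElt, Polynomial.map_add, Polynomial.map_mul, Polynomial.map_X, Polynomial.eval_add,
    Polynomial.eval_mul, Polynomial.eval_X, hv0, hv1] at h h'
  have h0 : ((vZero n).map φ).eval u = 0 := by
    have h2 : (2 : B) * ((vZero n).map φ).eval u = 0 := by linear_combination h + h'
    exact (mul_eq_zero.1 h2).resolve_left two_ne_zero_of_rat
  refine ⟨h0, fun r => ?_⟩
  induction r with
  | zero =>
    rw [h0, zero_add] at h
    exact (mul_eq_zero.1 h).resolve_left hu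
  | succ r ih =>
    have := congrArg (fun p => (p.map φ).eval u) (X_sq_mul_vElt n r)
    simp only [Polynomial.map_mul, Polynomial.map_sub, Polynomial.map_pow, Polynomial.map_X,
      Polynomial.eval_mul, Polynomial.eval_sub, Polynomial.eval_pow, Polynomial.eval_X, ih, h0,
      mul_zero, sub_zero] at this
    exact (mul_eq_zero.1 this).resolve_left (pow_ne_zero _ hu)

/-- The value of the generating function at `t⁻¹`, when `φ` is the evaluation at `y`. -/
theorem eval_generating_eq_prod {B : Type*} [CommRing B] (φ : SymRing (2 * n) →+* B)
    (y : Fin (2 * n) → B)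
    (hφ : ∀ k, φ (elemSym (2 * n) (k : ℕ)) = ∑ s ∈ Finset.powersetCard k Finset.univ, ∏ i ∈ s, y i)
    (t u : B) (htu : t * u = 1) :
    ((vZero n + wElt n 1).map φ).eval u = u ^ (2 * n) * ∏ j, (t + y j) := by
  have h := congrArg (fun p => Polynomial.eval₂ (MvPolynomial.eval₂Hom (algebraMap ℤ B) y) t p)
    (MvPolynomial.prod_C_add_X_eq_sum_esymm ℤ (Fin (2 * n)))
  simp only [Polynomial.eval₂_finsetProd, Polynomial.eval₂_add, Polynomial.eval₂_X,
    Polynomial.eval₂_C, Polynomial.eval₂_finsetSum, Polynomial.eval₂_mul, Polynomial.eval₂_pow,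
    Fintype.card_fin, MvPolynomial.coe_eval₂Hom, MvPolynomial.eval₂_X] at h
  rw [h, vZero_add_wElt_one, Finset.mul_sum]
  simp only [Polynomial.map_sum, Polynomial.eval_finsetSum]
  refine Finset.sum_congr rfl fun k hk => ?_
  have hk' : k ≤ 2 * n := Nat.lt_succ_iff.1 (Finset.mem_range.1 hk)
  simp only [Polynomial.map_mul, Polynomial.map_C, Polynomial.map_pow, Polynomial.map_X,
    Polynomial.eval_mul, Polynomial.eval_C, Polynomial.eval_pow, Polynomial.eval_X, hφ]
  have he : MvPolynomial.eval₂ (algebraMap ℤ B) y (esymm (Fin (2 * n)) ℤ k) =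
      ∑ s ∈ Finset.powersetCard k Finset.univ, ∏ i ∈ s, y i := by
    simp [esymm, MvPolynomial.eval₂_sum, MvPolynomial.eval₂_prod]
  rw [he]
  have hpow : u ^ (2 * n) * t ^ (2 * n - k) = u ^ k := by
    rw [← Nat.sub_add_cancel hk', pow_add, Nat.add_sub_cancel, mul_right_comm, ← mul_pow, mul_comm u,
      htu, one_pow, one_mul]
  linear_combination (-∑ s ∈ Finset.powersetCard k Finset.univ, ∏ i ∈ s, y i) * hpow

end Membership

end WedgeSpan

/-! ### The elements `v_I ∧ w_J ∧ ξ_K` satisfy `ρ_± = 0`. -/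

namespace WedgeSpan

open ExteriorAlgebra Polynomial

variable {n ℓ : ℕ}

instance (N : ℕ) : IsDomain (LaurentRing N) := inferInstance

/-- The values of the variables under `bar`. -/
def barVar (N : ℕ) (j : Fin N) : LaurentRing N :=
  if h : (j : ℕ) < N - 2 then LaurentPolynomial.C (MvPolynomial.X ⟨j, h⟩)
  else if (j : ℕ) + 2 = N then LaurentPolynomial.T 1 else -LaurentPolynomial.T 1

theorem bar_apply (N : ℕ) (f : SymRing N) :
    bar N f = MvPolynomial.aeval (barVar N) (SymRing.toPoly N f) := rfl

/-- The value is a multiple of `∏ (ε x + x_j)` over the specialized variables. For `ε = 1` the last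
variable `-x` gives a zero factor, for `ε = -1` the one before it, `x`. -/
theorem eval_bar_generating (hn : 0 < n) (ε : ℤˣ) :
    ((vZero n + wElt n 1).map (bar (2 * n))).eval
      (((ε : ℤ) : LaurentRing (2 * n)) * LaurentPolynomial.T (-1)) = 0 := by
  have hT : (LaurentPolynomial.T 1 : LaurentRing (2 * n)) * LaurentPolynomial.T (-1) = 1 := by
    rw [← LaurentPolynomial.T_add]; simp
  have hε : ((ε : ℤ) : LaurentRing (2 * n)) * ((ε : ℤ) : LaurentRing (2 * n)) = 1 := by
    rw [← Int.cast_mul, ← Units.val_mul, Int.units_mul_self]; simp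
  rw [eval_generating_eq_prod (bar (2 * n)) (barVar (2 * n)) (fun k => by
    rw [bar_apply, toPoly_elemSym]
    simp [esymm, map_sum, map_prod])
    (((ε : ℤ) : LaurentRing (2 * n)) * LaurentPolynomial.T 1) _ (by
      rw [mul_mul_mul_comm, hε, hT, one_mul])]
  refine mul_eq_zero_of_right _ ?_
  rcases Int.units_eq_one_or ε with rfl | rfl
  · refine Finset.prod_eq_zero (i := ⟨2 * n - 1, by omega⟩) (Finset.mem_univ _) ?_
    rw [barVar, dif_neg (by simp; omega), if_neg (by simp; omega)]
    simp
  · refine Finset.prod_eq_zero (i := ⟨2 * n - 2, by omega⟩) (Finset.mem_univ _) ?_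
    rw [barVar, dif_neg (by simp), if_pos (by simp; omega), Units.val_neg, Units.val_one,
      Int.cast_neg, Int.cast_one]
    have h : (-1 * LaurentPolynomial.T 1 + LaurentPolynomial.T 1 : LaurentRing (2 * n)) = 0 := by
      linear_combination
    exact h

theorem eval_bar_eq_zero (hn : 0 < n) (ε : ℤˣ) :
    ((vZero n).map (bar (2 * n))).eval
      (((ε : ℤ) : LaurentRing (2 * n)) * LaurentPolynomial.T (-1)) = 0 ∧
    ∀ r, ((vElt n (r + 1)).map (bar (2 * n))).eval
      (((ε : ℤ) : LaurentRing (2 * n)) * LaurentPolynomial.T (-1)) = 0 := by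
  refine eval_vElt_eq_zero _ ?_ (eval_bar_generating hn ε) ?_
  · intro h0
    have h1 : ((ε : ℤ) : LaurentRing (2 * n)) * LaurentPolynomial.T (-1) *
        (((ε : ℤ) : LaurentRing (2 * n)) * LaurentPolynomial.T 1) =
        0 * (((ε : ℤ) : LaurentRing (2 * n)) * LaurentPolynomial.T 1) := by rw [h0]
    have hε : ((ε : ℤ) : LaurentRing (2 * n)) * ((ε : ℤ) : LaurentRing (2 * n)) = 1 := by
      rw [← Int.cast_mul, ← Units.val_mul, Int.units_mul_self]; simp
    rw [mul_mul_mul_comm, hε, ← LaurentPolynomial.T_add, zero_mul] at h1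
    simp at h1
  · have := eval_bar_generating hn (-ε)
    have e : -(((ε : ℤ) : LaurentRing (2 * n)) * LaurentPolynomial.T (-1)) =
        (((-ε : ℤˣ) : ℤ) : LaurentRing (2 * n)) * LaurentPolynomial.T (-1) := by
      rw [Units.val_neg, Int.cast_neg]
      linear_combination
    rw [e]
    exact this

/-- The images of the variables `X_a` under `ρ_ε`. -/
def rhoVar (N m : ℕ) (ε : ℤˣ) : Fin (m + 1) → MvPolynomial (Fin m) (LaurentRing N) :=
  Fin.snoc (α := fun _ => MvPolynomial (Fin m) (LaurentRing N)) MvPolynomial.X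
    (MvPolynomial.C (((ε : ℤ) : LaurentRing N) * LaurentPolynomial.T (-1)))

theorem rho_eq_eval (N : ℕ) {m : ℕ} (ε : ℤˣ) (P : MvPolynomial (Fin (m + 1)) (SymRing N)) :
    rho N ε P = MvPolynomial.eval (rhoVar N m ε)
      (MvPolynomial.map ((MvPolynomial.C (σ := Fin m)).comp (bar N)) P) := by
  rw [MvPolynomial.eval_map]; rfl

theorem rhoVar_last (N m : ℕ) (ε : ℤˣ) : rhoVar N m ε (Fin.last m) =
    MvPolynomial.C (((ε : ℤ) : LaurentRing N) * LaurentPolynomial.T (-1)) := by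
  simp [rhoVar]

theorem rhoVar_castSucc (N m : ℕ) (ε : ℤˣ) (i : Fin m) :
    rhoVar N m ε i.castSucc = MvPolynomial.X i := by
  rw [rhoVar, Fin.snoc_castSucc]

theorem rhoVar_add_ne_zero (N m : ℕ) (ε : ℤˣ) {a b : Fin (m + 1)} (h : a ≠ b) :
    rhoVar N m ε a + rhoVar N m ε b ≠ 0 := by
  have key : ∀ (i : Fin m) (c : LaurentRing N),
      (MvPolynomial.X i + MvPolynomial.C c : MvPolynomial (Fin m) (LaurentRing N)) ≠ 0 := by
    intro i c h0
    have := congrArg (MvPolynomial.coeff (Finsupp.single i 1)) h0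
    rw [MvPolynomial.coeff_add, MvPolynomial.coeff_C, if_neg (by
      intro h; simpa using (Finsupp.ext_iff.1 h i).symm)] at this
    simp at this
  induction a using Fin.lastCases with
  | last =>
    induction b using Fin.lastCases with
    | last => exact absurd rfl h
    | cast j => rw [add_comm, rhoVar_last, rhoVar_castSucc]; exact key j _
  | cast i =>
    induction b using Fin.lastCases with
    | last => rw [rhoVar_last, rhoVar_castSucc]; exact key i _
    | cast j =>
      have := X_add_X_ne_zero (B := LaurentRing N) (a := i) (b := j) (fun hij => h (by rw [hij]))
      rw [rhoVar_castSucc, rhoVar_castSucc]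
      exact this

theorem rho_atVar (N : ℕ) {m : ℕ} (ε : ℤˣ) (a : Fin (m + 1)) (p : (SymRing N)[X]) :
    rho N ε (atVar a p) =
      (p.map ((MvPolynomial.C (σ := Fin m)).comp (bar N))).eval (rhoVar N m ε a) := by
  rw [atVar, Polynomial.aeval_def, Polynomial.hom_eval₂, Polynomial.eval_map]
  congr 1
  · ext x : 1
    simp [rho, MvPolynomial.algebraMap_eq]
  · simp [rho, rhoVar]

theorem eval_map_C_comp (N m : ℕ) (p : (SymRing N)[X]) (u : LaurentRing N) :
    (p.map ((MvPolynomial.C (σ := Fin m)).comp (bar N))).eval (MvPolynomial.C u) =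
      MvPolynomial.C ((p.map (bar N)).eval u) := by
  rw [← Polynomial.map_map, Polynomial.eval_map, Polynomial.eval₂_at_apply]

/-- In `(X_1 + X_2) ξ_k` both terms contain `v_0` or `v_k` at the variable `c`; the factor `x 0 + x
1` is then cancelled. -/
theorem eval_map_xiElt_eq_zero {B : Type*} [CommRing B] [IsDomain B] [Algebra ℚ B]
    (φ : SymRing (2 * n) →+* B) (k : ℕ) (x : Fin 2 → B) (hx : x 0 + x 1 ≠ 0) (c : Fin 2)
    (h0 : ((vZero n).map φ).eval (x c) = 0) (h1 : ((vElt n k).map φ).eval (x c) = 0) :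
    MvPolynomial.eval x (MvPolynomial.map φ (xiElt n k)) = 0 := by
  have hspec := congrArg (MvPolynomial.eval x) (map_xiElt_spec φ k)
  have hev : ∀ (c : Fin 2) (p : B[X]),
      MvPolynomial.eval x (Polynomial.aeval (MvPolynomial.X c) p) = p.eval (x c) := by
    intro c p
    rw [Polynomial.aeval_def, Polynomial.hom_eval₂, ← Polynomial.eval₂_id]
    congr 1
    · ext x : 1; simp [MvPolynomial.algebraMap_eq]
    · simp
  simp only [map_mul, map_add, map_sub, map_pow, hev, MvPolynomial.eval_X] at hspec
  refine (mul_eq_zero.1 (hspec.trans ?_)).resolve_left hx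
  fin_cases c
  · simp only [Fin.zero_eta] at h0 h1
    rw [h0, h1, mul_zero, mul_zero, zero_mul, sub_zero]
  · simp only [Fin.mk_one] at h0 h1
    rw [h0, h1, mul_zero, mul_zero, zero_mul, sub_zero]

theorem rho_xiElt (hn : 0 < n) {m : ℕ} (ε : ℤˣ) (k : ℕ) {a b : Fin (m + 1)} (hab : a ≠ b)
    (h : a = Fin.last m ∨ b = Fin.last m) :
    rho (2 * n) ε (rename ![a, b] (xiElt n (k + 1))) = 0 := by
  obtain ⟨h0, h1⟩ := eval_bar_eq_zero hn ε
  rw [rho_eq_eval, MvPolynomial.map_rename, MvPolynomial.eval_rename]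
  obtain ⟨c, hc⟩ : ∃ c : Fin 2, ![a, b] c = Fin.last m := by
    rcases h with h | h
    exacts [⟨0, h⟩, ⟨1, h⟩]
  have hxc : (rhoVar (2 * n) m ε ∘ ![a, b]) c =
      MvPolynomial.C (((ε : ℤ) : LaurentRing (2 * n)) * LaurentPolynomial.T (-1)) := by
    rw [Function.comp_apply, hc, rhoVar_last]
  have key := eval_map_xiElt_eq_zero (B := MvPolynomial (Fin m) (LaurentRing (2 * n)))
    (MvPolynomial.C.comp (bar (2 * n))) (k + 1) (rhoVar (2 * n) m ε ∘ ![a, b])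
    (rhoVar_add_ne_zero _ _ ε hab) c
  refine key ?_ ?_
  · rw [hxc, eval_map_C_comp, h0, map_zero]
  · rw [hxc, eval_map_C_comp, h1, map_zero]

/-- In each term of the sum over permutations exactly one factor involves the last variable, and
that factor already maps to zero. -/
theorem rho_basisElt {m : ℕ} (ε : ℤˣ) (t : BasisIndex n (m + 1)) :
    rho (2 * n) ε (basisElt t) = 0 := by
  -- For `n = 0` all three index sequences are empty, which contradicts their total degree `m + 1`.
  have hn : 0 < n := by
    by_contra hn
    have h1 : t.l₁ = 0 := by
      by_contra h; have := t.one_le_I ⟨0, by omega⟩; have := t.I_le ⟨0, by omega⟩; omega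
    have h2 : t.l₂ = 0 := by
      by_contra h; have := t.one_le_J ⟨0, by omega⟩; have := t.J_le ⟨0, by omega⟩; omega
    have h3 : t.l₃ = 0 := by
      by_contra h; have := t.one_le_K ⟨0, by omega⟩; have := t.K_le ⟨0, by omega⟩; omega
    have := t.sum_eq
    omega
  obtain ⟨h0, h1⟩ := eval_bar_eq_zero hn ε
  have hv : ∀ r, 1 ≤ r → rho (2 * n) ε (atVar (Fin.last m) (vElt n r)) = 0 := by
    intro r hr
    obtain ⟨r, rfl⟩ := Nat.exists_eq_add_of_le' hr
    rw [rho_atVar, rhoVar_last, eval_map_C_comp, h1, map_zero]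
  have hw : ∀ r, 1 ≤ r → rho (2 * n) ε (atVar (Fin.last m) (wElt n r)) = 0 := by
    intro r hr
    obtain ⟨r, rfl⟩ := Nat.exists_eq_add_of_le' hr
    rw [rho_atVar, rhoVar_last, eval_map_C_comp, wElt, Polynomial.map_mul, Polynomial.eval_mul, h1,
      mul_zero, map_zero]
  rw [basisElt, map_sum]
  refine Finset.sum_eq_zero fun σ _ => ?_
  rw [map_zsmul, map_mul, map_mul, map_prod, map_prod, map_prod]
  obtain ⟨k, hk⟩ := σ.surjective (Fin.last m)
  have hsum := t.sum_eq
  rcases lt_or_ge (k : ℕ) t.l₁ with hk₁ | hk₁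
  · rw [Finset.prod_eq_zero (i := ⟨k, hk₁⟩) (Finset.mem_univ _)]
    · simp
    · rw [show σ ⟨k, _⟩ = Fin.last m from hk]
      exact hv _ (t.one_le_I _)
  rcases lt_or_ge (k : ℕ) (t.l₁ + t.l₂) with hk₂ | hk₂
  · rw [Finset.prod_eq_zero (i := (⟨k - t.l₁, by omega⟩ : Fin t.l₂)) (Finset.mem_univ _)]
    · simp
    · have : (⟨t.l₁ + ((⟨k - t.l₁, by omega⟩ : Fin t.l₂) : ℕ), by simp; omega⟩ : Fin (m + 1)) = k :=
        Fin.ext (by simp; omega)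
      rw [this, hk]
      exact hw _ (t.one_le_J _)
  · have hkm := k.isLt
    rw [Finset.prod_eq_zero (ι := Fin t.l₃) (i := ⟨(k - (t.l₁ + t.l₂)) / 2, by omega⟩)
      (Finset.mem_univ _)]
    · simp
    · obtain ⟨r, hr⟩ := Nat.exists_eq_add_of_le' (t.one_le_K ⟨(k - (t.l₁ + t.l₂)) / 2, by omega⟩)
      rw [hr]
      refine rho_xiElt hn ε r (fun h => ?_) ?_
      · have := congrArg Fin.val (σ.injective h)
        simp at this
      · rcases Nat.mod_two_eq_zero_or_one (k - (t.l₁ + t.l₂)) with h | h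
        · left
          rw [← hk]; congr 1; exact Fin.ext (by simp; omega)
        · right
          rw [← hk]; congr 1; exact Fin.ext (by simp; omega)

theorem basisElt_mem_solutionModule (t : BasisIndex n ℓ) :
    basisElt t ∈ solutionModule (2 * n) ℓ := by
  refine ⟨basisElt_mem_extPower t, ?_⟩
  cases ℓ with
  | zero => trivial
  | succ m => exact ⟨rho_basisElt 1 t, rho_basisElt (-1) t⟩

end WedgeSpan

/-! ### Counting the index triples. -/

namespace BasisIndex

variable {n ℓ : ℕ}

theorem eq_of_image_eq {k : ℕ} {f g : Fin k → ℕ} (hf : StrictMono f) (hg : StrictMono g)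
    (h : Finset.univ.image f = Finset.univ.image g) : f = g := by
  refine (StrictMono.range_inj hf hg).1 ?_
  have := congrArg (fun s : Finset ℕ => (s : Set ℕ)) h
  simpa using this

theorem card_image {k : ℕ} {f : Fin k → ℕ} (hf : StrictMono f) :
    (Finset.univ.image f).card = k := by
  rw [Finset.card_image_of_injective _ hf.injective, Finset.card_univ, Fintype.card_fin]

theorem strictMono_I' (t : BasisIndex n ℓ) : StrictMono fun a => t.I a - 1 := fun a b h => by
  have := t.I_strictMono h
  have := t.one_le_I a
  dsimp only
  omega

theorem strictMono_J' (t : BasisIndex n ℓ) : StrictMono fun a => t.J a - 1 := fun a b h => by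
  have := t.J_strictMono h
  have := t.one_le_J a
  dsimp only
  omega

theorem strictMono_K' (t : BasisIndex n ℓ) : StrictMono fun c => t.K c - 1 + (c : ℕ) :=
  fun a b h => by
    have := t.K_monotone h.le
    have : (a : ℕ) < b := h
    dsimp only
    omega

/-- Triples `(A, C, B)` of sets of natural numbers below `n`, `n - #A` and `n - #A - #C`. -/
def setTriples (n : ℕ) : Finset (Σ _ : Finset ℕ, Σ _ : Finset ℕ, Finset ℕ) :=
  (Finset.range n).powerset.sigma fun A =>
    (Finset.range (n - A.card)).powerset.sigma fun C =>
      (Finset.range (n - A.card - C.card)).powerset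

/-- The sets underlying the index sequences, the monotone sequence being made strictly monotone. -/
def toSets (t : BasisIndex n ℓ) : Σ _ : Finset ℕ, Σ _ : Finset ℕ, Finset ℕ :=
  ⟨Finset.univ.image fun a => t.I a - 1, Finset.univ.image fun c => t.K c - 1 + (c : ℕ),
    Finset.univ.image fun b => t.J b - 1⟩

theorem toSets_mem (t : BasisIndex n ℓ) : t.toSets ∈ (setTriples n).filter fun p =>
    p.1.card + p.2.2.card + 2 * p.2.1.card = ℓ := by
  rw [Finset.mem_filter, setTriples, toSets]
  dsimp only
  rw [Finset.mem_sigma, Finset.mem_sigma, Finset.mem_powerset, Finset.mem_powerset,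
    Finset.mem_powerset]
  dsimp only
  rw [card_image t.strictMono_I', card_image t.strictMono_J', card_image t.strictMono_K']
  refine ⟨⟨?_, ?_, ?_⟩, t.sum_eq⟩ <;>
  · intro x hx
    obtain ⟨a, -, rfl⟩ := Finset.mem_image.1 hx
    rw [Finset.mem_range]
    have := a.isLt
    first
    | (have := t.I_le a; have := t.one_le_I a; omega)
    | (have := t.K_le a; have := t.one_le_K a; omega)
    | (have := t.J_le a; have := t.one_le_J a; omega)

theorem toSets_injective : Function.Injective (toSets : BasisIndex n ℓ → _) := by
  intro t t' h
  have hI := congrArg (fun p => p.1) h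
  have hK := congrArg (fun p => p.2.1) h
  have hJ := congrArg (fun p => p.2.2) h
  dsimp only [toSets] at hI hK hJ
  have h1 := congrArg Finset.card hI
  have h2 := congrArg Finset.card hJ
  have h3 := congrArg Finset.card hK
  rw [card_image t.strictMono_I', card_image t'.strictMono_I'] at h1
  rw [card_image t.strictMono_J', card_image t'.strictMono_J'] at h2
  rw [card_image t.strictMono_K', card_image t'.strictMono_K'] at h3
  have tI := t.strictMono_I'
  have tJ := t.strictMono_J'
  have tK := t.strictMono_K'
  have tI' := t'.strictMono_I'
  have tJ' := t'.strictMono_J'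
  have tK' := t'.strictMono_K'
  obtain ⟨l₁, l₂, l₃, I, J, K, I1, I2, I3, J1, J2, J3, K1, K2, K3, hs⟩ := t
  obtain ⟨l₁', l₂', l₃', I', J', K', I1', I2', I3', J1', J2', J3', K1', K2', K3', hs'⟩ := t'
  dsimp only at h1 h2 h3
  subst h1 h2 h3
  have eI := eq_of_image_eq tI tI' hI
  have eJ := eq_of_image_eq tJ tJ' hJ
  have eK := eq_of_image_eq tK tK' hK
  obtain rfl : I = I' := funext fun a => by
    have := congrFun eI a; have := I1 a; have := I1' a; dsimp only at *; omega
  obtain rfl : J = J' := funext fun a => by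
    have := congrFun eJ a; have := J1 a; have := J1' a; dsimp only at *; omega
  obtain rfl : K = K' := funext fun a => by
    have := congrFun eK a; have := K1 a; have := K1' a; dsimp only at *; omega
  rfl

/-- Generating function: summing over the third set gives powers of `X + 1`, over the second powers
of `X² + X + 1`, over the first `(X² + 2X + 1)^n = (1 + X)^(2n)`. -/
theorem card_filter_setTriples (n ℓ : ℕ) : ((setTriples n).filter fun p =>
    p.1.card + p.2.2.card + 2 * p.2.1.card = ℓ).card = (2 * n).choose ℓ := by
  have key : ∑ p ∈ setTriples n,
      (Polynomial.X : Polynomial ℕ) ^ (p.1.card + p.2.2.card + 2 * p.2.1.card) =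
        (1 + Polynomial.X) ^ (2 * n) := by
    rw [setTriples, Finset.sum_sigma]
    have h1 : ∀ A ∈ (Finset.range n).powerset,
        (∑ q ∈ (Finset.range (n - A.card)).powerset.sigma fun C =>
          (Finset.range (n - A.card - C.card)).powerset,
          (Polynomial.X : Polynomial ℕ) ^ (A.card + q.2.card + 2 * q.1.card)) =
        Polynomial.X ^ A.card * (Polynomial.X ^ 2 + (Polynomial.X + 1)) ^
          ((Finset.range n).card - A.card) := by
      intro A _
      rw [Finset.sum_sigma, Finset.card_range]
      have h2 := Finset.sum_pow_mul_eq_add_pow (Polynomial.X ^ 2 : Polynomial ℕ)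
        (Polynomial.X + 1) (Finset.range (n - A.card))
      rw [Finset.card_range] at h2
      rw [← h2, Finset.mul_sum]
      refine Finset.sum_congr rfl fun C _ => ?_
      have h3 := Finset.sum_pow_mul_eq_add_pow (Polynomial.X : Polynomial ℕ) 1
        (Finset.range (n - A.card - C.card))
      rw [Finset.card_range] at h3
      rw [← h3, Finset.mul_sum, Finset.mul_sum]
      refine Finset.sum_congr rfl fun B _ => ?_
      rw [one_pow]
      ring
    rw [Finset.sum_congr rfl h1, Finset.sum_pow_mul_eq_add_pow, Finset.card_range, pow_mul]
    congr 1
    ring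
  have := congrArg (fun p => Polynomial.coeff p ℓ) key
  simp only [Polynomial.finsetSum_coeff, Polynomial.coeff_X_pow, Polynomial.coeff_one_add_X_pow]
    at this
  rw [Finset.sum_boole] at this
  simpa [eq_comm] using this

instance : Finite (BasisIndex n ℓ) :=
  Finite.of_injective (fun t => (⟨t.toSets, t.toSets_mem⟩ : {p // p ∈ (setTriples n).filter fun p =>
    p.1.card + p.2.2.card + 2 * p.2.1.card = ℓ})) fun _ _ h =>
      toSets_injective (congrArg Subtype.val h)

instance : Fintype (BasisIndex n ℓ) := Fintype.ofFinite _

/-- Surjectivity of `toSets` is not needed: the opposite inequality comes from a spanning statement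
in `card_basisIndex`. -/
theorem card_le (n ℓ : ℕ) : Fintype.card (BasisIndex n ℓ) ≤ (2 * n).choose ℓ := by
  rw [← card_filter_setTriples, ← Finset.card_univ]
  exact Finset.card_le_card_of_injOn toSets (fun t _ => t.toSets_mem) toSets_injective.injOn

end BasisIndex

/-! ### Homomorphisms out of the ring of symmetric polynomials. -/

/-- The fundamental theorem on symmetric polynomials. -/
def SymRing.equiv (N : ℕ) : MvPolynomial (Fin N) ℂ ≃ₐ[ℂ] SymRing N :=
  (esymmAlgEquiv (Fin N) ℂ (Fintype.card_fin N) :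
    MvPolynomial (Fin N) ℂ ≃ₐ[ℂ] symmetricSubalgebra (Fin N) ℂ)

theorem SymRing.equiv_X (N : ℕ) (i : Fin N) :
    SymRing.equiv N (X i) = elemSym N ((i + 1 : ℕ) : ℤ) := by
  refine SymRing.toPoly_injective N ?_
  rw [toPoly_elemSym]
  exact (esymmAlgHom_apply (σ := Fin N) (R := ℂ) (n := N) (X i)).trans (aeval_X _ _)

/-- The homomorphism from `SymRing N` with given values on `e_1, …, e_N`. -/
def SymRing.lift (N : ℕ) {B : Type*} [CommRing B] [Algebra ℂ B] (c : ℕ → B) : SymRing N →ₐ[ℂ] B :=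
  (aeval fun i : Fin N => c (i + 1)).comp (SymRing.equiv N).symm.toAlgHom

theorem SymRing.lift_elemSym {N : ℕ} {B : Type*} [CommRing B] [Algebra ℂ B] (c : ℕ → B)
    {k : ℕ} (h1 : 1 ≤ k) (hk : k ≤ N) : SymRing.lift N c (elemSym N k) = c k := by
  obtain ⟨k, rfl⟩ := Nat.exists_eq_add_of_le' h1
  have := SymRing.equiv_X N ⟨k, by omega⟩
  dsimp only at this
  rw [← this, SymRing.lift]
  simp

instance (N : ℕ) : IsIntegrallyClosed (SymRing N) :=
  IsIntegrallyClosed.of_equiv (SymRing.equiv N).toRingEquiv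

theorem SymRing.hom_ext {N : ℕ} {B : Type*} [CommRing B] [Algebra ℂ B] {f g : SymRing N →ₐ[ℂ] B}
    (h : ∀ k : ℕ, 1 ≤ k → k ≤ N → f (elemSym N k) = g (elemSym N k)) : f = g := by
  have : f.comp (SymRing.equiv N).toAlgHom = g.comp (SymRing.equiv N).toAlgHom := by
    refine MvPolynomial.algHom_ext fun i => ?_
    have := h (i + 1) (by omega) (by omega)
    rw [← SymRing.equiv_X] at this
    exact this
  ext x
  have := DFunLike.congr_fun this ((SymRing.equiv N).symm x)
  simpa using this

/-! ### Expansion in the `E_i`, and specializations where only `e_{2n-1}` and `e_{2n}` survive. -/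

namespace WedgeSpan

open ExteriorAlgebra Polynomial

variable {B : Type*} [CommRing B] [IsDomain B] [Algebra ℚ B] {n ℓ : ℕ}

/-- Both sides are even of degree below `2n`, so comparison at the `2n` points `±ζ_i⁻¹` suffices.
The units are the inverse values of `E_i` at `ζ_i⁻¹`. -/
theorem exists_evenBasis_expansion (ζ : Fin n → Bˣ)
    (hη : ∀ i j, i ≠ j → IsUnit (sq ζ i - sq ζ j)) :
    ∃ g : Fin n → Bˣ, ∀ c : ℕ → B,
      ∑ s ∈ Finset.range n, Polynomial.C (c s) * Polynomial.X ^ (2 * s) =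
      ∑ i, ((g i : B) * ∑ s ∈ Finset.range n, c s * (↑(ζ i)⁻¹ : B) ^ (2 * s)) •
        evenBasis (sq ζ) i := by
  choose g hg using isUnit_gridValue ζ hη
  refine ⟨fun i => (g i)⁻¹, fun c => ?_⟩
  rw [← sub_eq_zero]
  refine Polynomial.eq_zero_of_degree_lt_of_eval_index_eq_zero Finset.univ
    (gridPoint_injective ζ hη).injOn ?_ fun p _ => ?_
  · rw [Finset.card_univ, Fintype.card_prod, Fintype.card_fin, Fintype.card_units_int,
      ← Polynomial.mem_degreeLT]
    refine Submodule.sub_mem _ (Submodule.sum_mem _ fun s hs => ?_)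
      (Submodule.sum_mem _ fun i _ => Submodule.smul_mem _ _ ?_)
    · rw [Polynomial.mem_degreeLT]
      refine lt_of_le_of_lt (Polynomial.degree_C_mul_X_pow_le _ _) ?_
      have := Finset.mem_range.1 hs
      exact_mod_cast (by omega : 2 * s < n * 2)
    · rw [Polynomial.mem_degreeLT]
      rw [mul_comm n]
      exact lt_of_le_of_lt (le_add_of_nonneg_right (by norm_num))
        (degree_evenBasis_add_one_lt (sq ζ) i)
  · have hs : ∀ s, gridPoint ζ p ^ (2 * s) = (↑(ζ p.1)⁻¹ : B) ^ (2 * s) := fun s => by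
      have h : (((p.2 : ℤ) : B)) ^ 2 = 1 := by
        rw [← Int.cast_pow, ← Units.val_pow_eq_pow_val, Int.units_sq]; simp
      rw [gridPoint, mul_pow, pow_mul, h, one_pow, one_mul]
    rw [Polynomial.eval_sub, Polynomial.eval_finsetSum, Polynomial.eval_finsetSum, sub_eq_zero,
      Finset.sum_eq_single p.1]
    · rw [Polynomial.eval_smul, eval_evenBasis_self, ← hg, smul_eq_mul, mul_right_comm,
        Units.inv_mul, one_mul]
      exact Finset.sum_congr rfl fun s _ => by simp [hs]
    · intro i _ hi
      rw [Polynomial.eval_smul, eval_evenBasis_of_ne ζ i p hi.symm, smul_zero]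
    · simp

section Nilpotent

variable {A : Type*} [CommRing A] (φ : SymRing (2 * n) →+* A)
  (ho : ∀ s : ℕ, 1 ≤ s → φ (elemSym (2 * n) (2 * s - 1)) = if s = n then 1 else 0)
  {c : A} (he : ∀ s : ℕ, 1 ≤ s → φ (elemSym (2 * n) (2 * s)) = if s = n then -c else 0)

-- Below `r = n` the value of `P_{r,1}` is zero, so the correction term of the recursion disappears
-- and only the shift in `s` remains. The even `e_k` therefore play no role.
include ho in
theorem map_coeffP_of_map_elemSym {r : ℕ} (hr : 1 ≤ r) (hrn : r ≤ n) (s : ℕ) (hs : 1 ≤ s) :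
    φ (coeffP (2 * n) r s) = if s + r = n + 1 then 1 else 0 := by
  induction r, hr using Nat.le_induction generalizing s with
  | base =>
    rw [coeffP, ho s hs]
    exact if_congr (by omega) rfl rfl
  | succ r hr ih =>
    obtain ⟨r, rfl⟩ := Nat.exists_eq_add_of_le' hr
    have h1 := ih (by omega) 1 le_rfl
    have h2 := ih (by omega) (s + 1) (by omega)
    rw [Nat.cast_one, if_neg (by omega)] at h1
    rw [Nat.cast_add, Nat.cast_one] at h2
    rw [coeffP, map_sub, map_mul, h1, mul_zero, sub_zero, h2]
    exact if_congr (by omega) rfl rfl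

include ho in
theorem map_vElt_of_map_elemSym {r : ℕ} (hr : 1 ≤ r) (hrn : r ≤ n) :
    (vElt n r).map φ = Polynomial.X ^ (2 * (n - r)) := by
  rw [vElt_eq, Polynomial.map_sum, Finset.sum_eq_single (n - r)]
  · rw [Polynomial.map_mul, Polynomial.map_C,
      map_coeffP_of_map_elemSym φ ho hr hrn _ (by omega), if_pos (by omega)]
    simp
  · intro s _ hs
    rw [Polynomial.map_mul, Polynomial.map_C,
      map_coeffP_of_map_elemSym φ ho hr hrn _ (by omega), if_neg (by omega)]
    simp
  · intro h
    exact absurd (Finset.mem_range.2 (by omega)) h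

include he in
theorem map_vZero_of_map_elemSym (hn : 0 < n) :
    (vZero n).map φ = 1 - Polynomial.C c * Polynomial.X ^ (2 * n) := by
  rw [vZero_eq, Polynomial.map_add, Polynomial.map_one, Polynomial.map_sum,
    Finset.sum_eq_single (n - 1)]
  · rw [Polynomial.map_mul, Polynomial.map_C, he _ (by omega), if_pos (by omega)]
    simp [Nat.sub_add_cancel hn, sub_eq_add_neg]
  · intro s _ hs
    rw [Polynomial.map_mul, Polynomial.map_C, he _ (by omega), if_neg (by omega)]
    simp
  · intro h
    exact absurd (Finset.mem_range.2 (by omega)) h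

end Nilpotent

end WedgeSpan

theorem Submodule.mul_comm_of_mul_eq_or_neg {B A : Type*} [CommRing B] [Ring A] [Algebra B A]
    {S T : Submodule B A} (h : ∀ x ∈ S, ∀ y ∈ T, x * y = y * x ∨ x * y = -(y * x)) :
    Commute S T := by
  refine le_antisymm (Submodule.mul_le.2 fun x hx y hy => ?_)
    (Submodule.mul_le.2 fun y hy x hx => ?_)
  · rcases h x hx y hy with h | h <;> rw [h]
    · exact Submodule.mul_mem_mul hy hx
    · exact Submodule.neg_mem _ (Submodule.mul_mem_mul hy hx)
  · rcases h x hx y hy with h | h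
    · rw [← h]; exact Submodule.mul_mem_mul hx hy
    · rw [← neg_eq_iff_eq_neg.2 h]; exact Submodule.neg_mem _ (Submodule.mul_mem_mul hx hy)

/-! ### Spanning at the point where only `e_{2n-1}` is nonzero. -/

namespace WedgeSpan

open ExteriorAlgebra Polynomial

variable {n ℓ : ℕ}

section Spans

variable {B : Type*} [CommRing B] (φ : SymRing (2 * n) →+* B)

theorem vSpan_le_range : vSpan φ ≤ LinearMap.range (ι B) := by
  rw [vSpan, Submodule.span_le]
  rintro _ ⟨r, -, rfl⟩
  exact ⟨_, rfl⟩

theorem wSpan_le_range (m : ℕ) : wSpan φ m ≤ LinearMap.range (ι B) := by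
  rw [wSpan, Submodule.span_le]
  rintro _ ⟨r, -, rfl⟩
  exact ⟨_, rfl⟩

theorem xiSpan_le_range (m : ℕ) : xiSpan φ m ≤ LinearMap.range (twoForm B) := by
  rw [xiSpan, Submodule.span_le]
  rintro _ ⟨r, -, rfl⟩
  exact ⟨_, rfl⟩

theorem commute_vSpan_wSpan (m : ℕ) : Commute (vSpan φ) (wSpan φ m) := by
  refine Submodule.mul_comm_of_mul_eq_or_neg fun x hx y hy => Or.inr ?_
  obtain ⟨x, rfl⟩ := vSpan_le_range φ hx
  obtain ⟨y, rfl⟩ := wSpan_le_range φ m hy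
  exact ι_mul_ι_comm _ _

theorem commute_xiSpan (m : ℕ) (S : Submodule B (ExteriorAlgebra B B[X])) :
    Commute (xiSpan φ m) S := by
  refine Submodule.mul_comm_of_mul_eq_or_neg fun x hx y _ => Or.inl ?_
  obtain ⟨x, rfl⟩ := xiSpan_le_range φ m hx
  exact commute_twoForm x y

/-- Each of the `b` last factors is a `ξ` or a product `w ∧ v`. Exchanging a `ξ` for `w ∧ v` raises
`l₁` by one and lowers the number of `ξ`'s by one; the bounds on the indices depend only on the sum
of these two numbers and are preserved. -/
theorem span_mul_span_mul_span_le (b l₁ l₂ a m : ℕ) (hℓ : l₁ + l₂ + 2 * a + 2 * b = ℓ)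
    (hm : l₁ + a + b + m = n) :
    vSpan φ ^ l₁ * wSpan φ m ^ l₂ * xiSpan φ (m + 1) ^ a *
      (xiSpan φ (m + 1) + wSpan φ m * vSpan φ) ^ b ≤ basisFormSpan φ ℓ := by
  induction b generalizing l₁ l₂ a with
  | zero =>
    rw [pow_zero, mul_one]
    have := span_mul_span_le φ l₁ l₂ a (by omega : l₁ + l₂ + 2 * a = ℓ) (by omega)
    rwa [show n - l₁ - a = m by omega] at this
  | succ b ih =>
    have h₁ := ih l₁ l₂ (a + 1) (by omega) (by omega)
    have h₂ := ih (l₁ + 1) (l₂ + 1) a (by omega) (by omega)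
    generalize hD : (xiSpan φ (m + 1) + wSpan φ m * vSpan φ) ^ b = D at h₁ h₂
    rw [pow_succ', hD, add_mul, mul_add]
    refine sup_le ?_ ?_
    · rwa [← mul_assoc, mul_assoc _ (_ ^ a), ← pow_succ]
    · have e : vSpan φ ^ l₁ * wSpan φ m ^ l₂ * xiSpan φ (m + 1) ^ a *
          (wSpan φ m * vSpan φ * D) = vSpan φ ^ (l₁ + 1) * wSpan φ m ^ (l₂ + 1) *
          xiSpan φ (m + 1) ^ a * D := by
        have c₁ := ((commute_xiSpan φ (m + 1) (wSpan φ m * vSpan φ)).pow_left a).eq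
        have c₂ := ((commute_vSpan_wSpan φ m).pow_right (l₂ + 1)).eq
        rw [← mul_assoc, mul_assoc _ (_ ^ a), c₁, ← mul_assoc, ← mul_assoc,
          mul_assoc (_ ^ l₁) (_ ^ l₂), ← pow_succ, mul_assoc (_ ^ l₁) _ (vSpan φ), ← c₂,
          ← mul_assoc, ← pow_succ]
      rwa [e]

end Spans

section Nilpotent

variable {B : Type*} [CommRing B] [IsDomain B] [Algebra ℚ B]
  (φ : SymRing (2 * n) →+* B)
  (ho : ∀ s : ℕ, 1 ≤ s → φ (elemSym (2 * n) (2 * s - 1)) = if s = n then 1 else 0)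
  (φ' : SymRing (2 * n) →+* B)
  (ho' : ∀ s : ℕ, 1 ≤ s → φ' (elemSym (2 * n) (2 * s - 1)) = if s = n then 1 else 0)
  {c : B} (he : ∀ s : ℕ, 1 ≤ s → φ (elemSym (2 * n) (2 * s)) = if s = n then -c else 0)
  {c' : B} (he' : ∀ s : ℕ, 1 ≤ s → φ' (elemSym (2 * n) (2 * s)) = if s = n then -c' else 0)

-- Here `v_r = X^(2(n-r))` for both homomorphisms and `v_0 = 1 - c X^(2n)`, so the difference is a
-- geometric sum. Its terms are `v_{k-1-i}(X_1) v_{i+1}(X_2)`, with both indices between `1` and `k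
-- - 1`.
include ho ho' he he' in
theorem map_xiElt_sub {k : ℕ} (hk : 1 ≤ k) (hkn : k ≤ n) :
    MvPolynomial.map φ' (xiElt n k) - MvPolynomial.map φ (xiElt n k) =
      MvPolynomial.C (c' - c) * ((MvPolynomial.X 0 - MvPolynomial.X 1) *
        ∑ i ∈ Finset.range (k - 1), MvPolynomial.X 0 ^ (2 * (n - (k - 1 - i))) *
          MvPolynomial.X 1 ^ (2 * (n - (i + 1)))) := by
  refine mul_left_cancel₀ (X_add_X_ne_zero (B := B) (a := (0 : Fin 2)) (b := 1) (by decide)) ?_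
  rw [mul_sub, map_xiElt_spec, map_xiElt_spec, map_vZero_of_map_elemSym φ he (by omega),
    map_vZero_of_map_elemSym φ' he' (by omega), map_vElt_of_map_elemSym φ ho hk hkn,
    map_vElt_of_map_elemSym φ' ho' hk hkn]
  have hg := Commute.mul_geom_sum₂ (Commute.all (MvPolynomial.X 0 ^ 2 : MvPolynomial (Fin 2) B)
    (MvPolynomial.X 1 ^ 2)) (k - 1)
  have hs : ∑ i ∈ Finset.range (k - 1), (MvPolynomial.X 0 : MvPolynomial (Fin 2) B) ^
      (2 * (n - (k - 1 - i))) * MvPolynomial.X 1 ^ (2 * (n - (i + 1))) =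
      (MvPolynomial.X 0 ^ (2 * (n - k) + 2) * MvPolynomial.X 1 ^ (2 * (n - k) + 2)) *
      ∑ i ∈ Finset.range (k - 1), (MvPolynomial.X 0 ^ 2) ^ i *
        (MvPolynomial.X 1 ^ 2) ^ (k - 1 - 1 - i) := by
    rw [Finset.mul_sum]
    refine Finset.sum_congr rfl fun i hi => ?_
    have := Finset.mem_range.1 hi
    rw [← pow_mul, ← pow_mul, mul_mul_mul_comm, ← pow_add, ← pow_add]
    congr 2 <;> omega
  have hp : ∀ a : Fin 2, (MvPolynomial.X a : MvPolynomial (Fin 2) B) ^ (2 * n) =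
      MvPolynomial.X a ^ (2 * (n - k) + 2) * (MvPolynomial.X a ^ 2) ^ (k - 1) := fun a => by
    rw [← pow_mul, ← pow_add]; congr 1; omega
  simp only [map_sub, map_mul, map_one, map_pow, Polynomial.aeval_X, Polynomial.aeval_C,
    MvPolynomial.algebraMap_eq, hs, hp]
  linear_combination (MvPolynomial.C c' - MvPolynomial.C c) *
    (MvPolynomial.X 0 ^ (2 * (n - k) + 2) * MvPolynomial.X 1 ^ (2 * (n - k) + 2)) * (-hg)

-- Changing `e_{2n}` leaves the `v_r` and `w_r` alone and alters `ξ_k` by terms `w ∧ v` with indices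
-- at most `k - 1`. Since `k ≤ m + 1` with `m = n - l₁ - l₃`, the `w` indices respect their bound
-- `m`.
include ho ho' he he' in
theorem basisForm_mem_basisFormSpan (t : BasisIndex n ℓ) :
    basisForm φ' t ∈ basisFormSpan φ ℓ := by
  obtain ⟨l₁, l₂, l₃, I, J, K, hI, hI', hI'', hJ, hJ', hJ'', hK, hK', hK'', hℓ⟩ := t
  have hv : ∀ r, 1 ≤ r → r ≤ n → (vElt n r).map φ' = (vElt n r).map φ := fun r h h' => by
    rw [map_vElt_of_map_elemSym φ ho h h', map_vElt_of_map_elemSym φ' ho' h h']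
  have hle : l₁ + l₃ ≤ n := by
    rcases Nat.eq_zero_or_pos l₃ with h | h
    · subst h
      have := Fintype.card_le_of_injective (fun a : Fin l₁ => (⟨I a - 1, by
        have := hI a; have := hI'' a; omega⟩ : Fin n)) fun a b hab => hI'.injective (by
          have := congrArg Fin.val hab; have := hI a; have := hI b; dsimp only at *; omega)
      simpa using this
    · have := hK'' ⟨0, h⟩; have := hK ⟨0, h⟩; omega
  obtain ⟨m, hm⟩ := Nat.exists_eq_add_of_le hle
  refine span_mul_span_mul_span_le φ l₃ l₁ l₂ 0 m (by omega) (by omega) ?_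
  rw [pow_zero, mul_one, basisForm]
  refine Submodule.mul_mem_mul (Submodule.mul_mem_mul ?_ ?_) ?_
  · have := list_prod_mem_pow (S := vSpan φ)
      (List.ofFn fun a => ι B ((vElt n (I a)).map φ')) fun x hx => ?_
    · simpa using this
    · obtain ⟨a, rfl⟩ := List.mem_ofFn.1 hx
      rw [hv _ (hI a) (hI'' a)]
      exact Submodule.subset_span ⟨I a, ⟨hI a, hI'' a⟩, rfl⟩
  · have := list_prod_mem_pow (S := wSpan φ m)
      (List.ofFn fun a => ι B ((wElt n (J a)).map φ')) fun x hx => ?_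
    · simpa using this
    · obtain ⟨a, rfl⟩ := List.mem_ofFn.1 hx
      refine Submodule.subset_span ⟨J a, ⟨hJ a, by have := hJ'' a; omega⟩, ?_⟩
      dsimp only
      rw [wElt, Polynomial.map_mul, Polynomial.map_mul, Polynomial.map_X, Polynomial.map_X,
        hv _ (hJ a) (by have := hJ'' a; omega)]
  · have := list_prod_mem_pow (S := xiSpan φ (m + 1) + wSpan φ m * vSpan φ)
      (List.ofFn fun a => twoForm B (MvPolynomial.map φ' (xiElt n (K a)))) fun x hx => ?_
    · simpa using this
    · obtain ⟨a, rfl⟩ := List.mem_ofFn.1 hx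
      have h1 := hK a
      have h2 := hK'' a
      have := a.isLt
      rw [← add_sub_cancel (MvPolynomial.map φ (xiElt n (K a)))
        (MvPolynomial.map φ' (xiElt n (K a))), map_add]
      refine Submodule.add_mem_sup (S := xiSpan φ (m + 1)) (T := wSpan φ m * vSpan φ)
        (Submodule.subset_span ⟨K a, ⟨h1, by omega⟩, rfl⟩) ?_
      rw [map_xiElt_sub φ ho φ' ho' he he' h1 (by omega), ← MvPolynomial.smul_eq_C_mul, map_smul,
        Finset.mul_sum, map_sum]
      refine Submodule.smul_mem _ _ (Submodule.sum_mem _ fun i hi => ?_)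
      have hi' := Finset.mem_range.1 hi
      have e : ∀ p q : ℕ, twoForm B ((MvPolynomial.X 0 - MvPolynomial.X 1) *
          (MvPolynomial.X 0 ^ p * MvPolynomial.X 1 ^ q)) =
          ι B (Polynomial.X * Polynomial.X ^ p : B[X]) * ι B (Polynomial.X ^ q : B[X]) -
          ι B (Polynomial.X ^ p : B[X]) * ι B (Polynomial.X * Polynomial.X ^ q : B[X]) := by
        intro p q
        rw [← twoForm_mul, ← twoForm_mul, ← map_sub]
        congr 1
        simp only [map_mul, map_pow, Polynomial.aeval_X]
        ring
      have hmv : ∀ r, 1 ≤ r → r ≤ n → ι B (Polynomial.X ^ (2 * (n - r)) : B[X]) ∈ vSpan φ :=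
        fun r hr hr' => Submodule.subset_span
          ⟨r, ⟨hr, hr'⟩, by dsimp only; rw [map_vElt_of_map_elemSym φ ho hr hr']⟩
      have hmw : ∀ r, 1 ≤ r → r ≤ m →
          ι B (Polynomial.X * Polynomial.X ^ (2 * (n - r)) : B[X]) ∈ wSpan φ m :=
        fun r hr hr' => Submodule.subset_span
          ⟨r, ⟨hr, hr'⟩, by
            dsimp only
            rw [wElt, Polynomial.map_mul, map_vElt_of_map_elemSym φ ho hr (by omega),
              Polynomial.map_X]⟩
      rw [e]
      refine Submodule.sub_mem _ (Submodule.mul_mem_mul (hmw _ (by omega) (by omega))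
        (hmv _ (by omega) (by omega))) ?_
      rw [← (commute_vSpan_wSpan φ m).eq]
      exact Submodule.mul_mem_mul (hmv _ (by omega) (by omega)) (hmw _ (by omega) (by omega))

end Nilpotent

/-- The homomorphism sending `e_{2n-1}` to `1`, `e_{2n}` to `-c` and the other `e_k` to `0`. -/
def nilHom (n : ℕ) (c : ℂ) : SymRing (2 * n) →ₐ[ℂ] ℂ :=
  SymRing.lift (2 * n) fun k => if k + 1 = 2 * n then 1 else if k = 2 * n then -c else 0

theorem nilHom_odd (n : ℕ) (c : ℂ) (s : ℕ) (hs : 1 ≤ s) :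
    nilHom n c (elemSym (2 * n) (2 * s - 1)) = if s = n then 1 else 0 := by
  rw [show (2 * (s : ℤ) - 1) = ((2 * s - 1 : ℕ) : ℤ) by omega]
  rcases le_or_gt (2 * s - 1) (2 * n) with h | h
  · rw [nilHom, SymRing.lift_elemSym _ (by omega) h]
    by_cases hsn : s = n
    · rw [if_pos (by omega), if_pos hsn]
    · rw [if_neg (by omega), if_neg (by omega), if_neg hsn]
  · rw [elemSym_eq_zero (by omega), map_zero, if_neg (by omega)]

theorem nilHom_even (n : ℕ) (c : ℂ) (s : ℕ) (hs : 1 ≤ s) :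
    nilHom n c (elemSym (2 * n) (2 * s)) = if s = n then -c else 0 := by
  rw [show (2 * (s : ℤ)) = ((2 * s : ℕ) : ℤ) by omega]
  rcases le_or_gt (2 * s) (2 * n) with h | h
  · rw [nilHom, SymRing.lift_elemSym _ (by omega) h, if_neg (by omega)]
    exact if_congr (by omega) rfl rfl
  · rw [elemSym_eq_zero (by omega), map_zero, if_neg (by omega)]

/-- At this point `v_0 = 1 - X^(2n)` splits with distinct `η_i`, the `n`-th roots of unity, and `v_1
= X^(2n-2)` has nonzero weights. The divisibility condition of `mem_span_map_basisElt` is then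
empty. -/
theorem mem_span_map_nilHom_one (P : MvPolynomial (Fin ℓ) ℂ)
    (hσ : ∀ σ : Equiv.Perm (Fin ℓ), rename σ P = (Equiv.Perm.sign σ : ℤ) • P)
    (hP : ∀ m ∈ P.support, ∀ a, m a < 2 * n) :
    P ∈ Submodule.span ℂ (Set.range fun t : BasisIndex n ℓ =>
      MvPolynomial.map (nilHom n 1 : SymRing (2 * n) →+* ℂ) (basisElt t)) := by
  set φ : SymRing (2 * n) →+* ℂ := (nilHom n 1 : SymRing (2 * n) →+* ℂ) with hφ
  have hω := Complex.isPrimitiveRoot_exp (2 * n)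
  rcases Nat.eq_zero_or_pos n with rfl | hn
  · refine mem_span_map_basisElt (φ := φ) (β := fun _ => 1) (fun _ => 1) (fun i => i.elim0) ?_ ?_
      P hσ hP fun x => by simp
    · simp [vZero, elemSym_zero]
    · simp [vElt]
  specialize hω (by omega)
  set ω := Complex.exp (2 * Real.pi * Complex.I / (2 * n : ℕ)) with hωdef
  have hη := hω.pow (by omega) (rfl : 2 * n = 2 * n)
  -- The first `n` powers of a primitive `2n`-th root of unity; their squares run once through the
  -- `n`-th roots of unity.
  let ζ : Fin n → ℂˣ := fun i => Units.mk0 (ω ^ (i : ℕ)) (pow_ne_zero _ (Complex.exp_ne_zero _))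
  have hsq : ∀ i, sq ζ i = (ω ^ 2) ^ (i : ℕ) := fun i => by
    rw [sq, Units.val_mk0, ← pow_mul, ← pow_mul, mul_comm]
  have hne : ∀ i j, i ≠ j → IsUnit (sq ζ i - sq ζ j) := fun i j hij => by
    rw [isUnit_iff_ne_zero, hsq, hsq, sub_ne_zero]
    exact fun h => hij (Fin.ext (hη.pow_inj i.isLt j.isLt h))
  obtain ⟨g, hg⟩ := exists_evenBasis_expansion ζ hne
  have hprod : ∏ j, (1 - Polynomial.C (sq ζ j) * Polynomial.X ^ 2) =
      (1 - Polynomial.C 1 * Polynomial.X ^ (2 * n) : ℂ[X]) := by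
    have hC := hη.map_of_injective (f := (Polynomial.C : ℂ →+* ℂ[X])) Polynomial.C_injective
    have h1 := hC.pow_sub_pow_eq_prod_sub_mul 1 (Polynomial.X ^ 2) hn
    rw [one_pow, ← pow_mul] at h1
    rw [map_one, one_mul, h1]
    have himg : Finset.univ.image (fun j : Fin n => Polynomial.C (sq ζ j)) =
        nthRootsFinset n (1 : ℂ[X]) := by
      refine Finset.eq_of_subset_of_card_le ?_ ?_
      · intro z hz
        obtain ⟨j, -, rfl⟩ := Finset.mem_image.1 hz
        rw [mem_nthRootsFinset hn, hsq, ← map_pow, ← pow_mul, mul_comm, pow_mul, hη.pow_eq_one,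
          one_pow, map_one]
      · rw [hC.card_nthRootsFinset, Finset.card_image_of_injective, Finset.card_univ,
          Fintype.card_fin]
        intro i j hij
        by_contra h
        have := hne i j h
        rw [Polynomial.C_injective hij, sub_self] at this
        exact not_isUnit_zero this
    rw [← himg, Finset.prod_image]
    intro i _ j _ hij
    by_contra h
    have := hne i j h
    rw [Polynomial.C_injective hij, sub_self] at this
    exact not_isUnit_zero this
  have hv1 := hg fun s => if s = n - 1 then 1 else 0
  refine mem_span_map_basisElt (φ := φ) ζ hne ?_ (Eq.trans ?_ hv1) P hσ hP fun x => ?_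
  · rw [hprod, map_vZero_of_map_elemSym φ (nilHom_even n 1) hn]
  · rw [map_vElt_of_map_elemSym φ (nilHom_odd n 1) le_rfl hn, Finset.sum_eq_single (n - 1)]
    · simp
    · intro s _ hs; simp [hs]
    · intro h; exact absurd (Finset.mem_range.2 (by omega)) h
  · refine IsUnit.dvd (isUnit_iff_ne_zero.2 (Finset.prod_ne_zero_iff.2 fun i _ => ?_))
    refine mul_ne_zero (Units.ne_zero _) ?_
    rw [Finset.sum_eq_single (n - 1)]
    · simp
    · intro s _ hs; simp [hs]
    · intro h; exact absurd (Finset.mem_range.2 (by omega)) h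

/-- At `c = 0` all `η_i` collide and the diagonalization is unavailable; spanning is carried over
from `c = 1`. -/
theorem mem_span_map_nilHom_zero (P : MvPolynomial (Fin ℓ) ℂ)
    (hσ : ∀ σ : Equiv.Perm (Fin ℓ), rename σ P = (Equiv.Perm.sign σ : ℤ) • P)
    (hP : ∀ m ∈ P.support, ∀ a, m a < 2 * n) :
    P ∈ Submodule.span ℂ (Set.range fun t : BasisIndex n ℓ =>
      MvPolynomial.map (nilHom n 0 : SymRing (2 * n) →+* ℂ) (basisElt t)) := by
  refine Submodule.span_le.2 ?_ (mem_span_map_nilHom_one P hσ hP)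
  rintro _ ⟨t, rfl⟩
  dsimp only
  rw [← antisym_basisForm]
  have := Submodule.mem_map_of_mem (f := antisym ℂ ℓ) (basisForm_mem_basisFormSpan
    (nilHom n 0 : SymRing (2 * n) →+* ℂ) (nilHom_odd n 0) (nilHom n 1 : SymRing (2 * n) →+* ℂ)
    (nilHom_odd n 1) (nilHom_even n 0) (nilHom_even n 1) t)
  rw [basisFormSpan, Submodule.map_span] at this
  refine Submodule.span_mono ?_ this
  rintro _ ⟨_, ⟨t, rfl⟩, rfl⟩
  exact ⟨t, (antisym_basisForm _ t).symm⟩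

end WedgeSpan

/-! ### The coefficient determinant and Cramer's rule. -/

namespace WedgeSpan

open ExteriorAlgebra Polynomial

variable {n ℓ : ℕ}

/-- The index set of strictly increasing exponent vectors, as subsets. -/
abbrev ExpIndex (N ℓ : ℕ) : Type := {s : Finset (Fin N) // s ∈ Finset.powersetCard ℓ Finset.univ}

theorem card_expIndex (N ℓ : ℕ) : Fintype.card (ExpIndex N ℓ) = N.choose ℓ := by
  rw [Fintype.card_coe, Finset.card_powersetCard, Finset.card_univ, Fintype.card_fin]

/-- The strictly increasing enumeration of a subset. -/
def ExpIndex.enum {N : ℕ} (s : ExpIndex N ℓ) : Fin ℓ ↪o Fin N :=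
  s.1.orderEmbOfFin (Finset.mem_powersetCard.1 s.2).2

theorem ExpIndex.enum_injective {N : ℕ} : Function.Injective (ExpIndex.enum : ExpIndex N ℓ → _) :=
  fun s t h => Subtype.ext <| by
    rw [← Finset.coe_inj, ← Finset.range_orderEmbOfFin s.1 (Finset.mem_powersetCard.1 s.2).2,
      ← Finset.range_orderEmbOfFin t.1 (Finset.mem_powersetCard.1 t.2).2]
    exact congrArg (fun f : Fin ℓ ↪o Fin N => Set.range f) h

theorem ExpIndex.exists_enum_eq {N : ℕ} {f : Fin ℓ → Fin N} (hf : StrictMono f) :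
    ∃ s : ExpIndex N ℓ, ⇑s.enum = f := by
  have hc : (Finset.univ.image f).card = ℓ := by
    rw [Finset.card_image_of_injective _ hf.injective, Finset.card_univ, Fintype.card_fin]
  refine ⟨⟨Finset.univ.image f, Finset.mem_powersetCard.2 ⟨Finset.subset_univ _, hc⟩⟩, ?_⟩
  exact (Finset.orderEmbOfFin_unique hc (fun a => Finset.mem_image_of_mem f (Finset.mem_univ a))
    hf).symm

/-- The exponent vector of a subset. -/
def ExpIndex.exponent {N : ℕ} (s : ExpIndex N ℓ) : Fin ℓ →₀ ℕ :=
  Finsupp.equivFunOnFinite.symm fun a => (s.enum a : ℕ)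

theorem ExpIndex.exponent_apply {N : ℕ} (s : ExpIndex N ℓ) (a : Fin ℓ) :
    s.exponent a = s.enum a := rfl

section Antisymmetric

variable {B : Type*} [CommRing B]

theorem coeff_mapDomain_of_antisymm {P : MvPolynomial (Fin ℓ) B}
    (hσ : ∀ σ : Equiv.Perm (Fin ℓ), rename σ P = (Equiv.Perm.sign σ : ℤ) • P)
    (σ : Equiv.Perm (Fin ℓ)) (d : Fin ℓ →₀ ℕ) :
    (Equiv.Perm.sign σ : ℤ) • P.coeff (d.mapDomain σ) = P.coeff d := by
  rw [← coeff_rename_mapDomain σ σ.injective P d, hσ, MvPolynomial.coeff_smul]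

theorem eq_zero_of_coeff_exponent_eq_zero [IsDomain B] [CharZero B] {N : ℕ}
    {P : MvPolynomial (Fin ℓ) B}
    (hσ : ∀ σ : Equiv.Perm (Fin ℓ), rename σ P = (Equiv.Perm.sign σ : ℤ) • P)
    (hP : ∀ m ∈ P.support, ∀ a, m a < N)
    (h0 : ∀ s : ExpIndex N ℓ, P.coeff s.exponent = 0) : P = 0 := by
  ext d
  rw [MvPolynomial.coeff_zero]
  by_contra hd
  have hlt := hP d (MvPolynomial.mem_support_iff.2 hd)
  by_cases hinj : Function.Injective d
  · have hmono : StrictMono fun a => (⟨d (Tuple.sort d a), hlt _⟩ : Fin N) :=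
      (Tuple.monotone_sort d).strictMono_of_injective (hinj.comp (Tuple.sort d).injective)
    obtain ⟨s, hs⟩ := ExpIndex.exists_enum_eq hmono
    have := coeff_mapDomain_of_antisymm hσ (Tuple.sort d)⁻¹ d
    rw [show d.mapDomain ⇑(Tuple.sort d)⁻¹ = s.exponent by
      ext a
      rw [Finsupp.mapDomain_equiv_apply, ExpIndex.exponent_apply, hs]
      rfl, h0, smul_zero] at this
    exact hd this.symm
  · simp only [Function.Injective, not_forall] at hinj
    obtain ⟨a, b, hab, hne⟩ := hinj
    have := coeff_mapDomain_of_antisymm hσ (Equiv.swap a b) d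
    rw [show d.mapDomain ⇑(Equiv.swap a b) = d by
      ext c
      rw [Finsupp.mapDomain_equiv_apply, Equiv.symm_swap]
      rcases eq_or_ne c a with rfl | hca
      · rw [Equiv.swap_apply_left, hab]
      rcases eq_or_ne c b with rfl | hcb
      · rw [Equiv.swap_apply_right, hab]
      · rw [Equiv.swap_apply_of_ne_of_ne hca hcb], Equiv.Perm.sign_swap hne] at this
    simp only [Units.val_neg, Units.val_one, neg_smul, one_smul] at this
    exact hd (self_eq_neg.1 this.symm)

theorem coeff_antisym_ιMulti_X_pow (e : Fin ℓ → ℕ) (d : Fin ℓ →₀ ℕ) :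
    (antisym B ℓ (ιMulti B ℓ fun a => (Polynomial.X ^ e a : B[X]))).coeff d =
      ∑ σ : Equiv.Perm (Fin ℓ), (Equiv.Perm.sign σ : ℤ) •
        if (Finsupp.equivFunOnFinite.symm e).mapDomain σ = d then (1 : B) else 0 := by
  classical
  rw [antisym_ιMulti, MvPolynomial.coeff_sum]
  refine Finset.sum_congr rfl fun σ _ => ?_
  rw [MvPolynomial.coeff_smul, ← MvPolynomial.coeff_monomial, MvPolynomial.monomial_eq,
    Finsupp.prod_mapDomain_index_inj σ.injective, Finsupp.prod_fintype _ _ (by simp)]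
  simp

theorem coeff_antisym_ιMulti_exponent {N : ℕ} (s s' : ExpIndex N ℓ) :
    (antisym B ℓ (ιMulti B ℓ fun a => (Polynomial.X ^ (s.enum a : ℕ) : B[X]))).coeff s'.exponent =
      if s = s' then 1 else 0 := by
  classical
  have key : ∀ σ : Equiv.Perm (Fin ℓ), s.exponent.mapDomain σ = s'.exponent →
      σ = 1 ∧ s = s' := by
    intro σ h
    have h1 : ∀ a, s.enum (σ⁻¹ a) = s'.enum a := fun a => by
      have := DFunLike.congr_fun h a
      rw [Finsupp.mapDomain_equiv_apply] at this
      exact Fin.ext this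
    have h2 : ⇑s.enum ∘ ⇑σ⁻¹ = s'.enum := funext h1
    have h3 : ⇑s.enum ∘ ⇑σ⁻¹ = s.enum := by
      refine (StrictMono.range_inj (h2 ▸ s'.enum.strictMono) s.enum.strictMono).1 ?_
      rw [Set.range_comp, (σ⁻¹).surjective.range_eq, Set.image_univ]
    refine ⟨?_, ExpIndex.enum_injective (DFunLike.coe_injective (h3.symm.trans h2))⟩
    rw [← inv_eq_one]
    exact Equiv.ext fun a => s.enum.injective (congrFun h3 a)
  rw [coeff_antisym_ιMulti_X_pow, Finset.sum_eq_single 1]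
  · rw [Equiv.Perm.sign_one, Units.val_one, one_smul, Equiv.Perm.coe_one, Finsupp.mapDomain_id]
    refine if_congr ⟨fun h => ?_, fun h => h ▸ rfl⟩ rfl rfl
    exact (key 1 (by rw [Equiv.Perm.coe_one, Finsupp.mapDomain_id]; exact h)).2
  · intro σ _ hσ
    exact (congrArg _ (if_neg fun h => hσ (key σ h).1)).trans (smul_zero _)
  · simp

theorem lt_of_mem_support_antisym_ιMulti {N : ℕ} (s : ExpIndex N ℓ) {d : Fin ℓ →₀ ℕ}
    (hd : d ∈ (antisym B ℓ (ιMulti B ℓ fun a =>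
      (Polynomial.X ^ (s.enum a : ℕ) : B[X]))).support) (a : Fin ℓ) : d a < N := by
  rw [MvPolynomial.mem_support_iff, coeff_antisym_ιMulti_X_pow] at hd
  obtain ⟨σ, -, hσ⟩ := Finset.exists_ne_zero_of_sum_ne_zero hd
  have : (Finsupp.equivFunOnFinite.symm fun a => (s.enum a : ℕ)).mapDomain σ = d := by
    by_contra h
    exact hσ (by rw [if_neg h, smul_zero])
  rw [← this, Finsupp.mapDomain_equiv_apply]
  exact (s.enum _).isLt

end Antisymmetric

/-- The coefficients at the strictly increasing exponent vectors. -/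
def expCoeff (B : Type*) [CommRing B] (N ℓ : ℕ) :
    MvPolynomial (Fin ℓ) B →ₗ[B] (ExpIndex N ℓ → B) :=
  LinearMap.pi fun s => MvPolynomial.lcoeff B s.exponent

theorem expCoeff_apply {B : Type*} [CommRing B] {N : ℕ} (P : MvPolynomial (Fin ℓ) B)
    (s : ExpIndex N ℓ) : expCoeff B N ℓ P s = P.coeff s.exponent := rfl

theorem span_expCoeff_eq_top (n ℓ : ℕ) : Submodule.span ℂ (Set.range fun t : BasisIndex n ℓ =>
    expCoeff ℂ (2 * n) ℓ (MvPolynomial.map (nilHom n 0 : SymRing (2 * n) →+* ℂ) (basisElt t))) =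
      ⊤ := by
  rw [eq_top_iff, ← (Pi.basisFun ℂ (ExpIndex (2 * n) ℓ)).span_eq, Submodule.span_le]
  rintro _ ⟨s, rfl⟩
  have := Submodule.mem_map_of_mem (f := expCoeff ℂ (2 * n) ℓ) (mem_span_map_nilHom_zero
    (antisym ℂ ℓ (ιMulti ℂ ℓ fun a => (Polynomial.X ^ (s.enum a : ℕ) : ℂ[X])))
    (rename_antisym_ιMulti _) fun m hm a => lt_of_mem_support_antisym_ιMulti s hm a)
  rw [Submodule.map_span, ← Set.range_comp] at this
  have e : (Pi.basisFun ℂ (ExpIndex (2 * n) ℓ)) s = expCoeff ℂ (2 * n) ℓ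
      (antisym ℂ ℓ (ιMulti ℂ ℓ fun a => (Polynomial.X ^ (s.enum a : ℕ) : ℂ[X]))) := by
    ext s'
    rw [expCoeff_apply, coeff_antisym_ιMulti_exponent, Pi.basisFun_apply, Pi.single_apply]
    exact if_congr eq_comm rfl rfl
  rw [SetLike.mem_coe, e]
  exact this

/-- The family spans a space whose dimension is the binomial coefficient, which gives the missing
inequality and makes the coefficient matrix square. -/
theorem card_basisIndex (n ℓ : ℕ) : Fintype.card (BasisIndex n ℓ) = (2 * n).choose ℓ := by
  refine le_antisymm (BasisIndex.card_le n ℓ) ?_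
  have h := finrank_range_le_card (R := ℂ) (fun t : BasisIndex n ℓ =>
    expCoeff ℂ (2 * n) ℓ (MvPolynomial.map (nilHom n 0 : SymRing (2 * n) →+* ℂ) (basisElt t)))
  rwa [Set.finrank, span_expCoeff_eq_top, finrank_top, Module.finrank_fintype_fun_eq_card,
    card_expIndex] at h

/-- A numbering of the increasing exponent vectors by the indices of the basis. -/
def expEquiv (n ℓ : ℕ) : BasisIndex n ℓ ≃ ExpIndex (2 * n) ℓ :=
  Fintype.equivOfCardEq (by rw [card_basisIndex, card_expIndex])

open scoped Classical in
/-- The matrix of the coefficients of the `v_I ∧ w_J ∧ ξ_K`. -/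
def coeffMatrix (n ℓ : ℕ) : Matrix (BasisIndex n ℓ) (BasisIndex n ℓ) (SymRing (2 * n)) :=
  fun t t' => (basisElt t).coeff (expEquiv n ℓ t').exponent

open scoped Classical in
/-- The determinant of the coefficients of the `v_I ∧ w_J ∧ ξ_K`. -/
def coeffDet (n ℓ : ℕ) : SymRing (2 * n) := (coeffMatrix n ℓ).det

theorem nilHom_coeffDet_ne_zero (n ℓ : ℕ) : nilHom n 0 (coeffDet n ℓ) ≠ 0 := by
  classical
  have hdet : nilHom n 0 (coeffDet n ℓ) = ((coeffMatrix n ℓ).map (nilHom n 0)).det := by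
    rw [coeffDet, AlgHom.map_det]; rfl
  rw [hdet, ← isUnit_iff_ne_zero, ← Matrix.isUnit_iff_isUnit_det,
    ← Matrix.vecMul_surjective_iff_isUnit]
  intro f
  have hf : f ∘ (expEquiv n ℓ).symm ∈ Submodule.span ℂ (Set.range fun t : BasisIndex n ℓ =>
      expCoeff ℂ (2 * n) ℓ
        (MvPolynomial.map (nilHom n 0 : SymRing (2 * n) →+* ℂ) (basisElt t))) := by
    rw [span_expCoeff_eq_top]; trivial
  obtain ⟨c, hc⟩ := (Submodule.mem_span_range_iff_exists_fun ℂ).1 hf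
  refine ⟨c, funext fun t' => ?_⟩
  have := congrFun hc (expEquiv n ℓ t')
  rw [Function.comp_apply, Equiv.symm_apply_apply] at this
  rw [← this, Finset.sum_apply]
  refine Finset.sum_congr rfl fun t _ => ?_
  rw [Pi.smul_apply, expCoeff_apply, MvPolynomial.coeff_map, smul_eq_mul]
  rfl

theorem linearIndependent_map_basisElt {A : Type*} [CommRing A] [IsDomain A]
    (φ : SymRing (2 * n) →+* A) (hφ : φ (coeffDet n ℓ) ≠ 0) :
    LinearIndependent A fun t : BasisIndex n ℓ => MvPolynomial.map φ (basisElt t) := by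
  classical
  rw [Fintype.linearIndependent_iff]
  intro c hc
  have h : Matrix.vecMul c ((coeffMatrix n ℓ).map φ) = 0 := by
    funext t'
    have := congrArg (MvPolynomial.coeff (expEquiv n ℓ t').exponent) hc
    rw [MvPolynomial.coeff_sum, MvPolynomial.coeff_zero] at this
    rw [Matrix.vecMul, dotProduct, Pi.zero_apply, ← this]
    refine Finset.sum_congr rfl fun t _ => ?_
    rw [MvPolynomial.coeff_smul, MvPolynomial.coeff_map, smul_eq_mul]
    rfl
  refine congrFun (Matrix.eq_zero_of_vecMul_eq_zero ?_ h)
  have hdet : φ (coeffDet n ℓ) = ((coeffMatrix n ℓ).map φ).det := by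
    rw [coeffDet, RingHom.map_det]; rfl
  rwa [← hdet]

/-- Cramer's rule: the coefficients are obtained from the adjugate, and an antisymmetric polynomial
is determined by its coefficients at increasing exponent vectors. -/
theorem exists_coeffDet_smul_eq {P : MvPolynomial (Fin ℓ) (SymRing (2 * n))}
    (hP : P ∈ extPower (2 * n) ℓ) :
    ∃ c : BasisIndex n ℓ → SymRing (2 * n), coeffDet n ℓ • P = ∑ t, c t • basisElt t := by
  classical
  set p : BasisIndex n ℓ → SymRing (2 * n) := fun t => P.coeff (expEquiv n ℓ t).exponent with hp
  refine ⟨Matrix.vecMul p (coeffMatrix n ℓ).adjugate, ?_⟩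
  have hcz : CharZero (SymRing (2 * n)) := algebraRat.charZero _
  have hmem : coeffDet n ℓ • P - ∑ t, Matrix.vecMul p (coeffMatrix n ℓ).adjugate t • basisElt t ∈
      extPower (2 * n) ℓ := Submodule.sub_mem _ (Submodule.smul_mem _ _ hP)
    (Submodule.sum_mem _ fun t _ => Submodule.smul_mem _ _ (basisElt_mem_extPower t))
  rw [← sub_eq_zero]
  refine eq_zero_of_coeff_exponent_eq_zero hmem.1 hmem.2 fun s => ?_
  obtain ⟨t', rfl⟩ := (expEquiv n ℓ).surjective s
  have h : Matrix.vecMul (Matrix.vecMul p (coeffMatrix n ℓ).adjugate) (coeffMatrix n ℓ) =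
      coeffDet n ℓ • p := by
    rw [Matrix.vecMul_vecMul, Matrix.adjugate_mul, Matrix.vecMul_smul, Matrix.vecMul_one, coeffDet]
  have := congrFun h t'
  rw [Pi.smul_apply, Matrix.vecMul, dotProduct] at this
  rw [MvPolynomial.coeff_sub, MvPolynomial.coeff_smul, MvPolynomial.coeff_sum, sub_eq_zero]
  refine this.symm.trans (Finset.sum_congr rfl fun t _ => ?_)
  rw [MvPolynomial.coeff_smul, smul_eq_mul]
  rfl

end WedgeSpan

/-! ### Descent of divisibility along integral extensions. -/

/-- Divisibility descends along an injective integral extension of an integrally closed domain. -/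
theorem IsIntegrallyClosed.dvd_of_map_dvd {R S : Type*} [CommRing R] [IsDomain R]
    [IsIntegrallyClosed R] [CommRing S] [IsDomain S] [Algebra R S] [Algebra.IsIntegral R S]
    (hinj : Function.Injective (algebraMap R S)) {d a : R} (hd : d ≠ 0)
    (h : algebraMap R S d ∣ algebraMap R S a) : d ∣ a := by
  obtain ⟨q, hq⟩ := h
  let K := FractionRing R
  let L := FractionRing S
  have hL : Function.Injective (algebraMap R L) := by
    rw [IsScalarTower.algebraMap_eq R S L]
    exact (IsFractionRing.injective S L).comp hinj
  let f : K →ₐ[R] L := IsFractionRing.liftAlgHom (A := R) (R := R) (g := Algebra.ofId R L) hL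
  have hdK : algebraMap R K d ≠ 0 := fun h0 => hd (IsFractionRing.injective R K (by simpa using h0))
  have hdL : algebraMap R L d ≠ 0 := fun h0 => hd (hL (by simpa using h0))
  have hfq : f (algebraMap R K a / algebraMap R K d) = algebraMap S L q := by
    rw [map_div₀, AlgHom.commutes, AlgHom.commutes, div_eq_iff hdL,
      IsScalarTower.algebraMap_apply R S L, IsScalarTower.algebraMap_apply R S L, hq, map_mul,
      mul_comm]
  -- In the larger fraction field this quotient is the image of `q`, which is integral over `R`;
  -- hence it lies in `R`.
  have hint : IsIntegral R (algebraMap R K a / algebraMap R K d) := by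
    rw [← isIntegral_algHom_iff f f.toRingHom.injective, hfq]
    exact (Algebra.IsIntegral.isIntegral q).algebraMap
  obtain ⟨y, hy⟩ := IsIntegrallyClosed.isIntegral_iff.1 hint
  refine ⟨y, IsFractionRing.injective R K ?_⟩
  rw [map_mul, hy, mul_div_cancel₀ _ hdK]

/-! ### The embedding `psi` that splits `v_0`. -/

namespace WedgeSpan

open ExteriorAlgebra Polynomial

variable {n ℓ : ℕ}

/-- The polynomial ring in `ζ_1, …, ζ_n` and `u_1, …, u_n`. -/
abbrev WeightRing (n : ℕ) : Type := MvPolynomial (Fin n ⊕ Fin n) ℂ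

/-- The variable `ζ_i`. -/
def zeta (i : Fin n) : WeightRing n := MvPolynomial.X (Sum.inl i)

/-- The variables `u_s`, numbered from `0`. -/
def uVar (n : ℕ) (s : ℕ) : WeightRing n :=
  if h : s < n then MvPolynomial.X (Sum.inr ⟨s, h⟩) else 0

/-- The polynomial `∏ (1 - ζ_j² Y)`. -/
def evenPoly (n : ℕ) : (WeightRing n)[X] := ∏ j, (1 - Polynomial.C (zeta j ^ 2) * Polynomial.X)

/-- The homomorphism sending `e_{2s+1}` to `u_s` and `∑ e_{2j} Y^j` to `∏ (1 - ζ_j² Y)`. -/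
def psi (n : ℕ) : SymRing (2 * n) →ₐ[ℂ] WeightRing n :=
  SymRing.lift (2 * n) fun k => if k % 2 = 0 then (evenPoly n).coeff (k / 2) else uVar n (k / 2)

theorem evenPoly_coeff_zero : (evenPoly n).coeff 0 = 1 := by
  rw [Polynomial.coeff_zero_eq_eval_zero, evenPoly, Polynomial.eval_prod]
  simp

theorem natDegree_evenPoly_le : (evenPoly n).natDegree ≤ n := by
  refine (Polynomial.natDegree_prod_le _ _).trans ((Finset.sum_le_card_nsmul _ _ 1 fun j _ => ?_).trans
    (by simp))
  compute_degree

theorem psi_even {j : ℕ} (hj : j ≤ n) :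
    psi n (elemSym (2 * n) (2 * j)) = (evenPoly n).coeff j := by
  rcases Nat.eq_zero_or_pos j with rfl | h
  · rw [Nat.cast_zero, mul_zero, elemSym_zero, map_one, evenPoly_coeff_zero]
  · rw [show (2 * (j : ℤ)) = ((2 * j : ℕ) : ℤ) by push_cast; rfl, psi,
      SymRing.lift_elemSym _ (by omega) (by omega), if_pos (by omega)]
    congr 1; omega

theorem psi_odd {s : ℕ} (hs : s < n) :
    psi n (elemSym (2 * n) (2 * (s + 1 : ℕ) - 1)) = uVar n s := by
  rw [show (2 * ((s + 1 : ℕ) : ℤ) - 1) = ((2 * s + 1 : ℕ) : ℤ) by push_cast; ring, psi,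
    SymRing.lift_elemSym _ (by omega) (by omega), if_neg (by omega)]
  congr 1; omega

theorem map_psi_vZero : (vZero n).map (psi n : SymRing (2 * n) →+* WeightRing n) =
    ∏ j, (1 - Polynomial.C (zeta j ^ 2) * Polynomial.X ^ 2) := by
  have h := congrArg (fun p => Polynomial.aeval (Polynomial.X ^ 2 : (WeightRing n)[X]) p)
    ((evenPoly n).as_sum_range' (n + 1) (Nat.lt_succ_of_le natDegree_evenPoly_le))
  have h2 : Polynomial.aeval (Polynomial.X ^ 2 : (WeightRing n)[X]) (evenPoly n) =
      ∏ j, (1 - Polynomial.C (zeta j ^ 2) * Polynomial.X ^ 2) := by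
    rw [evenPoly, map_prod]
    refine Finset.prod_congr rfl fun j _ => ?_
    rw [map_sub, map_mul, map_one, Polynomial.aeval_C, Polynomial.aeval_X]
    rfl
  rw [← h2, h, vZero, Polynomial.map_sum, map_sum]
  refine Finset.sum_congr rfl fun j hj => ?_
  have hj' := Finset.mem_range.1 hj
  rw [Polynomial.map_mul, Polynomial.map_C, Polynomial.map_pow, Polynomial.map_X,
    Polynomial.aeval_monomial, ← pow_mul]
  congr 2
  exact psi_even (by omega)

theorem map_psi_vElt_one : (vElt n 1).map (psi n : SymRing (2 * n) →+* WeightRing n) =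
    ∑ s ∈ Finset.range n, Polynomial.C (uVar n s) * Polynomial.X ^ (2 * s) := by
  rw [vElt_eq, Polynomial.map_sum]
  refine Finset.sum_congr rfl fun s hs => ?_
  rw [Polynomial.map_mul, Polynomial.map_C, Polynomial.map_pow, Polynomial.map_X]
  congr 2
  exact psi_odd (Finset.mem_range.1 hs)

/-- The polynomial reciprocal to `∏ (1 - ζ_j² Y)` is monic with root `ζ_i²`. This is the integral
equation of `ζ_i` over the even elementary symmetric polynomials. -/
theorem sum_coeff_evenPoly_mul_zeta_pow (i : Fin n) :
    ∑ j ∈ Finset.range (n + 1), (evenPoly n).coeff j * zeta i ^ (2 * (n - j)) = 0 := by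
  let L := FractionRing (WeightRing n)
  have hinj := IsFractionRing.injective (WeightRing n) L
  have hz : algebraMap (WeightRing n) L (zeta i) ≠ 0 := fun h =>
    MvPolynomial.X_ne_zero (R := ℂ) (Sum.inl i : Fin n ⊕ Fin n)
      (hinj (h.trans (map_zero _).symm))
  set z := algebraMap (WeightRing n) L (zeta i)
  refine hinj ?_
  have h1 : Polynomial.aeval ((z ^ 2)⁻¹) (evenPoly n) = 0 := by
    rw [evenPoly, map_prod]
    refine Finset.prod_eq_zero (Finset.mem_univ i) ?_
    rw [map_sub, map_mul, map_one, Polynomial.aeval_C, Polynomial.aeval_X, map_pow,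
      mul_inv_cancel₀ (pow_ne_zero _ hz), sub_self]
  rw [(evenPoly n).as_sum_range' (n + 1) (Nat.lt_succ_of_le natDegree_evenPoly_le), map_sum] at h1
  rw [map_sum, map_zero, ← zero_mul (z ^ (2 * n)), ← h1, Finset.sum_mul]
  refine Finset.sum_congr rfl fun j hj => ?_
  have hj' := Finset.mem_range.1 hj
  rw [Polynomial.aeval_monomial, map_mul, map_pow, mul_assoc]
  congr 1
  rw [show 2 * n = 2 * j + 2 * (n - j) by omega, pow_add, ← mul_assoc, pow_mul z 2 j, ← mul_pow,
    inv_mul_cancel₀ (pow_ne_zero _ hz), one_pow, one_mul]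

theorem psi_isIntegral (n : ℕ) : (psi n : SymRing (2 * n) →+* WeightRing n).IsIntegral := by
  let := (psi n : SymRing (2 * n) →+* WeightRing n).toAlgebra
  intro x
  change IsIntegral (SymRing (2 * n)) x
  have hmem : ∀ c : SymRing (2 * n), IsIntegral (SymRing (2 * n)) (psi n c) := fun c =>
    isIntegral_algebraMap (x := c)
  induction x using MvPolynomial.induction_on with
  | C a =>
    have := hmem (algebraMap ℂ _ a)
    rwa [AlgHom.commutes] at this
  | add p q hp hq => exact hp.add hq
  | mul_X p v hp =>
    refine hp.mul ?_
    rcases v with i | s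
    · refine ⟨∑ j ∈ Finset.range (n + 1), Polynomial.C (elemSym (2 * n) (2 * j)) *
        Polynomial.X ^ (2 * (n - j)), ?_, ?_⟩
      · rw [Finset.sum_range_succ', Nat.cast_zero, mul_zero, elemSym_zero, map_one, one_mul,
          Nat.sub_zero, add_comm]
        refine Polynomial.monic_X_pow_add ?_
        rw [← Polynomial.mem_degreeLT]
        refine Submodule.sum_mem _ fun k hk => ?_
        rw [Polynomial.mem_degreeLT]
        refine lt_of_le_of_lt (Polynomial.degree_C_mul_X_pow_le _ _) ?_
        have := Finset.mem_range.1 hk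
        exact_mod_cast (by omega : 2 * (n - (k + 1)) < 2 * n)
      · rw [Polynomial.eval₂_finsetSum, ← sum_coeff_evenPoly_mul_zeta_pow i]
        refine Finset.sum_congr rfl fun j hj => ?_
        have hj' := Finset.mem_range.1 hj
        rw [Polynomial.eval₂_mul, Polynomial.eval₂_C, Polynomial.eval₂_X_pow]
        congr 1
        exact psi_even (by omega)
    · have := hmem (elemSym (2 * n) (2 * ((s : ℕ) + 1 : ℕ) - 1))
      rw [psi_odd s.isLt, uVar, dif_pos s.isLt] at this
      exact this

/-- The `2n` images of the generators have the ring of weights as an integral extension, and that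
ring has transcendence degree `2n`; so they are algebraically independent. -/
theorem psi_injective (n : ℕ) : Function.Injective (psi n) := by
  let x : Fin (2 * n) → WeightRing n := fun k => psi n (SymRing.equiv (2 * n) (MvPolynomial.X k))
  have hx : (psi n).comp (SymRing.equiv (2 * n)).toAlgHom = MvPolynomial.aeval x :=
    MvPolynomial.algHom_ext fun k => by rw [MvPolynomial.aeval_X]; rfl
  have hmem : ∀ r, psi n r ∈ Algebra.adjoin ℂ (Set.range x) := fun r => by
    rw [Algebra.adjoin_range_eq_range_aeval, ← hx]
    exact ⟨(SymRing.equiv (2 * n)).symm r, congrArg (psi n) ((SymRing.equiv (2 * n)).apply_symm_apply r)⟩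
  have hint : (algebraMap (Algebra.adjoin ℂ (Set.range x)) (WeightRing n)).IsIntegral :=
    RingHom.IsIntegral.tower_top ((psi n).codRestrict _ hmem).toRingHom _ (psi_isIntegral n)
  have : Algebra.IsIntegral (Algebra.adjoin ℂ (Set.range x)) (WeightRing n) := ⟨hint⟩
  have hb := Algebra.IsAlgebraic.isTranscendenceBasis_of_le_trdeg_of_finite ℂ x (by
    rw [MvPolynomial.trdeg_of_isDomain]; simp [two_mul])
  have hinj : Function.Injective (MvPolynomial.aeval x) := hb.1
  rw [← hx] at hinj
  intro a b hab
  have := @hinj ((SymRing.equiv (2 * n)).symm a) ((SymRing.equiv (2 * n)).symm b) (by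
    simpa using hab)
  exact (SymRing.equiv (2 * n)).symm.injective this

end WedgeSpan

/-! ### Coprimality to the denominators, and divisibility by the weights. -/

theorem MvPolynomial.irreducible_X_add_C_mul_X {σ K : Type*} [Field K] {v w : σ} (h : v ≠ w)
    (c : K) : Irreducible (X v + C c * X w : MvPolynomial σ K) := by
  classical
  have hc : (X v + C c * X w : MvPolynomial σ K).coeff (Finsupp.single v 1) = 1 := by
    rw [coeff_add, coeff_C_mul, coeff_X, coeff_X, if_pos rfl, if_neg, mul_zero, add_zero]
    exact fun h' => h (Finsupp.single_left_injective one_ne_zero h').symm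
  refine irreducible_of_totalDegree_eq_one (le_antisymm ?_ ?_) fun x hx => ?_
  · refine (totalDegree_add _ _).trans (max_le (totalDegree_X _).le ?_)
    exact (totalDegree_mul _ _).trans (by simp)
  · have := le_totalDegree (mem_support_iff.2 (hc.symm ▸ one_ne_zero : _ ≠ (0 : K)))
    simpa using this
  · have := hx (Finsupp.single v 1)
    rw [hc] at this
    exact isUnit_of_dvd_one this

namespace WedgeSpan

open ExteriorAlgebra Polynomial

variable {n ℓ : ℕ}

/-- The specialization `ζ_i ↦ 0`, `u_n ↦ 1` and `u_s ↦ 0` for the other `s`. -/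
def eps (n : ℕ) : WeightRing n →ₐ[ℂ] ℂ :=
  MvPolynomial.aeval (Sum.elim (fun _ => 0) fun s => if (s : ℕ) + 1 = n then 1 else 0)

theorem eps_zeta (i : Fin n) : eps n (zeta i) = 0 := by
  rw [eps, zeta, MvPolynomial.aeval_X, Sum.elim_inl]

theorem eps_coeff_evenPoly {j : ℕ} (hj : j ≠ 0) : eps n ((evenPoly n).coeff j) = 0 := by
  have h : (evenPoly n).map (eps n : WeightRing n →+* ℂ) = 1 := by
    rw [evenPoly, Polynomial.map_prod]
    refine Finset.prod_eq_one fun i _ => ?_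
    have h0 : (eps n : WeightRing n →+* ℂ) (zeta i ^ 2) = 0 := by
      rw [map_pow]
      exact (congrArg (· ^ 2) (eps_zeta i)).trans (zero_pow two_ne_zero)
    rw [Polynomial.map_sub, Polynomial.map_one, Polynomial.map_mul, Polynomial.map_C, h0, map_zero,
      zero_mul, sub_zero]
  have := congrArg (fun p => Polynomial.coeff p j) h
  simpa [Polynomial.coeff_map, Polynomial.coeff_one, hj] using this

/-- The point where the determinant is nonzero thus lifts to one with all `ζ_i = 0`, which is where
every factor of `denom` vanishes. -/
theorem eps_comp_psi (n : ℕ) : (eps n).comp (psi n) = nilHom n 0 := by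
  refine SymRing.hom_ext fun k h1 hk => ?_
  rw [nilHom, SymRing.lift_elemSym _ h1 hk, AlgHom.comp_apply, psi, SymRing.lift_elemSym _ h1 hk]
  split_ifs with h2 h3 h3 h3 h3
  · omega
  · rw [eps_coeff_evenPoly (by omega), neg_zero]
  · exact eps_coeff_evenPoly (by omega)
  · rw [uVar, dif_pos (by omega), eps, MvPolynomial.aeval_X, Sum.elim_inr, if_pos (by
      dsimp only; omega)]
  · omega
  · rw [uVar, dif_pos (by omega), eps, MvPolynomial.aeval_X, Sum.elim_inr, if_neg (by
      dsimp only; omega)]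

/-- The product of the `ζ_i` and of the `ζ_i² - ζ_j²`. -/
def denom (n : ℕ) : WeightRing n :=
  (∏ i, zeta i) * ∏ i, ∏ j ∈ Finset.univ.erase i, (zeta i ^ 2 - zeta j ^ 2)

/-- The factor `denom` is a product of the irreducible linear forms `ζ_i`, `ζ_i + ζ_j` and `ζ_i -
ζ_j`. All of them are killed by `eps`, so none divides `D`. -/
theorem isRelPrime_denom {D : WeightRing n} (hD : eps n D ≠ 0) : IsRelPrime D (denom n) := by
  have key : ∀ (i : Fin n) (w : Fin n ⊕ Fin n) (c : ℂ), Sum.inl i ≠ w →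
      eps n (MvPolynomial.C c * MvPolynomial.X w) = 0 →
      IsRelPrime D (zeta i + MvPolynomial.C c * MvPolynomial.X w) := by
    intro i w c h h0
    refine ((MvPolynomial.irreducible_X_add_C_mul_X h c).isRelPrime_iff_not_dvd.2 ?_).symm
    rintro ⟨q, rfl⟩
    refine hD ?_
    rw [map_mul, map_add, h0]
    simp [eps]
  refine IsRelPrime.mul_right (IsRelPrime.prod_right fun i _ => ?_)
    (IsRelPrime.prod_right fun i _ => IsRelPrime.prod_right fun j hj => ?_)
  -- With coefficient zero the linear form is `ζ_i` itself; the second variable is a dummy.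
  · have := key i (Sum.inr i) 0 (by simp) (by simp)
    simpa using this
  · have hij : i ≠ j := (Finset.ne_of_mem_erase hj).symm
    have hz : eps n (MvPolynomial.X (Sum.inl j)) = 0 := eps_zeta j
    have h1 := key i (Sum.inl j) 1 (by simpa using hij) (by simp [hz])
    have h2 := key i (Sum.inl j) (-1) (by simpa using hij) (by simp [hz])
    have : zeta i ^ 2 - zeta j ^ 2 = (zeta i + MvPolynomial.C 1 * MvPolynomial.X (Sum.inl j)) *
        (zeta i + MvPolynomial.C (-1) * MvPolynomial.X (Sum.inl j)) := by
      rw [map_neg, MvPolynomial.C_1]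
      simp only [zeta]
      ring
    rw [this]
    exact h1.mul_right h2

theorem dvd_of_psi_dvd {d a : SymRing (2 * n)} (hd : nilHom n 0 d ≠ 0) (m : ℕ)
    (h : psi n d ∣ denom n ^ m * psi n a) : d ∣ a := by
  have h' : psi n d ∣ psi n a := by
    refine IsRelPrime.dvd_of_dvd_mul_left ((isRelPrime_denom ?_).pow_right) h
    rwa [← AlgHom.comp_apply, eps_comp_psi]
  let := (psi n : SymRing (2 * n) →+* WeightRing n).toAlgebra
  have : Algebra.IsIntegral (SymRing (2 * n)) (WeightRing n) := ⟨psi_isIntegral n⟩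
  refine IsIntegrallyClosed.dvd_of_map_dvd (S := WeightRing n) (psi_injective n) ?_ h'
  rintro rfl
  exact hd (map_zero _)

/-- The weight `∑ u_s ζ_i^{2(n-1-s)}`, the numerator of the value at `ζ_i⁻¹` of the image
of `v_1`. -/
def weight (i : Fin n) : WeightRing n :=
  ∑ s ∈ Finset.range n, uVar n s * zeta i ^ (2 * (n - 1 - s))

/-- The endomorphism of the ring of weights with kernel generated by the `i`-th weight. -/
def theta (i : Fin n) : WeightRing n →ₐ[ℂ] WeightRing n :=
  MvPolynomial.aeval (Sum.elim zeta fun s =>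
    if (s : ℕ) + 1 = n then uVar n s - weight i else uVar n s)

theorem theta_zeta (i j : Fin n) : theta i (zeta j) = zeta j := by
  rw [theta, zeta, MvPolynomial.aeval_X, Sum.elim_inl, zeta]

theorem theta_uVar (i : Fin n) {s : ℕ} (hs : s < n) :
    theta i (uVar n s) = uVar n s - if s + 1 = n then weight i else 0 := by
  rw [uVar, dif_pos hs, theta, MvPolynomial.aeval_X, Sum.elim_inr]
  dsimp only
  rw [uVar, dif_pos hs]
  split_ifs
  · rfl
  · rw [sub_zero]

/-- The last `u_s`, with `s = n - 1`, occurs in every weight with coefficient one, and it is the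
only variable that `theta i` moves. -/
theorem theta_weight (i j : Fin n) : theta i (weight j) = weight j - weight i := by
  have hn := i.pos
  conv_lhs => rw [weight]
  rw [map_sum]
  have : ∀ s ∈ Finset.range n, theta i (uVar n s * zeta j ^ (2 * (n - 1 - s))) =
      uVar n s * zeta j ^ (2 * (n - 1 - s)) - if s = n - 1 then weight i else 0 := by
    intro s hs
    have hs' := Finset.mem_range.1 hs
    rw [map_mul, map_pow, theta_zeta, theta_uVar i hs', sub_mul]
    congr 1
    by_cases h : s = n - 1
    · rw [if_pos (by omega), if_pos h, h]; simp
    · rw [if_neg (by omega), if_neg h, zero_mul]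
  rw [Finset.sum_congr rfl this, Finset.sum_sub_distrib, Finset.sum_ite_eq',
    if_pos (Finset.mem_range.2 (by omega))]
  rfl

theorem weight_injective : Function.Injective (weight : Fin n → WeightRing n) := by
  intro i j h
  by_contra hij
  have hn : 2 ≤ n := by
    have := i.isLt; have := j.isLt
    by_contra hn
    exact hij (Fin.ext (by omega))
  -- A point that separates the weights: only `ζ_i` and `u_0` are one, all other variables zero. The
  -- exponent `2(n - 1)` of `ζ` next to `u_0` is positive because `n ≥ 2`.
  let f : WeightRing n →ₐ[ℂ] ℂ := MvPolynomial.aeval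
    (Sum.elim (fun k => if k = i then 1 else 0) fun s => if (s : ℕ) = 0 then 1 else 0)
  have hf : ∀ k, f (weight k) = if k = i then 1 else 0 := fun k => by
    have hu : ∀ s < n, f (uVar n s) = if s = 0 then 1 else 0 := fun s hs => by
      rw [uVar, dif_pos hs, MvPolynomial.aeval_X, Sum.elim_inr]
    have hz : f (zeta k) = if k = i then 1 else 0 := by
      rw [zeta, MvPolynomial.aeval_X, Sum.elim_inl]
    rw [weight, map_sum, Finset.sum_eq_single 0]
    · rw [map_mul, map_pow, hu 0 (by omega), if_pos rfl, one_mul, hz]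
      split_ifs
      · rw [one_pow]
      · rw [zero_pow (by omega)]
    · intro s hs h0
      rw [map_mul, hu s (Finset.mem_range.1 hs), if_neg h0, zero_mul]
    · intro h0
      exact absurd (Finset.mem_range.2 (by omega)) h0
  have := congrArg f h
  rw [hf, hf, if_pos rfl, if_neg (Ne.symm hij)] at this
  exact one_ne_zero this

theorem weight_dvd_sub_theta (i : Fin n) (f : WeightRing n) : weight i ∣ f - theta i f := by
  rw [← Ideal.mem_span_singleton, ← Ideal.Quotient.eq]
  have : (Ideal.Quotient.mkₐ ℂ (Ideal.span {weight i})) =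
      (Ideal.Quotient.mkₐ ℂ (Ideal.span {weight i})).comp (theta i) := by
    refine MvPolynomial.algHom_ext fun v => ?_
    rcases v with j | s
    · exact congrArg _ (theta_zeta i j).symm
    · have hs := theta_uVar i s.isLt
      rw [uVar, dif_pos s.isLt] at hs
      rw [AlgHom.comp_apply]
      erw [hs]
      rw [map_sub]
      refine (sub_eq_self.2 ?_).symm
      split_ifs
      · exact Ideal.Quotient.eq_zero_iff_mem.2 (Ideal.mem_span_singleton_self _)
      · exact map_zero _
  exact DFunLike.congr_fun this f

/-- An element killed by `theta i` is a multiple of `weight i`. Other weights have nonzero image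
under `theta i`, so they can be divided out one after another. -/
theorem prod_weight_dvd {f : WeightRing n} (T : Finset (Fin n)) (h : ∀ i ∈ T, theta i f = 0) :
    ∏ i ∈ T, weight i ∣ f := by
  classical
  induction T using Finset.induction_on with
  | empty => simp
  | insert i T hi ih =>
    obtain ⟨g, hg⟩ := ih fun j hj => h j (Finset.mem_insert_of_mem hj)
    have h0 := h i (Finset.mem_insert_self i T)
    rw [hg, map_mul, map_prod] at h0
    have h1 : theta i g = 0 := by
      refine (mul_eq_zero.1 h0).resolve_left (Finset.prod_ne_zero_iff.2 fun j hj => ?_)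
      rw [theta_weight, sub_ne_zero]
      exact fun h => hi (weight_injective h ▸ hj)
    have h2 := weight_dvd_sub_theta i g
    rw [h1, sub_zero] at h2
    rw [Finset.prod_insert hi, hg, mul_comm]
    exact mul_dvd_mul_left _ h2

end WedgeSpan

/-! ### Vanishing of solutions at common zeros of `v_0` and `v_1`. -/

theorem Polynomial.Monic.exists_eq_prod_X_add_C {K : Type*} [Field K] [IsAlgClosed K] (m : ℕ)
    {p : Polynomial K} (hp : p.Monic) (hm : p.natDegree = m) :
    ∃ y : Fin m → K, p = ∏ j, (Polynomial.X + Polynomial.C (y j)) := by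
  induction m generalizing p with
  | zero => exact ⟨Fin.elim0, by simpa using hp.natDegree_eq_zero.1 hm⟩
  | succ m ih =>
    obtain ⟨r, hr⟩ := IsAlgClosed.exists_root p (by
      rw [Polynomial.degree_eq_natDegree hp.ne_zero, hm]; exact_mod_cast Nat.succ_ne_zero m)
    obtain ⟨q, hq⟩ := Polynomial.dvd_iff_isRoot.2 hr
    have hq' : q.Monic := (Polynomial.monic_X_sub_C r).of_mul_monic_left (hq ▸ hp)
    obtain ⟨y, hy⟩ := ih hq' (by
      rw [hq, (Polynomial.monic_X_sub_C r).natDegree_mul hq', Polynomial.natDegree_X_sub_C] at hm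
      omega)
    refine ⟨Fin.cons (-r) y, ?_⟩
    rw [Fin.prod_univ_succ, Fin.cons_zero]
    simp only [Fin.cons_succ]
    rw [← hy, hq, map_neg, sub_eq_add_neg]

namespace WedgeSpan

open ExteriorAlgebra Polynomial

variable {n ℓ : ℕ} {K : Type*} [Field K] [Algebra ℂ K]

omit [Algebra ℂ K] in
theorem eval_neg_map_vZero (φ : SymRing (2 * n) →+* K) (u : K) :
    ((vZero n).map φ).eval (-u) = ((vZero n).map φ).eval u := by
  simp [vZero, Polynomial.eval_finsetSum, Polynomial.map_sum, pow_mul]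

omit [Algebra ℂ K] in
theorem eval_neg_map_vElt (φ : SymRing (2 * n) →+* K) (r : ℕ) (u : K) :
    ((vElt n r).map φ).eval (-u) = ((vElt n r).map φ).eval u := by
  simp [vElt, Polynomial.eval_finsetSum, Polynomial.map_sum, pow_mul]

/-- The monic polynomial with coefficients `φ(e_k)` equals `t^(2n) (v_0 + w_1)(t⁻¹)`, so by parity
both `z` and `-z` are roots. The remaining factor of degree `2n - 2` splits and supplies `y`. -/
theorem exists_elemSym_eq [IsAlgClosed K] (hn : 0 < n) (φ : SymRing (2 * n) →+* K) {z : K}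
    (hz : z ≠ 0) (h0 : ((vZero n).map φ).eval z⁻¹ = 0) (h1 : ((vElt n 1).map φ).eval z⁻¹ = 0) :
    ∃ y : Fin (2 * n - 2) → K, ∀ k ≤ 2 * n, φ (elemSym (2 * n) (k : ℕ)) =
      ∑ s ∈ Finset.powersetCard k (Finset.univ : Finset (Fin (2 * n))),
        ∏ j ∈ s, if h : (j : ℕ) < 2 * n - 2 then y ⟨j, h⟩ else if (j : ℕ) + 2 = 2 * n then z
          else -z := by
  set g : K[X] := ∑ k ∈ Finset.range (2 * n + 1),
    Polynomial.C (φ (elemSym (2 * n) (k : ℕ))) * Polynomial.X ^ (2 * n - k) with hg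
  have hcz : CharZero K := charZero_of_injective_algebraMap (algebraMap ℂ K).injective
  have hgcoeff : ∀ k ≤ 2 * n, g.coeff (2 * n - k) = φ (elemSym (2 * n) (k : ℕ)) := by
    intro k hk
    rw [hg, Polynomial.finsetSum_coeff, Finset.sum_eq_single k]
    · rw [Polynomial.coeff_C_mul_X_pow, if_pos rfl]
    · intro j hj hjk
      have := Finset.mem_range.1 hj
      rw [Polynomial.coeff_C_mul_X_pow, if_neg (by omega)]
    · intro h
      exact absurd (Finset.mem_range.2 (by omega)) h
  have hgmonic : g.Monic ∧ g.natDegree = 2 * n := by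
    have hlt : (∑ k ∈ Finset.range (2 * n), Polynomial.C (φ (elemSym (2 * n) (k + 1 : ℕ))) *
        Polynomial.X ^ (2 * n - (k + 1)) : K[X]).degree < (2 * n : ℕ) := by
      rw [← Polynomial.mem_degreeLT]
      refine Submodule.sum_mem _ fun k hk => ?_
      rw [Polynomial.mem_degreeLT]
      refine lt_of_le_of_lt (Polynomial.degree_C_mul_X_pow_le _ _) ?_
      have := Finset.mem_range.1 hk
      exact_mod_cast (by omega : 2 * n - (k + 1) < 2 * n)
    have hge : g = Polynomial.X ^ (2 * n) + ∑ k ∈ Finset.range (2 * n),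
        Polynomial.C (φ (elemSym (2 * n) (k + 1 : ℕ))) * Polynomial.X ^ (2 * n - (k + 1)) := by
      rw [hg, Finset.sum_range_succ', Nat.cast_zero, elemSym_zero, map_one, map_one, one_mul,
        Nat.sub_zero, add_comm]
    rw [hge]
    exact ⟨Polynomial.monic_X_pow_add hlt, Polynomial.natDegree_eq_of_degree_eq_some (by
      rw [Polynomial.degree_add_eq_left_of_degree_lt (by rwa [Polynomial.degree_X_pow]),
        Polynomial.degree_X_pow])⟩
  have hgeval : ∀ t : K, t ≠ 0 → g.eval t =
      t ^ (2 * n) * ((vZero n + wElt n 1).map φ).eval t⁻¹ := by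
    intro t ht
    rw [hg, Polynomial.eval_finsetSum, vZero_add_wElt_one, Polynomial.map_sum,
      Polynomial.eval_finsetSum, Finset.mul_sum]
    refine Finset.sum_congr rfl fun k hk => ?_
    have hk' := Finset.mem_range.1 hk
    have : t ^ (2 * n) * (t⁻¹) ^ k = t ^ (2 * n - k) := by
      rw [inv_pow, ← div_eq_mul_inv, div_eq_iff (pow_ne_zero _ ht), ← pow_add]
      congr 1; omega
    simp only [Polynomial.eval_mul, Polynomial.eval_C, Polynomial.eval_pow, Polynomial.eval_X,
      Polynomial.map_mul, Polynomial.map_C, Polynomial.map_pow, Polynomial.map_X]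
    rw [← this]; ring
  have hgz : g.IsRoot z := by
    rw [Polynomial.IsRoot, hgeval z hz, wElt, Polynomial.map_add, Polynomial.map_mul,
      Polynomial.eval_add, Polynomial.eval_mul, h0, h1]
    ring
  have hgz' : g.IsRoot (-z) := by
    rw [Polynomial.IsRoot, hgeval _ (neg_ne_zero.2 hz), wElt, Polynomial.map_add,
      Polynomial.map_mul, Polynomial.eval_add, Polynomial.eval_mul, inv_neg, eval_neg_map_vZero,
      eval_neg_map_vElt, h0, h1]
    ring
  obtain ⟨g₁, hg₁⟩ := Polynomial.dvd_iff_isRoot.2 hgz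
  have hg₁z : g₁.IsRoot (-z) := by
    rw [Polynomial.IsRoot, hg₁, Polynomial.eval_mul] at hgz'
    refine (mul_eq_zero.1 hgz').resolve_left ?_
    rw [Polynomial.eval_sub, Polynomial.eval_X, Polynomial.eval_C, ← neg_add', neg_eq_zero,
      ← two_mul]
    exact mul_ne_zero two_ne_zero hz
  obtain ⟨h, hh⟩ := Polynomial.dvd_iff_isRoot.2 hg₁z
  have hg₁m : g₁.Monic := (Polynomial.monic_X_sub_C z).of_mul_monic_left (hg₁ ▸ hgmonic.1)
  have hhm : h.Monic := (Polynomial.monic_X_sub_C (-z)).of_mul_monic_left (hh ▸ hg₁m)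
  obtain ⟨y, hy⟩ := Polynomial.Monic.exists_eq_prod_X_add_C (2 * n - 2) hhm (by
    have := hgmonic.2
    rw [hg₁, (Polynomial.monic_X_sub_C z).natDegree_mul hg₁m, hh,
      (Polynomial.monic_X_sub_C (-z)).natDegree_mul hhm, Polynomial.natDegree_X_sub_C,
      Polynomial.natDegree_X_sub_C] at this
    omega)
  refine ⟨y, fun k hk => ?_⟩
  set x : ℕ → K := fun j => if h : j < 2 * n - 2 then y ⟨j, h⟩ else if j + 2 = 2 * n then z else -z
    with hx
  have hgx : g = ∏ j : Fin (2 * n), (Polynomial.X + Polynomial.C (x j)) := by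
    rw [← Finset.prod_range (fun j => Polynomial.X + Polynomial.C (x j)),
      show 2 * n = 2 * n - 2 + 1 + 1 by omega, Finset.prod_range_succ, Finset.prod_range_succ,
      Finset.prod_range (fun j => Polynomial.X + Polynomial.C (x j))]
    have e1 : x (2 * n - 2) = z := by
      rw [hx]; dsimp only; rw [dif_neg (by omega), if_pos (by omega)]
    have e2 : x (2 * n - 2 + 1) = -z := by
      rw [hx]; dsimp only; rw [dif_neg (by omega), if_neg (by omega)]
    have e3 : ∀ j : Fin (2 * n - 2), x j = y j := fun j => by
      rw [hx]; dsimp only; rw [dif_pos j.isLt]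
    simp only [e1, e2, e3, ← hy]
    rw [hg₁, hh, map_neg]; ring
  rw [← hgcoeff k hk, hgx, Finset.prod_X_add_C_coeff _ _ (by simp), Finset.card_univ,
    Fintype.card_fin, Nat.sub_sub_self hk]

/-- Evaluating the remaining variables at `y` and `x` at `z` reproduces `φ` on all `e_k`, hence
everywhere: such a `φ` factors through the substitution `bar`. -/
theorem exists_comp_bar_eq [IsAlgClosed K] (hn : 0 < n) (φ : SymRing (2 * n) →ₐ[ℂ] K) {z : K}
    (hz : z ≠ 0) (h0 : ((vZero n).map (φ : SymRing (2 * n) →+* K)).eval z⁻¹ = 0)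
    (h1 : ((vElt n 1).map (φ : SymRing (2 * n) →+* K)).eval z⁻¹ = 0) :
    ∃ ev : LaurentRing (2 * n) →+* K, (∀ f, ev (bar (2 * n) f) = φ f) ∧
      ev (LaurentPolynomial.T (-1)) = z⁻¹ := by
  obtain ⟨y, hy⟩ := exists_elemSym_eq hn (φ : SymRing (2 * n) →+* K) hz h0 h1
  let ev : LaurentRing (2 * n) →+* K :=
    LaurentPolynomial.eval₂ (MvPolynomial.aeval y : MvPolynomial (Fin (2 * n - 2)) ℂ →ₐ[ℂ] K)
      (Units.mk0 z hz)
  have hT : ∀ k : ℤ, ev (LaurentPolynomial.T k) = z ^ k := fun k =>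
    (LaurentPolynomial.eval₂_T _ _ k).trans (by simp)
  have hC : ∀ p, ev (LaurentPolynomial.C p) = MvPolynomial.aeval y p := fun p =>
    LaurentPolynomial.eval₂_C _ _ p
  have hvar : ∀ j : Fin (2 * n), ev (barVar (2 * n) j) =
      if h : (j : ℕ) < 2 * n - 2 then y ⟨j, h⟩ else if (j : ℕ) + 2 = 2 * n then z else -z := by
    intro j
    rw [barVar]
    split_ifs
    · rw [hC, MvPolynomial.aeval_X]
    · rw [hT, zpow_one]
    · rw [map_neg, hT, zpow_one]
  let F : SymRing (2 * n) →ₐ[ℂ] K := ⟨ev.comp (bar (2 * n)), fun c => by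
    change ev (bar (2 * n) (algebraMap ℂ (SymRing (2 * n)) c)) = _
    rw [bar_apply, show SymRing.toPoly (2 * n) (algebraMap ℂ (SymRing (2 * n)) c) =
      algebraMap ℂ _ c from rfl, AlgHom.commutes]
    exact (hC (MvPolynomial.C c)).trans (MvPolynomial.aeval_C _ _)⟩
  have hF : F = φ := SymRing.hom_ext fun k _ hk => by
    change ev (bar (2 * n) (elemSym (2 * n) k)) = _
    refine Eq.trans ?_ (hy k hk).symm
    rw [bar_apply, toPoly_elemSym, esymm, map_sum, map_sum]
    refine Finset.sum_congr rfl fun s _ => ?_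
    rw [map_prod, map_prod]
    refine Finset.prod_congr rfl fun j _ => ?_
    rw [MvPolynomial.aeval_X, hvar]
  exact ⟨ev, fun f => DFunLike.congr_fun hF f, by rw [hT, zpow_neg, zpow_one]⟩

/-- The evaluation factors through `ρ_ε` when the distinguished variable is the last one;
antisymmetry moves it there at the cost of a sign. -/
theorem eval_map_eq_zero_of_mem_solutionModule [IsAlgClosed K] (hn : 0 < n)
    (φ : SymRing (2 * n) →ₐ[ℂ] K) {z : K} (hz : z ≠ 0)
    (h0 : ((vZero n).map (φ : SymRing (2 * n) →+* K)).eval z⁻¹ = 0)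
    (h1 : ((vElt n 1).map (φ : SymRing (2 * n) →+* K)).eval z⁻¹ = 0)
    {P : MvPolynomial (Fin ℓ) (SymRing (2 * n))} (hP : P ∈ solutionModule (2 * n) ℓ)
    (x : Fin ℓ → K) (a : Fin ℓ) (ε : ℤˣ) (hxa : x a = ((ε : ℤ) : K) * z⁻¹) :
    MvPolynomial.eval x (MvPolynomial.map (φ : SymRing (2 * n) →+* K) P) = 0 := by
  obtain ⟨ev, hev, hT⟩ := exists_comp_bar_eq hn φ hz h0 h1
  obtain ⟨hPe, hPs⟩ := hP
  cases ℓ with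
  | zero => exact a.elim0
  | succ m =>
    have hrho : rho (2 * n) ε P = 0 := by
      rcases Int.units_eq_one_or ε with rfl | rfl
      exacts [hPs.1, hPs.2]
    have hlast : ∀ x : Fin (m + 1) → K, x (Fin.last m) = ((ε : ℤ) : K) * z⁻¹ →
        MvPolynomial.eval x (MvPolynomial.map (φ : SymRing (2 * n) →+* K) P) = 0 := by
      intro x hx
      have hcomp : ((MvPolynomial.eval (x ∘ Fin.castSucc)).comp (MvPolynomial.map ev)).comp
          (rho (2 * n) ε) = (MvPolynomial.eval x).comp
            (MvPolynomial.map (φ : SymRing (2 * n) →+* K)) := by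
        refine MvPolynomial.ringHom_ext (fun c => ?_) fun i => ?_
        · simp [rho, hev]
        · have hr : rho (2 * n) ε (MvPolynomial.X i) = rhoVar (2 * n) m ε i := by
            simp [rho, rhoVar]
          rw [RingHom.comp_apply, hr]
          induction i using Fin.lastCases with
          | last => simp [rhoVar_last, hT, hx]
          | cast i => simp [rhoVar_castSucc]
      have := DFunLike.congr_fun hcomp P
      rw [RingHom.comp_apply, hrho, map_zero] at this
      exact this.symm
    have h2 := hlast (x ∘ Equiv.swap a (Fin.last m)) (by simp [hxa])
    have h3 := hPe.1 (Equiv.swap a (Fin.last m))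
    have h4 := congrArg (fun Q => MvPolynomial.eval x
      (MvPolynomial.map (φ : SymRing (2 * n) →+* K) Q)) h3
    rw [MvPolynomial.map_rename, MvPolynomial.eval_rename, h2, map_zsmul, map_zsmul] at h4
    rcases Int.units_eq_one_or (Equiv.Perm.sign (Equiv.swap a (Fin.last m))) with h | h
    · rw [h] at h4; simpa using h4.symm
    · rw [h] at h4; simpa using h4.symm

end WedgeSpan

/-! ### Spanning over the localization, descent to `R`, and the basis. -/

namespace WedgeSpan

open ExteriorAlgebra Polynomial

variable {n ℓ : ℕ}

theorem zeta_ne_zero (i : Fin n) : zeta i ≠ 0 := MvPolynomial.X_ne_zero _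

theorem zeta_sq_sub_zeta_sq_ne_zero {i j : Fin n} (h : i ≠ j) : zeta i ^ 2 - zeta j ^ 2 ≠ 0 := by
  intro h0
  have := congrArg (MvPolynomial.aeval (R := ℂ) (S₁ := ℂ)
    (Sum.elim (fun k => if k = i then 1 else 0) fun _ => 0)) h0
  simp [zeta, h.symm] at this

theorem denom_ne_zero (n : ℕ) : denom n ≠ 0 :=
  mul_ne_zero (Finset.prod_ne_zero_iff.2 fun i _ => zeta_ne_zero i)
    (Finset.prod_ne_zero_iff.2 fun _ _ => Finset.prod_ne_zero_iff.2 fun _ hj =>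
      zeta_sq_sub_zeta_sq_ne_zero (Finset.ne_of_mem_erase hj).symm)

theorem zeta_dvd_denom (i : Fin n) : zeta i ∣ denom n :=
  (Finset.dvd_prod_of_mem _ (Finset.mem_univ i)).mul_right _

theorem zeta_sq_sub_zeta_sq_dvd_denom {i j : Fin n} (h : i ≠ j) :
    zeta i ^ 2 - zeta j ^ 2 ∣ denom n :=
  ((Finset.dvd_prod_of_mem (fun j => zeta i ^ 2 - zeta j ^ 2)
    (Finset.mem_erase.2 ⟨h.symm, Finset.mem_univ j⟩)).trans
    (Finset.dvd_prod_of_mem (fun i => ∏ j ∈ Finset.univ.erase i, (zeta i ^ 2 - zeta j ^ 2))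
      (Finset.mem_univ i))).mul_left _

theorem theta_denom (i : Fin n) : theta i (denom n) = denom n := by
  simp only [denom, map_mul, map_prod, map_sub, map_pow, theta_zeta]

/-- This links `weight i` to `v_1(ζ_i⁻¹)`, from which it differs by a power of `ζ_i`. -/
theorem sum_map_uVar_mul_inv_pow {K : Type*} [CommRing K] (f : WeightRing n →+* K) (i : Fin n)
    {u : K} (hu : f (zeta i) * u = 1) :
    ∑ s ∈ Finset.range n, f (uVar n s) * u ^ (2 * s) = f (weight i) * u ^ (2 * (n - 1)) := by
  rw [weight, map_sum, Finset.sum_mul]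
  refine Finset.sum_congr rfl fun s hs => ?_
  have hs' := Finset.mem_range.1 hs
  rw [map_mul, map_pow, show 2 * (n - 1) = 2 * (n - 1 - s) + 2 * s by omega, pow_add, mul_assoc,
    ← mul_assoc (f (zeta i) ^ _), ← mul_pow, hu, one_pow, one_mul]

section Localization

variable {B : Type*} [CommRing B] [Algebra (WeightRing n) B] [IsLocalization.Away (denom n) B]

/-- The values at the points `± ζ_i⁻¹` of an element of `U` are divisible by the weights. -/
theorem prod_weight_dvd_eval (hn : 0 < n) (ζ : Fin n → Bˣ)
    (hζ : ∀ i, (ζ i : B) = algebraMap (WeightRing n) B (zeta i))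
    {P : MvPolynomial (Fin ℓ) (SymRing (2 * n))} (hP : P ∈ solutionModule (2 * n) ℓ)
    (x : Fin ℓ → Fin n × ℤˣ) :
    ∏ i ∈ Finset.univ.image fun a => (x a).1, algebraMap (WeightRing n) B (weight i) ∣
      MvPolynomial.eval (fun a => gridPoint ζ (x a)) (MvPolynomial.map
        ((algebraMap (WeightRing n) B).comp (psi n : SymRing (2 * n) →+* WeightRing n)) P) := by
  set φ := (algebraMap (WeightRing n) B).comp (psi n : SymRing (2 * n) →+* WeightRing n) with hφ
  -- A power of `denom` clears the denominators of the value; it then suffices that each `theta i`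
  -- kills the numerator `f`.
  obtain ⟨m, f, hf⟩ := IsLocalization.Away.surj (denom n)
    (MvPolynomial.eval (fun a => gridPoint ζ (x a)) (MvPolynomial.map φ P))
  have hunit : IsUnit (algebraMap (WeightRing n) B (denom n) ^ m) :=
    (IsLocalization.Away.algebraMap_isUnit (denom n)).pow m
  rw [← hunit.dvd_mul_right, hf, ← map_prod]
  refine map_dvd _ (prod_weight_dvd _ fun i hi => ?_)
  obtain ⟨a, -, rfl⟩ := Finset.mem_image.1 hi
  set i := (x a).1
  let K := AlgebraicClosure (FractionRing (WeightRing n))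
  have hinj : Function.Injective (algebraMap (WeightRing n) K) := by
    rw [IsScalarTower.algebraMap_eq (WeightRing n) (FractionRing (WeightRing n)) K]
    exact (algebraMap (FractionRing (WeightRing n)) K).injective.comp
      (IsFractionRing.injective (WeightRing n) (FractionRing (WeightRing n)))
  have hz : algebraMap (WeightRing n) K (zeta i) ≠ 0 := fun h =>
    zeta_ne_zero i (hinj (h.trans (map_zero _).symm))
  let g : WeightRing n →+* K := (algebraMap (WeightRing n) K).comp (theta i : WeightRing n →+* _)
  have hg : ∀ w, g w = algebraMap (WeightRing n) K (theta i w) := fun _ => rfl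
  have hgd : IsUnit (g (denom n)) := by
    rw [hg, theta_denom, isUnit_iff_ne_zero]
    exact fun h => denom_ne_zero n (hinj (h.trans (map_zero _).symm))
  -- Since `theta i` fixes `denom`, it extends to the localization. It also kills `weight i`, so
  -- after this map `v_0` and `v_1` have the common zero `ζ_i⁻¹`.
  let Θ : B →+* K := IsLocalization.Away.lift (denom n) hgd
  have hΘ : ∀ w, Θ (algebraMap (WeightRing n) B w) = g w := fun w =>
    IsLocalization.Away.lift_eq (denom n) hgd w
  let φ' : SymRing (2 * n) →ₐ[ℂ] K :=
    (IsScalarTower.toAlgHom ℂ (WeightRing n) K).comp ((theta i).comp (psi n))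
  have hφ' : (φ' : SymRing (2 * n) →+* K) = g.comp (psi n : SymRing (2 * n) →+* WeightRing n) := rfl
  have hgz : ∀ j, g (zeta j) = algebraMap (WeightRing n) K (zeta j) := fun j => by
    rw [hg, theta_zeta]
  have h0 : ((vZero n).map (φ' : SymRing (2 * n) →+* K)).eval
      (algebraMap (WeightRing n) K (zeta i))⁻¹ = 0 := by
    rw [hφ', ← Polynomial.map_map, map_psi_vZero, Polynomial.map_prod, Polynomial.eval_prod]
    refine Finset.prod_eq_zero (Finset.mem_univ i) ?_
    simp [hgz, hz]
  have h1 : ((vElt n 1).map (φ' : SymRing (2 * n) →+* K)).eval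
      (algebraMap (WeightRing n) K (zeta i))⁻¹ = 0 := by
    rw [hφ', ← Polynomial.map_map, map_psi_vElt_one, Polynomial.map_sum,
      Polynomial.eval_finsetSum]
    have h := sum_map_uVar_mul_inv_pow g i
      (u := (algebraMap (WeightRing n) K (zeta i))⁻¹) (by rw [hgz, mul_inv_cancel₀ hz])
    rw [hg (weight i), theta_weight, sub_self, map_zero, zero_mul] at h
    rw [← h]
    refine Finset.sum_congr rfl fun s _ => ?_
    simp
  have hΘζ : Θ (↑(ζ i)⁻¹ : B) = (algebraMap (WeightRing n) K (zeta i))⁻¹ := by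
    refine eq_inv_of_mul_eq_one_left ?_
    rw [← hgz, ← hΘ, ← hζ, ← map_mul, Units.inv_mul, map_one]
  have hev := eval_map_eq_zero_of_mem_solutionModule hn φ' hz h0 h1 hP
    (fun a => Θ (gridPoint ζ (x a))) a (x a).2 (by
      rw [gridPoint, map_mul, hΘζ, map_intCast])
  have hcomp : Θ (MvPolynomial.eval (fun a => gridPoint ζ (x a)) (MvPolynomial.map φ P)) = 0 := by
    rw [← hev, MvPolynomial.eval_map, MvPolynomial.eval_map, MvPolynomial.eval₂_comp_left]
    have : Θ.comp φ = (φ' : SymRing (2 * n) →+* K) := RingHom.ext fun r => hΘ _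
    rw [this]
    rfl
  refine hinj ?_
  rw [← hg, ← hΘ, ← hf, map_mul, hcomp, zero_mul, map_zero]

theorem map_mem_span_map_basisElt [IsDomain B] [Algebra ℚ B] (hn : 0 < n)
    {P : MvPolynomial (Fin ℓ) (SymRing (2 * n))} (hP : P ∈ solutionModule (2 * n) ℓ) :
    MvPolynomial.map
      ((algebraMap (WeightRing n) B).comp (psi n : SymRing (2 * n) →+* WeightRing n)) P ∈
    Submodule.span B (Set.range fun t : BasisIndex n ℓ => MvPolynomial.map
      ((algebraMap (WeightRing n) B).comp (psi n : SymRing (2 * n) →+* WeightRing n))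
        (basisElt t)) := by
  set φ := (algebraMap (WeightRing n) B).comp (psi n : SymRing (2 * n) →+* WeightRing n) with hφ
  have hden : IsUnit (algebraMap (WeightRing n) B (denom n)) :=
    IsLocalization.Away.algebraMap_isUnit (denom n)
  choose ζ hζ using fun i : Fin n => isUnit_of_dvd_unit
    (map_dvd (algebraMap (WeightRing n) B) (zeta_dvd_denom i)) hden
  have hsq : ∀ i, sq ζ i = algebraMap (WeightRing n) B (zeta i ^ 2) := fun i => by
    rw [sq, hζ, map_pow]
  have hη : ∀ i j, i ≠ j → IsUnit (sq ζ i - sq ζ j) := fun i j hij => by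
    rw [hsq, hsq, ← map_sub]
    exact isUnit_of_dvd_unit (map_dvd _ (zeta_sq_sub_zeta_sq_dvd_denom hij)) hden
  obtain ⟨g, hg⟩ := exists_evenBasis_expansion ζ hη
  have hg' := hg fun s => algebraMap (WeightRing n) B (uVar n s)
  refine mem_span_map_basisElt (φ := φ) ζ hη ?_ (Eq.trans ?_ hg') _ (fun σ => ?_)
    (fun m hm a => ?_) fun x => ?_
  · rw [hφ, ← Polynomial.map_map, map_psi_vZero, Polynomial.map_prod]
    refine Finset.prod_congr rfl fun j _ => ?_
    simp [hsq]
  · rw [hφ, ← Polynomial.map_map, map_psi_vElt_one, Polynomial.map_sum]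
    refine Finset.sum_congr rfl fun s _ => ?_
    simp
  · rw [← MvPolynomial.map_rename, hP.1.1, map_zsmul]
  · exact hP.1.2 m (MvPolynomial.support_map_subset _ _ hm) a
  -- The coefficient of `E_i` in `v_1` is `weight i` times a unit, so the two products of weights
  -- agree up to units.
  · refine Dvd.dvd.trans ?_ (prod_weight_dvd_eval hn ζ hζ hP x)
    refine Finset.prod_dvd_prod_of_dvd _ _ fun i _ => ?_
    rw [sum_map_uVar_mul_inv_pow (algebraMap (WeightRing n) B) i (by rw [← hζ, Units.mul_inv]),
      ← mul_assoc, mul_comm]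
    have h1 : IsUnit ((↑(ζ i)⁻¹ : B) ^ (2 * (n - 1))) := (Units.isUnit _).pow _
    rw [h1.mul_left_dvd, (g i).isUnit.mul_left_dvd]

end Localization

/-- Two expansions are compared: one over the localization, and one over `R` for the multiple of `P`
by the determinant. Their coefficients must be proportional, and the determinant can be divided out
of those over `R`. -/
theorem mem_span_basisElt {P : MvPolynomial (Fin ℓ) (SymRing (2 * n))}
    (hP : P ∈ solutionModule (2 * n) ℓ) :
    P ∈ Submodule.span (SymRing (2 * n)) (Set.range fun t : BasisIndex n ℓ => basisElt t) := by
  rcases Nat.eq_zero_or_pos n with rfl | hn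
  · have := mem_span_map_basisElt (B := SymRing (2 * 0)) (φ := RingHom.id _) (β := fun _ => 1)
      (fun _ => 1) (fun i => i.elim0) (by simp [vZero, elemSym_zero]) (by simp [vElt]) P hP.1.1
      hP.1.2 fun x => by simp
    simpa only [MvPolynomial.map_id, RingHom.id_apply] using this
  let B := Localization.Away (denom n)
  have hle : Submonoid.powers (denom n) ≤ nonZeroDivisors (WeightRing n) :=
    powers_le_nonZeroDivisors_of_noZeroDivisors (denom_ne_zero n)
  have hdom : IsDomain B := IsLocalization.isDomain_localization hle
  have hinjB : Function.Injective (algebraMap (WeightRing n) B) := IsLocalization.injective B hle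
  let φ := (algebraMap (WeightRing n) B).comp (psi n : SymRing (2 * n) →+* WeightRing n)
  have hφinj : Function.Injective φ := hinjB.comp (psi_injective n)
  have hd := nilHom_coeffDet_ne_zero n ℓ
  have hd0 : coeffDet n ℓ ≠ 0 := fun h => hd (by rw [h, map_zero])
  have hdB : φ (coeffDet n ℓ) ≠ 0 := fun h => hd0 (hφinj (h.trans (map_zero _).symm))
  obtain ⟨b, hb⟩ := (Submodule.mem_span_range_iff_exists_fun B).1
    (map_mem_span_map_basisElt (B := B) hn hP)
  obtain ⟨c, hc⟩ := exists_coeffDet_smul_eq hP.1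
  have hlin := Fintype.linearIndependent_iff.1 (linearIndependent_map_basisElt φ hdB)
    (fun t => φ (coeffDet n ℓ) * b t - φ (c t)) (by
      have h := congrArg (MvPolynomial.map φ) hc
      rw [MvPolynomial.smul_eq_C_mul, map_mul, MvPolynomial.map_C, ← hb, map_sum,
        Finset.mul_sum] at h
      rw [← sub_eq_zero, ← Finset.sum_sub_distrib] at h
      rw [← h]
      refine Finset.sum_congr rfl fun t _ => ?_
      rw [sub_smul, MvPolynomial.smul_eq_C_mul (basisElt t), map_mul, MvPolynomial.map_C,
        MvPolynomial.smul_eq_C_mul, MvPolynomial.smul_eq_C_mul, MvPolynomial.smul_eq_C_mul,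
        map_mul, mul_assoc])
  have hdvd : ∀ t, coeffDet n ℓ ∣ c t := fun t => by
    obtain ⟨m, f, hf⟩ := IsLocalization.Away.surj (denom n) (b t)
    -- Here `f` is the numerator of the coefficient `b t`, and `m` the power of `denom` in its
    -- denominator.
    refine dvd_of_psi_dvd hd m ⟨f, hinjB ?_⟩
    have h := sub_eq_zero.1 (hlin t)
    rw [map_mul, map_mul, map_pow, ← hf]
    have h2 : algebraMap (WeightRing n) B (psi n (c t)) =
      algebraMap (WeightRing n) B (psi n (coeffDet n ℓ)) * b t := h.symm
    rw [h2]
    ring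
  choose q hq using hdvd
  have hPq : P = ∑ t, q t • basisElt t := by
    have hC : (MvPolynomial.C (coeffDet n ℓ) : MvPolynomial (Fin ℓ) (SymRing (2 * n))) ≠ 0 :=
      MvPolynomial.C_ne_zero.2 hd0
    refine mul_left_cancel₀ hC ?_
    rw [← MvPolynomial.smul_eq_C_mul, ← MvPolynomial.smul_eq_C_mul, hc, Finset.smul_sum]
    exact Finset.sum_congr rfl fun t _ => by rw [hq t, mul_smul]
  rw [hPq]
  exact Submodule.sum_mem _ fun t _ => Submodule.smul_mem _ _ (Submodule.subset_span ⟨t, rfl⟩)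

/-- The family `v_I ∧ w_J ∧ ξ_K` as a basis of `U`. -/
def solutionBasis (n ℓ : ℕ) :
    Module.Basis (BasisIndex n ℓ) (SymRing (2 * n)) (solutionModule (2 * n) ℓ) :=
  Module.Basis.mk (v := fun t => ⟨basisElt t, basisElt_mem_solutionModule t⟩)
    (by
      refine LinearIndependent.of_comp (solutionModule (2 * n) ℓ).subtype ?_
      have h := linearIndependent_map_basisElt (RingHom.id (SymRing (2 * n)))
        (n := n) (ℓ := ℓ) (fun h => nilHom_coeffDet_ne_zero n ℓ (by
          rw [RingHom.id_apply] at h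
          rw [h, map_zero]))
      simp only [MvPolynomial.map_id] at h
      exact h)
    (by
      rintro ⟨P, hP⟩ -
      obtain ⟨c, hc⟩ := (Submodule.mem_span_range_iff_exists_fun _).1 (mem_span_basisElt hP)
      exact (Submodule.mem_span_range_iff_exists_fun _).2 ⟨c, Subtype.ext (by simpa using hc)⟩)

end WedgeSpan

end

theorem mainTheorem2 (n ℓ : ℕ) :
    Module.Free (SymRing (2 * n)) (solutionModule (2 * n) ℓ) ∧
    Module.rank (SymRing (2 * n)) (solutionModule (2 * n) ℓ) = ((2 * n).choose ℓ : Cardinal) ∧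
    ∃ b : Module.Basis (BasisIndex n ℓ) (SymRing (2 * n)) (solutionModule (2 * n) ℓ),
      ∀ t : BasisIndex n ℓ,
        (b t : MvPolynomial (Fin ℓ) (SymRing (2 * n))) = basisElt t := by
  refine ⟨Module.Free.of_basis (WedgeSpan.solutionBasis n ℓ), ?_, WedgeSpan.solutionBasis n ℓ,
    fun t => ?_⟩
  · rw [rank_eq_card_basis (WedgeSpan.solutionBasis n ℓ), WedgeSpan.card_basisIndex]
  · rw [WedgeSpan.solutionBasis, Module.Basis.mk_apply]
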